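/- \textbf{Definitions.} A composition of a positive integer $n$ is a list $\alpha=(a_1,\dots,a_k)$ of positive integers with sum $|\alpha|=n$ (its size); $k$ is its length. Its reversal is $\alpha^*=(a_k,\dots,a_1)$, and $\alpha$ is symmetric if $\alpha=\alpha^*$ and lexicographic minimal if $\alpha\le\alpha^*$ in the lexicographic order. The near concatenation of $\alpha=(a_1,\dots,a_k)$ and $\beta=(b_1,\dots,b_\ell)$ is $\alpha\odot\beta=(a_1,\dots,a_{k-1},a_k+b_1,b_2,\dots,b_\ell)$, and $\alpha\circ\beta=\beta^{\odot a_1}\cdot\beta^{\odot a_2}\cdots\beta^{\odot a_k}$, where $\cdot$ is concatenation and $\beta^{\odot m}=\beta\odot\cdots\odot\beta$ ($m$ factors). A factorisation $\beta\circ\gamma$ is trivial if one of $\beta,\gamma$ is $(1)$, or both have length $1$, or both have all components equal to $1$. A factorisation $\alpha=\alpha_1\circ\cdots\circ\alpha_k$ ($k\ge1$) is irreducible if no $\alpha_i\circ\alpha_{i+1}$ is a trivial factorisation and each $\alpha_i$ admits only trivial factorisations into two compositions. A composition is normalised if all factors of its (unique) irreducible factorisation are lexicographic minimal. A ribbon is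 a pair of partitions $\mu\subseteq\lambda$ such that $\mu$ has fewer parts than $\lambda$ and $\lambda_{i+1}=\mu_i+1$ for all $i\ge1$ such that $\lambda$ has at least $i+1$ parts (with $\mu_i=0$ when $i$ exceeds the number of parts of $\mu$); its size is $|\lambda|-|\mu|$. Its ribbon Schur function is the skew Schur function $s_{\lambda/\mu}=\sum_T\prod_{c}x_{T(c)}$ in infinitely many variables, the sum over all semistandard tableaux $T$ of shape $\lambda/\mu$ and the product over the cells $c$ of $\lambda/\mu$. For functions on the positive integers, $(f*g)(n)=\sum_{d\mid n}f(d)g(n/d)$ is the Dirichlet convolution, and $f^{-1}$ denotes the inverse of $f$ with respect to it. Dirichlet series are formal. \textbf{Theorem.} The function $n\mapsto 2^{n-1}+2^{\lfloor n/2\rfloor}$ is invertible with respect to Dirichlet convolution (over $\mathbb{Q}$), and for every $n\ge1$ the number of normalised compositions of size $n$ is the value at $n$ of $$2\cdot 2^{n-1} * 2^{\lfloor n/2\rfloor} * \left(2^{n-1}+2^{\lfloor n/2\rfloor}\right)^{-1}.$$ Equivalently, let $R(s)$, $C(s)$, $S(s)$ be the formal Dirichlet generating functions $\sum_\alpha|\alpha|^{-s}$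 of the normalised, of all, and of the symmetric compositions. Then $C(s)+S(s)$ is invertible and $$R(s)=\frac{2\,C(s)\,S(s)}{C(s)+S(s)},$$ where $C(s)=\sum_{n\ge1}2^{n-1}n^{-s}$ and $S(s)=\sum_{n\ge1}2^{\lfloor n/2\rfloor}n^{-s}$. Moreover, for every $n\ge1$ the set of ribbon Schur functions of size $n$ is finite, and the number of its elements (the number of distinct ribbon Schur functions of size $n$) equals the number of normalised compositions of size $n$. -/

import Mathlib

namespace RibbonCount

/-! ### Compositions and their composition product

A composition is represented by its list of components. -/

/-- `l` is a composition of a positive integer: a nonempty list of positive integers. -/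
def IsComp (l : List ℕ) : Prop := l ≠ [] ∧ ∀ a ∈ l, 0 < a

/-- Near concatenation
`(a₁, …, aₖ) ⊙ (b₁, …, bₗ) = (a₁, …, aₖ₋₁, aₖ + b₁, b₂, …, bₗ)`;
the empty list is neutral. -/
def nearConcat : List ℕ → List ℕ → List ℕ
  | [], β => β
  | [a], [] => [a]
  | [a], b :: β => (a + b) :: β
  | a :: a' :: α, β => a :: nearConcat (a' :: α) β

/-- The `k`-fold near concatenation `β ⊙ β ⊙ ⋯ ⊙ β`. -/
def nearPow (β : List ℕ) : ℕ → List ℕ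
  | 0 => []
  | k + 1 => nearConcat β (nearPow β k)

/-- The composition product: `(a₁, …, aₖ) ∘ β` is the concatenation of the `aᵢ`-fold near
concatenations of `β`, for `i = 1, …, k`. -/
def compose (α β : List ℕ) : List ℕ := α.flatMap (nearPow β)

/-- A composition is symmetric if it coincides with its reversal. -/
def IsSymmetric (α : List ℕ) : Prop := α = α.reverse

/-- The factorisation `β ∘ γ` is trivial. -/
def IsTrivialFactorisation (β γ : List ℕ) : Prop :=
  (β = [1] ∨ γ = [1]) ∨
  (β.length = 1 ∧ γ.length = 1) ∨
  ((∀ b ∈ β, b = 1) ∧ (∀ c ∈ γ, c = 1))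

/-- `α` admits only trivial factorisations into two compositions. -/
def HasOnlyTrivialFactorisations (α : List ℕ) : Prop :=
  ∀ β γ : List ℕ, IsComp β → IsComp γ → compose β γ = α → IsTrivialFactorisation β γ

/-- `α = α₁ ∘ α₂ ∘ ⋯ ∘ αₖ`, with `L = [α₁, …, αₖ]` and `k ≥ 1`, is an irreducible factorisation:
no product of two consecutive factors is a trivial factorisation, and each factor admits
only trivial factorisations. (`[1]` is the neutral element of `∘`.) -/
def IsIrreducibleFactorisation (L : List (List ℕ)) (α : List ℕ) : Prop :=
  L ≠ [] ∧ (∀ δ ∈ L, IsComp δ) ∧ L.foldr compose [1] = α ∧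
  L.IsChain (fun β γ => ¬ IsTrivialFactorisation β γ) ∧
  ∀ δ ∈ L, HasOnlyTrivialFactorisations δ

/-- A composition is lexicographic minimal if it is at most its reversal in the lexicographic
order. (`≤` on `List ℕ` is the lexicographic order; both lists have the same length.) -/
def IsLexMin (α : List ℕ) : Prop := α ≤ α.reverse

/-- A composition is normalised if all factors in its (unique) irreducible factorisation are
lexicographic minimal. -/
def IsNormalised (α : List ℕ) : Prop :=
  ∃ L : List (List ℕ), IsIrreducibleFactorisation L α ∧ ∀ δ ∈ L, IsLexMin δ

/-! ### Dirichlet generating functions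

The coefficients below grow exponentially, so Dirichlet series are formal: the ring of formal
Dirichlet series over `ℚ` is the ring `ArithmeticFunction ℚ`, whose multiplication is Dirichlet
convolution. -/

/-- The number of compositions of `n` with property `P`. -/
noncomputable def numComps (P : List ℕ → Prop) (n : ℕ) : ℕ :=
  Nat.card {c : Composition n // P c.blocks}

/-- The formal Dirichlet generating function `∑ |α|⁻ˢ`, the sum over all compositions `α` (of
positive integers) with property `P`. -/
noncomputable def dirichletGF (P : List ℕ → Prop) : ArithmeticFunction ℚ :=
  ⟨fun n => if n = 0 then 0 else (numComps P n : ℚ), if_pos rfl⟩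

/-- The arithmetic function `n ↦ 2 ^ (n - 1)`, for `n ≥ 1`. -/
def powPred : ArithmeticFunction ℚ :=
  ⟨fun n => if n = 0 then 0 else 2 ^ (n - 1), if_pos rfl⟩

/-- The arithmetic function `n ↦ 2 ^ ⌊n / 2⌋`, for `n ≥ 1`. -/
def powHalf : ArithmeticFunction ℚ :=
  ⟨fun n => if n = 0 then 0 else 2 ^ (n / 2), if_pos rfl⟩

/-! ### Ribbon Schur functions -/

/-- The cells of the skew shape `lam / mu`. -/
def skewCells (lam mu : YoungDiagram) : Finset (ℕ × ℕ) := lam.cells \ mu.cells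

/-- The filling `T` of the cells `D` (row index first, rows numbered downwards) is a semistandard
tableau: entries increase weakly along rows and strictly down columns. -/
def IsSemistandard (D : Finset (ℕ × ℕ)) (T : D → ℕ) : Prop :=
  (∀ p q : D, p.1.1 = q.1.1 → p.1.2 < q.1.2 → T p ≤ T q) ∧
  (∀ p q : D, p.1.2 = q.1.2 → p.1.1 < q.1.1 → T p < T q)

/-- The exponent vector of the monomial `∏ x_{T p}`, the product over the cells `p`. -/
noncomputable def content (D : Finset (ℕ × ℕ)) (T : D → ℕ) : ℕ →₀ ℕ :=
  ∑ p : D, Finsupp.single (T p) 1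

/-- The skew Schur function `s_{lam / mu}` in the variables `x₀, x₁, …`: the coefficient of a
monomial is the (finite) number of semistandard tableaux of shape `lam / mu` with that content. -/
noncomputable def skewSchur (lam mu : YoungDiagram) : MvPowerSeries ℕ ℤ := fun d =>
  (Nat.card {T : skewCells lam mu → ℕ //
    IsSemistandard (skewCells lam mu) T ∧ content (skewCells lam mu) T = d} : ℤ)

/-- The pair `lam`, `mu` is a ribbon: `mu ⊆ lam`, `mu` has fewer rows than `lam`, and any two
consecutive rows of `lam / mu` overlap in exactly one column (`λᵢ₊₁ = μᵢ + 1`, with `μᵢ = 0` if `i`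
exceeds the number of parts of `mu`). Here `colLen 0` is the number of rows. -/
def IsRibbon (lam mu : YoungDiagram) : Prop :=
  mu ≤ lam ∧ mu.colLen 0 < lam.colLen 0 ∧
  ∀ i, i + 1 < lam.colLen 0 → lam.rowLen (i + 1) = mu.rowLen i + 1

/-- The set of ribbon Schur functions of size `n`. -/
def ribbonSchurFunctions (n : ℕ) : Set (MvPowerSeries ℕ ℤ) :=
  {f | ∃ lam mu : YoungDiagram,
    IsRibbon lam mu ∧ (skewCells lam mu).card = n ∧ f = skewSchur lam mu}

end RibbonCount

namespace RibbonCount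

open PowerSeries

/-! ### Path series of a set of cuts -/

/-! A composition of `n` is encoded by its set of cuts `S`, the partial sums strictly between `0`
and `n`. Numbering the cells of a ribbon from its lower left end, a semistandard tableau becomes a
word that ascends weakly at the positions in `S` and descends strictly at the others. Inclusion and
exclusion (`total_neg_ribbonSum`) writes the generating function of these words, up to sign, as the
sum over all chains from `0` to `n` through elements of `S`, a step of length `i` having weight
`-eᵢ`. The `eᵢ` being algebraically independent, two ribbon Schur functions agree exactly if the
chain sums agree for independent weights (`Sim`); a possible sign is excluded by positivity.

The heart is `Sim.structure`. Let `P_S` be the generating series of the chains from `0` through `S`,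
and let `S*` be the reflected set. Differentiating equal chain sums gives `P_S P_{S*} = P_T P_{T*}`
modulo `X ^ n`, so `L = P_S / P_T` is also `P_{T*} / P_{S*}` there. Let `u` and `v` be the sum and
the difference of the asymmetries `χ(x) - χ(n - x)` of `S` and `T`. The terms of degree at most two
in the weights say that `u v = 0` and `(u x + u y - u (x + y)) (v x + v y - v (x + y)) = 0`.
Possibly after reflecting `T`, the function `u` is nonzero earlier than `v`. Arguments in the style
of Fine and Wilf then yield a divisor `m > 1` of `n` such that `v` lives on the multiples of `m` and
`u` is `m`-periodic off them. With the weights restricted to multiples of `m`, every exponent in the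
support of `L` turns out to be a period of `S` off the multiples of `m`. This comes from the lowest
terms of first and mixed second derivatives of `L`, computed from both ends of the interval. If `g`
is the gcd of that support, then `S` and `T` agree off the multiples of `g` and are `g`-periodic
there. In terms of compositions, `α = δ ∘ D` and, up to reversal, `β = δ' ∘ D` with `|D| = g`. The
right factor can be cancelled (`SimComp.of_compose`), and induction shows that similar compositions
arise from each other by reversing factors. Conversely such reversals preserve chain sums, because
the total of a product is a substitution (`total_mul`) and totals are invariant under reflection.

Irreducible factorisations are unique (`Reduced.unique`): last factors coincide or are both of the
form `(k)` or both of the form `(1, …, 1)`, again by Fine and Wilf and the Chinese remainder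
theorem. Hence every similarity class contains exactly one normalised composition.

For the count, let the letters of reduced words be restricted to a class containing the two constant
families `(k)` and `(1, …, 1)`, and let `M` be the Dirichlet series of its nonconstant irreducible
letters. Then the series `W` of the words satisfies `W (2 μ - 1 - M) = 1`. All, symmetric and
lexicographic minimal letters give `C`, `S` and `R`. Since a letter and its reversal are both
minimal only if they coincide, `2 M_R = M_C + M_S`, that is, `2 / R = 1 / C + 1 / S`. -/

/-- The indicator function of a set of cuts. -/
noncomputable def chi (S : Set ℕ) (s : ℕ) : ℤ := open Classical in if s ∈ S then 1 else 0

theorem chi_of_mem {S : Set ℕ} {s : ℕ} (h : s ∈ S) : chi S s = 1 := if_pos h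

theorem chi_of_notMem {S : Set ℕ} {s : ℕ} (h : s ∉ S) : chi S s = 0 := if_neg h

theorem chi_eq_zero_or_one (S : Set ℕ) (s : ℕ) : chi S s = 0 ∨ chi S s = 1 := by
  by_cases h : s ∈ S
  · exact Or.inr (chi_of_mem h)
  · exact Or.inl (chi_of_notMem h)

theorem chi_congr {S T : Set ℕ} {s t : ℕ} (h : s ∈ S ↔ t ∈ T) : chi S s = chi T t := by
  by_cases hs : s ∈ S
  · rw [chi_of_mem hs, chi_of_mem (h.1 hs)]
  · rw [chi_of_notMem hs, chi_of_notMem (fun ht => hs (h.2 ht))]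

theorem chi_eq_iff {S T : Set ℕ} {s t : ℕ} : chi S s = chi T t ↔ (s ∈ S ↔ t ∈ T) := by
  refine ⟨fun h => ?_, chi_congr⟩
  by_cases hs : s ∈ S <;> by_cases ht : t ∈ T <;>
    simp_all [chi_of_mem, chi_of_notMem]

section Series

variable {A B : Type*} [CommRing A] [CommRing B]

/-- The weighted sum over all chains `0 = r₀ < r₁ < ⋯ < rₖ = s` with `r₁, …, rₖ ∈ S`, where a step of
length `i` has weight `x i`. -/
noncomputable def pathSum (S : Set ℕ) (x : ℕ → A) : ℕ → A
  | 0 => 1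
  | s + 1 => (chi S (s + 1) : A) * ∑ r : Fin (s + 1), pathSum S x r * x (s + 1 - r)

/-- The generating series of the weights of steps. -/
noncomputable def stepSeries (x : ℕ → A) : A⟦X⟧ := mk fun i => if i = 0 then 0 else x i

/-- The generating series of the path sums. -/
noncomputable def pathSeries (S : Set ℕ) (x : ℕ → A) : A⟦X⟧ := mk (pathSum S x)

theorem coeff_stepSeries {x : ℕ → A} {i : ℕ} (h : i ≠ 0) : coeff i (stepSeries x) = x i := by
  simp [stepSeries, h]

@[simp] theorem coeff_zero_stepSeries (x : ℕ → A) : coeff 0 (stepSeries x) = 0 := by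
  simp [stepSeries]

@[simp] theorem constantCoeff_stepSeries (x : ℕ → A) : constantCoeff (stepSeries x) = 0 := by
  simp [← coeff_zero_eq_constantCoeff_apply]

@[simp] theorem coeff_zero_pathSeries (S : Set ℕ) (x : ℕ → A) : coeff 0 (pathSeries S x) = 1 := by
  simp [pathSeries, pathSum]

@[simp] theorem constantCoeff_pathSeries (S : Set ℕ) (x : ℕ → A) :
    constantCoeff (pathSeries S x) = 1 := by
  rw [← coeff_zero_eq_constantCoeff_apply, coeff_zero_pathSeries]

theorem coeff_mul_congr {p q W : A⟦X⟧} {n : ℕ} (hW : coeff 0 W = 0)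
    (h : ∀ k < n, coeff k p = coeff k q) : coeff n (p * W) = coeff n (q * W) := by
  rw [coeff_mul, coeff_mul]
  refine Finset.sum_congr rfl fun ij hij => ?_
  rw [Finset.HasAntidiagonal.mem_antidiagonal] at hij
  by_cases h0 : ij.2 = 0
  · rw [h0, hW]; simp
  · rw [h _ (by omega)]

theorem coeff_mul_congr_le {p q W : A⟦X⟧} {n : ℕ}
    (h : ∀ k ≤ n, coeff k p = coeff k q) : coeff n (p * W) = coeff n (q * W) := by
  rw [coeff_mul, coeff_mul]
  refine Finset.sum_congr rfl fun ij hij => ?_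
  rw [Finset.HasAntidiagonal.mem_antidiagonal] at hij
  rw [h _ (by omega)]

/-- Splitting off the last step of a chain: off degree `0`, the series `P` is the part of `P W` on
`S`. All later computations with path series use only this recursion and the constant term `1`. -/
theorem coeff_pathSeries (S : Set ℕ) (x : ℕ → A) {s : ℕ} (hs : s ≠ 0) :
    coeff s (pathSeries S x) = (chi S s : A) * coeff s (pathSeries S x * stepSeries x) := by
  obtain ⟨s, rfl⟩ := Nat.exists_eq_succ_of_ne_zero hs
  rw [pathSeries, coeff_mk, pathSum, coeff_mul, Finset.Nat.sum_antidiagonal_eq_sum_range_succ_mk,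
    Finset.sum_range_succ, ← Fin.sum_univ_eq_sum_range
      (fun r => coeff r (mk (pathSum S x)) * coeff (s + 1 - r) (stepSeries x))]
  simp only [Nat.succ_eq_add_one, Nat.sub_self, coeff_zero_stepSeries, mul_zero, add_zero]
  congr 1
  refine Finset.sum_congr rfl fun r _ => ?_
  rw [coeff_mk, coeff_stepSeries]
  have := r.2; omega

/-- As `W` has no constant term, the recursion determines each coefficient from lower ones. It is
only required below `n`, since the membership of `n` itself plays no role. -/
theorem coeff_eq_coeff_pathSeries {S : Set ℕ} {x : ℕ → A} {p : A⟦X⟧} {n : ℕ} (h0 : coeff 0 p = 1)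
    (h : ∀ s, 0 < s → s < n → coeff s p = (chi S s : A) * coeff s (p * stepSeries x)) :
    ∀ s < n, coeff s p = coeff s (pathSeries S x) := by
  intro s
  induction s using Nat.strong_induction_on with
  | _ s ih =>
    intro hs
    rcases Nat.eq_zero_or_pos s with rfl | hs0
    · simpa using h0
    · rw [h s hs0 hs, coeff_pathSeries S x hs0.ne',
        coeff_mul_congr (coeff_zero_stepSeries x) fun k hk => ih k hk (hk.trans hs)]

theorem map_stepSeries (φ : A →+* B) (x : ℕ → A) :
    PowerSeries.map φ (stepSeries x) = stepSeries (fun i => φ (x i)) := by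
  ext i
  by_cases h : i = 0 <;> simp [stepSeries, h]

theorem map_pathSeries (φ : A →+* B) (S : Set ℕ) (x : ℕ → A) :
    PowerSeries.map φ (pathSeries S x) = pathSeries S (fun i => φ (x i)) := by
  ext s
  refine coeff_eq_coeff_pathSeries (n := s + 1) (by simp) (fun t ht _ => ?_) s s.lt_succ_self
  rw [← map_stepSeries, ← _root_.map_mul, coeff_map, coeff_map, coeff_pathSeries S x ht.ne',
    _root_.map_mul, map_intCast]

/-- The weighted sum over all chains from `0` to `n` with intermediate elements in `S`. -/
noncomputable def total (n : ℕ) (S : Set ℕ) (x : ℕ → A) : A :=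
  coeff n (pathSeries S x * stepSeries x)

theorem map_total (φ : A →+* B) (n : ℕ) (S : Set ℕ) (x : ℕ → A) :
    φ (total n S x) = total n S (fun i => φ (x i)) := by
  rw [total, total, ← map_stepSeries, ← map_pathSeries, ← _root_.map_mul, coeff_map]

/-- The reflection of a set of cuts of an interval of length `n`. -/
def refl (n : ℕ) (S : Set ℕ) : Set ℕ := {x | n - x ∈ S}

theorem chi_refl (n : ℕ) (S : Set ℕ) (x : ℕ) : chi (refl n S) x = chi S (n - x) :=
  chi_congr Iff.rfl

/-- A chain recursion with a source `g` can be evaluated from the other end: what enters at a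
position is carried to `n` by chains which, read backwards from `n`, run through the reflected cuts.
This converts every derivative of a total into a product of path series. -/
theorem coeff_add_coeff_eq_coeff_mul {n : ℕ} {S : Set ℕ} {x : ℕ → A} {D g : A⟦X⟧}
    (hD0 : coeff 0 D = 0) (hg0 : coeff 0 g = 0)
    (hD : ∀ s, 0 < s → s < n → coeff s D = (chi S s : A) * coeff s (D * stepSeries x + g)) :
    coeff n (D * stepSeries x + g) = coeff n (g * pathSeries (refl n S) x) := by
  rcases Nat.eq_zero_or_pos n with rfl | hn
  · simp_all
  set W := stepSeries x
  set Q := pathSeries (refl n S) x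
  -- For `0 < s < n` the summands `D_s (Q W)_{n-s}` and `(D W + g)_s Q_{n-s}` agree, both being
  -- `χ_S(s) (D W + g)_s (Q W)_{n-s}`. The end `s = n` gives the extra term on the left. Afterwards
  -- `D W Q` cancels.
  have key : coeff n (D * (Q * W)) + coeff n (D * W + g) = coeff n ((D * W + g) * Q) := by
    rw [coeff_mul, coeff_mul, Finset.Nat.sum_antidiagonal_eq_sum_range_succ_mk,
      Finset.Nat.sum_antidiagonal_eq_sum_range_succ_mk, Finset.sum_range_succ,
      Finset.sum_range_succ (n := n)]
    simp only [Nat.sub_self]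
    have h0 : coeff 0 Q = 1 := coeff_zero_pathSeries _ _
    have h1 : coeff 0 (Q * W) = 0 := by simp [W]
    rw [h0, h1, mul_zero, add_zero, mul_one]
    congr 1
    refine Finset.sum_congr rfl fun s hs => ?_
    rw [Finset.mem_range] at hs
    rcases Nat.eq_zero_or_pos s with rfl | hs0
    · have : coeff 0 (D * W + g) = 0 := by simp [W] at hg0 ⊢; exact hg0
      rw [hD0, this]; simp
    · rw [coeff_pathSeries (refl n S) x (by omega : n - s ≠ 0), chi_refl, hD s hs0 hs,
        show n - (n - s) = s by omega]
      ring
  have e : D * (Q * W) = D * W * Q := by ring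
  rw [e, add_mul, map_add _ (D * stepSeries x * Q)] at key
  exact add_left_cancel key

/-- Chains are read backwards; formally, the source is a first step and the recursion is that of `P
- 1`. -/
theorem total_refl {n : ℕ} (S : Set ℕ) (x : ℕ → A) : total n (refl n S) x = total n S x := by
  have h := coeff_add_coeff_eq_coeff_mul (n := n) (S := S) (x := x) (D := pathSeries S x - 1)
    (g := stepSeries x) (by simp) (by simp) (fun s hs _ => by
      rw [sub_mul, one_mul, sub_add_cancel, map_sub, coeff_pathSeries S x hs.ne', coeff_one,
        if_neg hs.ne', sub_zero])
  rw [sub_mul, one_mul, sub_add_cancel] at h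
  rw [total, total, h, mul_comm]

/-! ### Derivatives of totals by means of dual numbers -/

/-- The coefficientwise derivative of a power series over the dual numbers. -/
noncomputable def epsPart (p : (DualNumber A)⟦X⟧) : A⟦X⟧ := mk fun k => (coeff k p).snd

/-- The coefficientwise constant part of a power series over the dual numbers. -/
noncomputable def basePart (p : (DualNumber A)⟦X⟧) : A⟦X⟧ := mk fun k => (coeff k p).fst

@[simp] theorem coeff_epsPart (p : (DualNumber A)⟦X⟧) (k : ℕ) :
    coeff k (epsPart p) = (coeff k p).snd := coeff_mk _ _

@[simp] theorem coeff_basePart (p : (DualNumber A)⟦X⟧) (k : ℕ) :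
    coeff k (basePart p) = (coeff k p).fst := coeff_mk _ _

theorem basePart_eq_map (p : (DualNumber A)⟦X⟧) :
    basePart p = PowerSeries.map (TrivSqZeroExt.fstHom A A A).toRingHom p := by
  ext k
  simp

theorem basePart_mul (p q : (DualNumber A)⟦X⟧) : basePart (p * q) = basePart p * basePart q := by
  simp only [basePart_eq_map, _root_.map_mul]

theorem epsPart_mul (p q : (DualNumber A)⟦X⟧) :
    epsPart (p * q) = basePart p * epsPart q + epsPart p * basePart q := by
  ext k
  simp only [coeff_epsPart, coeff_mul, map_add, coeff_basePart, TrivSqZeroExt.snd_sum,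
    TrivSqZeroExt.snd_mul, smul_eq_mul, op_smul_eq_mul, Finset.sum_add_distrib]

theorem basePart_pathSeries (S : Set ℕ) (x : ℕ → DualNumber A) :
    basePart (pathSeries S x) = pathSeries S fun i => (x i).fst := by
  rw [basePart_eq_map, map_pathSeries]; rfl

theorem basePart_stepSeries (x : ℕ → DualNumber A) :
    basePart (stepSeries x) = stepSeries fun i => (x i).fst := by
  rw [basePart_eq_map, map_stepSeries]; rfl

theorem coeff_epsPart_pathSeries (S : Set ℕ) (x : ℕ → DualNumber A) {s : ℕ} (hs : s ≠ 0) :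
    coeff s (epsPart (pathSeries S x)) = (chi S s : A) *
      coeff s (epsPart (pathSeries S x) * basePart (stepSeries x) +
        basePart (pathSeries S x) * epsPart (stepSeries x)) := by
  rw [coeff_epsPart, coeff_pathSeries S x hs, add_comm, ← epsPart_mul, coeff_epsPart]
  simp [TrivSqZeroExt.snd_mul]

/-- Differentiation marks one step of a chain. The part before it is counted by the path series of
`S`, the part after it, read backwards from `n`, by that of the reflection. -/
theorem snd_total (n : ℕ) (S : Set ℕ) (x : ℕ → DualNumber A) :
    (total n S x).snd = coeff n (basePart (pathSeries S x) * epsPart (stepSeries x) *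
      pathSeries (refl n S) fun i => (x i).fst) := by
  rw [← coeff_add_coeff_eq_coeff_mul (D := epsPart (pathSeries S x)), total, ← coeff_epsPart,
    epsPart_mul, add_comm, basePart_stepSeries]
  · simp
  · simp [coeff_mul]
  · intro s hs _
    rw [← basePart_stepSeries]
    exact coeff_epsPart_pathSeries S x hs.ne'

theorem snd_total_single {n m : ℕ} (hm : 0 < m) (hmn : m ≤ n) (S : Set ℕ) (x : ℕ → A) :
    (total n S fun i => (TrivSqZeroExt.inl (x i) + TrivSqZeroExt.inr (if i = m then 1 else 0) :
      DualNumber A)).snd = coeff (n - m) (pathSeries S x * pathSeries (refl n S) x) := by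
  rw [snd_total, basePart_pathSeries]
  have : epsPart (stepSeries fun i => (TrivSqZeroExt.inl (x i) +
      TrivSqZeroExt.inr (if i = m then 1 else 0) : DualNumber A)) = X ^ m := by
    ext k
    rw [coeff_epsPart, coeff_X_pow]
    by_cases hk : k = 0
    · subst hk; simp [hm.ne]
    · rw [coeff_stepSeries hk]; split_ifs <;> simp
  rw [this]
  simp only [TrivSqZeroExt.fst_add, TrivSqZeroExt.fst_inl, TrivSqZeroExt.fst_inr, add_zero]
  rw [mul_right_comm, coeff_mul_X_pow', if_pos hmn]

end Series

/-! ### Similarity of sets of cuts -/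

/-- Two sets of cuts of an interval of length `n` are similar if their totals agree for
independent weights. -/
def Sim (n : ℕ) (S T : Set ℕ) : Prop :=
  total n S (MvPolynomial.X : ℕ → MvPolynomial ℕ ℤ) = total n T MvPolynomial.X

namespace Sim

variable {n : ℕ} {S T : Set ℕ} {A : Type*} [CommRing A]

theorem total_eq (h : Sim n S T) (x : ℕ → A) : total n S x = total n T x := by
  have := congrArg (MvPolynomial.aeval (R := ℤ) x).toRingHom h
  rw [map_total, map_total] at this
  simpa using this

protected theorem symm (h : Sim n S T) : Sim n T S := Eq.symm h

protected theorem trans {U : Set ℕ} (h : Sim n S T) (h' : Sim n T U) : Sim n S U := Eq.trans h h'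

protected theorem refl_right (h : Sim n S T) : Sim n S (refl n T) := h.trans (total_refl T _).symm

protected theorem refl_left (h : Sim n S T) : Sim n (refl n S) T := (total_refl S _).trans h

/-- The equal totals are differentiated with respect to the weight of a step of length `n - k`. The
resulting congruence modulo `X ^ n` is the main consequence of similarity, and it holds over every
ring, in particular over iterated dual numbers. -/
theorem coeff_mul_eq (h : Sim n S T) (x : ℕ → A) {k : ℕ} (hk : k < n) :
    coeff k (pathSeries S x * pathSeries (refl n S) x) =
      coeff k (pathSeries T x * pathSeries (refl n T) x) := by
  have h1 := snd_total_single (n := n) (m := n - k) (by omega) (by omega) S x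
  have h2 := snd_total_single (n := n) (m := n - k) (by omega) (by omega) T x
  rw [show n - (n - k) = k by omega] at h1 h2
  rw [← h1, ← h2, h.total_eq]

end Sim

end RibbonCount

namespace RibbonCount

open PowerSeries

/-! ### Weights with two square-zero perturbations -/

section BiDual

variable {A : Type*} [CommRing A]

/-- The weights `x` perturbed by a square-zero element at `e` and another one at `q`. -/
noncomputable def biWeight (x : ℕ → A) (e q : ℕ) (i : ℕ) : DualNumber (DualNumber A) :=
  TrivSqZeroExt.inl (TrivSqZeroExt.inl (x i) + TrivSqZeroExt.inr (if i = q then 1 else 0)) +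
    TrivSqZeroExt.inr (if i = e then 1 else 0)

theorem fst_biWeight (x : ℕ → A) (e q i : ℕ) : (biWeight x e q i).fst =
    (TrivSqZeroExt.inl (x i) + TrivSqZeroExt.inr (if i = q then 1 else 0) : DualNumber A) := by
  simp only [biWeight, TrivSqZeroExt.fst_add, TrivSqZeroExt.fst_inl, TrivSqZeroExt.fst_inr,
    add_zero]

theorem snd_biWeight (x : ℕ → A) (e q i : ℕ) : (biWeight x e q i).snd =
    (if i = e then 1 else 0 : DualNumber A) := by
  simp only [biWeight, TrivSqZeroExt.snd_add, TrivSqZeroExt.snd_inl, TrivSqZeroExt.snd_inr,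
    zero_add]

theorem fst_fst_biWeight (x : ℕ → A) (e q i : ℕ) : (biWeight x e q i).fst.fst = x i := by
  simp only [fst_biWeight, TrivSqZeroExt.fst_add, TrivSqZeroExt.fst_inl, TrivSqZeroExt.fst_inr,
    add_zero]

theorem snd_fst_biWeight (x : ℕ → A) (e q i : ℕ) :
    (biWeight x e q i).fst.snd = if i = q then 1 else 0 := by
  simp only [fst_biWeight, TrivSqZeroExt.snd_add, TrivSqZeroExt.snd_inl, TrivSqZeroExt.snd_inr,
    zero_add]

/-- The four coefficients of a power series over the iterated dual numbers. -/
noncomputable def part₀₀ (p : (DualNumber (DualNumber A))⟦X⟧) : A⟦X⟧ := basePart (basePart p)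
/-- The coefficient of the first perturbation. -/
noncomputable def part₁₀ (p : (DualNumber (DualNumber A))⟦X⟧) : A⟦X⟧ := basePart (epsPart p)
/-- The coefficient of the second perturbation. -/
noncomputable def part₀₁ (p : (DualNumber (DualNumber A))⟦X⟧) : A⟦X⟧ := epsPart (basePart p)
/-- The coefficient of the product of the perturbations. -/
noncomputable def part₁₁ (p : (DualNumber (DualNumber A))⟦X⟧) : A⟦X⟧ := epsPart (epsPart p)

theorem basePart_add (p q : (DualNumber A)⟦X⟧) : basePart (p + q) = basePart p + basePart q := by
  ext; simp

theorem epsPart_add (p q : (DualNumber A)⟦X⟧) : epsPart (p + q) = epsPart p + epsPart q := by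
  ext; simp

variable (p q : (DualNumber (DualNumber A))⟦X⟧)

theorem epsPart_stepSeries (x : ℕ → DualNumber A) :
    epsPart (stepSeries x) = stepSeries fun i => (x i).snd := by
  ext k
  by_cases hk : k = 0
  · subst hk; simp
  · rw [coeff_epsPart, coeff_stepSeries hk, coeff_stepSeries hk]

theorem stepSeries_single {m : ℕ} (hm : 0 < m) :
    stepSeries (fun i => if i = m then (1 : A) else 0) = X ^ m := by
  ext k
  rw [coeff_X_pow, stepSeries, coeff_mk]
  by_cases hk : k = 0
  · subst hk; simp [hm.ne]
  · rw [if_neg hk]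

theorem coeff_basePart_of_eq {p r : (DualNumber A)⟦X⟧} {s : ℕ} {c : ℤ}
    (h : coeff s p = (c : DualNumber A) * coeff s r) :
    coeff s (basePart p) = (c : A) * coeff s (basePart r) := by
  rw [coeff_basePart, h, coeff_basePart, TrivSqZeroExt.fst_mul, TrivSqZeroExt.fst_intCast]

theorem coeff_epsPart_of_eq {p r : (DualNumber A)⟦X⟧} {s : ℕ} {c : ℤ}
    (h : coeff s p = (c : DualNumber A) * coeff s r) :
    coeff s (epsPart p) = (c : A) * coeff s (epsPart r) := by
  rw [coeff_epsPart, h, coeff_epsPart, TrivSqZeroExt.snd_mul, TrivSqZeroExt.fst_intCast,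
    TrivSqZeroExt.snd_intCast, smul_zero, add_zero, smul_eq_mul]

theorem part₀₀_mul : part₀₀ (p * q) = part₀₀ p * part₀₀ q := by
  simp only [part₀₀, basePart_mul]

theorem part₁₀_mul : part₁₀ (p * q) = part₀₀ p * part₁₀ q + part₁₀ p * part₀₀ q := by
  simp only [part₀₀, part₁₀, basePart_mul, epsPart_mul, basePart_add]

theorem part₀₁_mul : part₀₁ (p * q) = part₀₀ p * part₀₁ q + part₀₁ p * part₀₀ q := by
  simp only [part₀₀, part₀₁, basePart_mul, epsPart_mul]

theorem part₁₁_mul : part₁₁ (p * q) =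
    part₀₀ p * part₁₁ q + part₀₁ p * part₁₀ q + part₁₀ p * part₀₁ q + part₁₁ p * part₀₀ q := by
  simp only [part₀₀, part₀₁, part₁₀, part₁₁, epsPart_mul, epsPart_add]
  ring

variable {p q}

theorem part_congr {k : ℕ} (h : coeff k p = coeff k q) :
    coeff k (part₀₀ p) = coeff k (part₀₀ q) ∧ coeff k (part₁₀ p) = coeff k (part₁₀ q) ∧
    coeff k (part₀₁ p) = coeff k (part₀₁ q) ∧ coeff k (part₁₁ p) = coeff k (part₁₁ q) := by
  simp [part₀₀, part₀₁, part₁₀, part₁₁, h]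

variable (S : Set ℕ) (x : ℕ → A) {e q : ℕ}

theorem part₀₀_stepSeries : part₀₀ (stepSeries (biWeight x e q)) = stepSeries x := by
  rw [part₀₀, basePart_stepSeries, basePart_stepSeries]
  simp only [fst_fst_biWeight]

theorem part₁₀_stepSeries (he : 0 < e) :
    part₁₀ (stepSeries (biWeight x e q)) = X ^ e := by
  rw [part₁₀, epsPart_stepSeries, basePart_stepSeries, ← stepSeries_single he]
  simp only [snd_biWeight, apply_ite TrivSqZeroExt.fst, TrivSqZeroExt.fst_one,
    TrivSqZeroExt.fst_zero]

theorem part₀₁_stepSeries (hq : 0 < q) :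
    part₀₁ (stepSeries (biWeight x e q)) = X ^ q := by
  rw [part₀₁, basePart_stepSeries, epsPart_stepSeries, ← stepSeries_single hq]
  simp only [snd_fst_biWeight]

theorem part₁₁_stepSeries : part₁₁ (stepSeries (biWeight x e q)) = 0 := by
  rw [part₁₁, epsPart_stepSeries, epsPart_stepSeries]
  ext k
  simp only [snd_biWeight, apply_ite TrivSqZeroExt.snd, TrivSqZeroExt.snd_one,
    TrivSqZeroExt.snd_zero, ite_self, stepSeries, coeff_mk, map_zero]

theorem part₀₀_pathSeries : part₀₀ (pathSeries S (biWeight x e q)) = pathSeries S x := by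
  rw [part₀₀, basePart_pathSeries, basePart_pathSeries]
  simp only [fst_fst_biWeight]

/-- The recursion for path series, differentiated in the weight at `e`, in the weight at `q`, and in
both. The product rule turns each derivative into the same recursion with a source. -/
theorem coeff_part_pathSeries (he : 0 < e) (hq : 0 < q) {s : ℕ} (hs : s ≠ 0) :
    coeff s (part₁₀ (pathSeries S (biWeight x e q))) = (chi S s : A) *
      coeff s (part₁₀ (pathSeries S (biWeight x e q)) * stepSeries x + pathSeries S x * X ^ e) ∧
    coeff s (part₀₁ (pathSeries S (biWeight x e q))) = (chi S s : A) *
      coeff s (part₀₁ (pathSeries S (biWeight x e q)) * stepSeries x + pathSeries S x * X ^ q) ∧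
    coeff s (part₁₁ (pathSeries S (biWeight x e q))) = (chi S s : A) *
      coeff s (part₁₁ (pathSeries S (biWeight x e q)) * stepSeries x +
        part₁₀ (pathSeries S (biWeight x e q)) * X ^ q +
        part₀₁ (pathSeries S (biWeight x e q)) * X ^ e) := by
  have key := coeff_pathSeries S (biWeight x e q) hs
  have k1 := coeff_basePart_of_eq (coeff_epsPart_of_eq key)
  have k2 := coeff_epsPart_of_eq (coeff_basePart_of_eq key)
  have k3 := coeff_epsPart_of_eq (coeff_epsPart_of_eq key)
  simp only [← part₁₀.eq_1, ← part₀₁.eq_1, ← part₁₁.eq_1] at k1 k2 k3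
  rw [part₁₀_mul, part₀₀_stepSeries, part₀₀_pathSeries, part₁₀_stepSeries x he, add_comm] at k1
  rw [part₀₁_mul, part₀₀_stepSeries, part₀₀_pathSeries, part₀₁_stepSeries x hq, add_comm] at k2
  rw [part₁₁_mul, part₀₀_stepSeries, part₀₀_pathSeries, part₀₁_stepSeries x hq,
    part₁₀_stepSeries x he, part₁₁_stepSeries] at k3
  refine ⟨k1, k2, k3.trans ?_⟩
  congr 2
  ring

theorem coeff_zero_part_pathSeries :
    coeff 0 (part₁₀ (pathSeries S (biWeight x e q))) = 0 ∧
    coeff 0 (part₀₁ (pathSeries S (biWeight x e q))) = 0 ∧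
    coeff 0 (part₁₁ (pathSeries S (biWeight x e q))) = 0 := by
  have key := coeff_zero_pathSeries S (biWeight x e q)
  refine ⟨?_, ?_, ?_⟩
  · rw [part₁₀, coeff_basePart, coeff_epsPart, key, TrivSqZeroExt.snd_one, TrivSqZeroExt.fst_zero]
  · rw [part₀₁, coeff_epsPart, coeff_basePart, key, TrivSqZeroExt.fst_one, TrivSqZeroExt.snd_one]
  · rw [part₁₁, coeff_epsPart, coeff_epsPart, key, TrivSqZeroExt.snd_one, TrivSqZeroExt.snd_zero]

end BiDual

/-! ### Asymmetries -/

/-- The difference of the indicator functions of a set of cuts and its reflection, as an odd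
function on `ℤ / n`. -/
noncomputable def skew (n : ℕ) (S : Set ℕ) (x : ℤ) : ℤ :=
  if (n : ℤ) ∣ x then 0 else chi S (x % n).toNat - chi S (n - (x % n).toNat)

theorem skew_add_self (n : ℕ) (S : Set ℕ) (x : ℤ) : skew n S (x + n) = skew n S x := by
  simp [skew]

theorem skew_of_dvd {n : ℕ} (S : Set ℕ) {x : ℤ} (h : (n : ℤ) ∣ x) : skew n S x = 0 := if_pos h

theorem skew_natCast {n : ℕ} (S : Set ℕ) {k : ℕ} (h0 : 0 < k) (hk : k < n) :
    skew n S k = chi S k - chi S (n - k) := by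
  have h1 : (k : ℤ) % n = k := Int.emod_eq_of_lt (by omega) (by omega)
  rw [skew, if_neg, h1, Int.toNat_natCast]
  intro h
  have := Int.emod_eq_zero_of_dvd h
  omega

theorem skew_neg {n : ℕ} (hn : 0 < n) (S : Set ℕ) (x : ℤ) : skew n S (-x) = -skew n S x := by
  by_cases h : (n : ℤ) ∣ x
  · rw [skew_of_dvd S h, skew_of_dvd S ((dvd_neg).2 h), neg_zero]
  · have h1 : (-x) % n = n - x % n := by
      have := Int.emod_nonneg x (by omega : (n : ℤ) ≠ 0)
      have h2 := Int.emod_lt_of_pos x (by omega : (0 : ℤ) < n)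
      have h3 : x % n ≠ 0 := fun h' => h (Int.dvd_of_emod_eq_zero h')
      have h4 : -x = (n - x % n) + n * (-(x / n) - 1) := by
        have := Int.emod_add_mul_ediv x n
        linear_combination this
      rw [h4, Int.add_mul_emod_self_left, Int.emod_eq_of_lt (by omega) (by omega)]
    have h2 := Int.emod_nonneg x (by omega : (n : ℤ) ≠ 0)
    have h3 := Int.emod_lt_of_pos x (by omega : (0 : ℤ) < n)
    rw [skew, skew, if_neg h, if_neg (fun h' => h (dvd_neg.1 h')), h1,
      show (n - x % n).toNat = n - (x % n).toNat by omega,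
      show n - (n - (x % n).toNat) = (x % n).toNat by omega]
    ring

theorem skew_refl {n : ℕ} (hn : 0 < n) (S : Set ℕ) (x : ℤ) : skew n (refl n S) x = -skew n S x := by
  rw [skew, skew]
  have h3 := Int.emod_lt_of_pos x (by omega : (0 : ℤ) < n)
  split_ifs
  · simp
  · rw [chi_refl, chi_refl, show n - (n - (x % n).toNat) = (x % n).toNat by omega]
    ring

theorem exists_natCast_of_not_dvd {n : ℕ} (hn : 0 < n) {x : ℤ} (h : ¬ (n : ℤ) ∣ x) :
    ∃ k : ℕ, 0 < k ∧ k < n ∧ (k : ℤ) = x % n := by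
  have h1 := Int.emod_nonneg x (by omega : (n : ℤ) ≠ 0)
  have h2 := Int.emod_lt_of_pos x (by omega : (0 : ℤ) < n)
  have h3 : x % n ≠ 0 := fun h' => h (Int.dvd_of_emod_eq_zero h')
  exact ⟨(x % n).toNat, by omega, by omega, by omega⟩

theorem skew_emod (n : ℕ) (S : Set ℕ) (x : ℤ) : skew n S (x % n) = skew n S x := by
  have : (n : ℤ) ∣ x % n ↔ (n : ℤ) ∣ x := by
    rw [Int.dvd_iff_emod_eq_zero, Int.emod_emod_of_dvd x dvd_rfl, Int.dvd_iff_emod_eq_zero]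
  rw [skew, skew, Int.emod_emod_of_dvd x dvd_rfl]
  simp only [this]

/-! ### Relations between asymmetries from the terms of degree one and two -/

namespace Sim

variable {n : ℕ} {S T : Set ℕ}

/-- At weight zero, the part of the `k`-th coefficient of `P_S P_{S*}` that is linear in the weight
at `k` comes from one single step, taken in either factor. -/
theorem chi_add_chi (h : Sim n S T) {k : ℕ} (h0 : 0 < k) (hk : k < n) :
    chi S k + chi S (n - k) = chi T k + chi T (n - k) := by
  obtain ⟨-, h1, -, -⟩ := part_congr (h.coeff_mul_eq (biWeight (0 : ℕ → ℤ) k 1) hk)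
  have hs : stepSeries (0 : ℕ → ℤ) = 0 := by ext i; simp [stepSeries]
  have hp : ∀ U : Set ℕ, pathSeries U (0 : ℕ → ℤ) = 1 := fun U => by
    ext s
    by_cases h : s = 0
    · simp [h]
    · rw [coeff_pathSeries U _ h, hs, mul_zero, map_zero, mul_zero, coeff_one, if_neg h]
  have hc : ∀ U : Set ℕ, coeff k (part₁₀ (pathSeries U (biWeight (0 : ℕ → ℤ) k 1))) = chi U k := by
    intro U
    rw [(coeff_part_pathSeries U (0 : ℕ → ℤ) h0 one_pos h0.ne').1, hs, hp]
    simp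
  simpa only [part₁₀_mul, part₀₀_pathSeries, hp, one_mul, mul_one, map_add, hc, chi_refl,
    add_comm] using h1

/-- The mixed derivative at `X ^ (r + q)` of `P_S P_{S*}` at weight zero: both steps are taken in
one factor, in either order and ending at `r + q`, or one step is taken in each factor. -/
theorem quadratic (h : Sim n S T) {r q : ℕ} (hr : 0 < r) (hq : 0 < q) (hrq : r + q < n) :
    chi S (r + q) * (chi S r + chi S q) + chi S (n - (r + q)) * (chi S (n - r) + chi S (n - q)) +
      chi S r * chi S (n - q) + chi S q * chi S (n - r) =
    chi T (r + q) * (chi T r + chi T q) + chi T (n - (r + q)) * (chi T (n - r) + chi T (n - q)) +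
      chi T r * chi T (n - q) + chi T q * chi T (n - r) := by
  obtain ⟨-, -, -, h1⟩ := part_congr (h.coeff_mul_eq (biWeight (0 : ℕ → ℤ) r q) hrq)
  have hs : stepSeries (0 : ℕ → ℤ) = 0 := by ext i; simp [stepSeries]
  have hp : ∀ U : Set ℕ, pathSeries U (0 : ℕ → ℤ) = 1 := fun U => by
    ext s
    by_cases h : s = 0
    · simp [h]
    · rw [coeff_pathSeries U _ h, hs, mul_zero, map_zero, mul_zero, coeff_one, if_neg h]
  have hc1 : ∀ U : Set ℕ, part₁₀ (pathSeries U (biWeight (0 : ℕ → ℤ) r q)) =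
      PowerSeries.C (chi U r) * X ^ r := by
    intro U
    ext s
    by_cases h : s = 0
    · rw [h, (coeff_zero_part_pathSeries U _).1]
      rw [coeff_C_mul, coeff_X_pow, if_neg hr.ne, mul_zero]
    · rw [(coeff_part_pathSeries U (0 : ℕ → ℤ) hr hq h).1, hs, hp]
      simp only [mul_zero, zero_add, one_mul, coeff_X_pow, coeff_C_mul]
      split_ifs with h'
      · rw [h']; simp
      · simp
  have hc2 : ∀ U : Set ℕ, part₀₁ (pathSeries U (biWeight (0 : ℕ → ℤ) r q)) =
      PowerSeries.C (chi U q) * X ^ q := by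
    intro U
    ext s
    by_cases h : s = 0
    · rw [h, (coeff_zero_part_pathSeries U _).2.1]
      rw [coeff_C_mul, coeff_X_pow, if_neg hq.ne, mul_zero]
    · rw [(coeff_part_pathSeries U (0 : ℕ → ℤ) hr hq h).2.1, hs, hp]
      simp only [mul_zero, zero_add, one_mul, coeff_X_pow, coeff_C_mul]
      split_ifs with h'
      · rw [h']; simp
      · simp
  have hX : ∀ c d : ℤ, PowerSeries.C c * X ^ r * (PowerSeries.C d * X ^ q) =
      PowerSeries.C (c * d) * (X : ℤ⟦X⟧) ^ (r + q) := fun c d => by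
    rw [_root_.map_mul, pow_add]; ring
  have hX' : ∀ c d : ℤ, PowerSeries.C c * X ^ q * (PowerSeries.C d * X ^ r) =
      PowerSeries.C (c * d) * (X : ℤ⟦X⟧) ^ (r + q) := fun c d => by
    rw [_root_.map_mul, pow_add]; ring
  have hc : ∀ U : Set ℕ, coeff (r + q) (part₁₁ (pathSeries U (biWeight (0 : ℕ → ℤ) r q))) =
      chi U (r + q) * (chi U r + chi U q) := by
    intro U
    rw [(coeff_part_pathSeries U (0 : ℕ → ℤ) hr hq (by omega)).2.2, hs, hc1, hc2]
    have e1 : PowerSeries.C (chi U r) * X ^ r * X ^ q =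
        PowerSeries.C (chi U r) * (X : ℤ⟦X⟧) ^ (r + q) := by rw [pow_add]; ring
    have e2 : PowerSeries.C (chi U q) * X ^ q * X ^ r =
        PowerSeries.C (chi U q) * (X : ℤ⟦X⟧) ^ (r + q) := by rw [pow_add]; ring
    rw [e1, e2, mul_zero, zero_add, map_add, coeff_C_mul, coeff_C_mul, coeff_X_pow, if_pos rfl,
      mul_one, mul_one, Int.cast_id]
  simp only [part₁₁_mul, part₀₀_pathSeries, hp, one_mul, mul_one, map_add, hc, hc1, hc2, chi_refl,
    hX, hX', coeff_C_mul, coeff_X_pow, if_true] at h1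
  linear_combination h1

/-- The values at `k` and `n - k` have the same sum for `S` and `T`, so as unordered pairs of zeros
and ones they coincide, and the asymmetries agree up to sign. -/
theorem skew_sq (h : Sim n S T) (hn : 0 < n) (x : ℤ) :
    (skew n S x + skew n T x) * (skew n S x - skew n T x) = 0 := by
  by_cases hx : (n : ℤ) ∣ x
  · simp [skew_of_dvd _ hx]
  obtain ⟨k, h0, hk, hkx⟩ := exists_natCast_of_not_dvd hn hx
  rw [← skew_emod n S, ← skew_emod n T, ← hkx, skew_natCast S h0 hk, skew_natCast T h0 hk]
  have := h.chi_add_chi h0 hk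
  rcases chi_eq_zero_or_one S k with h1 | h1 <;> rcases chi_eq_zero_or_one S (n - k) with h2 | h2 <;>
    rcases chi_eq_zero_or_one T k with h3 | h3 <;>
    rcases chi_eq_zero_or_one T (n - k) with h4 | h4 <;>
    simp_all

/-- This is the quadratic relation in disguise: after eliminating the mirrored values of `S` by
`chi_add_chi`, it differs from `-4` times that relation by the three instances of `skew_sq`. -/
theorem skew_mul_of_lt (h : Sim n S T) {r q : ℕ} (hr : 0 < r) (hq : 0 < q) (hrq : r + q < n) :
    ((skew n S r + skew n T r) + (skew n S q + skew n T q) -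
        (skew n S (r + q : ℕ) + skew n T (r + q : ℕ))) *
      ((skew n S r - skew n T r) + (skew n S q - skew n T q) -
        (skew n S (r + q : ℕ) - skew n T (r + q : ℕ))) = 0 := by
  have h0 := h.quadratic hr hq hrq
  have h1 := h.skew_sq (by omega) r
  have h2 := h.skew_sq (by omega) q
  have h3 := h.skew_sq (by omega) (r + q : ℕ)
  have k1 := h.chi_add_chi hr (by omega)
  have k2 := h.chi_add_chi hq (by omega)
  have k3 := h.chi_add_chi (k := r + q) (by omega) hrq
  simp only [skew_natCast _ hr (by omega : r < n), skew_natCast _ hq (by omega : q < n),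
    skew_natCast _ (by omega : 0 < r + q) hrq] at h1 h2 h3 ⊢
  generalize chi S r = a1 at *
  generalize chi S q = a2 at *
  generalize chi S (r + q) = a3 at *
  generalize chi S (n - r) = b1 at *
  generalize chi S (n - q) = b2 at *
  generalize chi S (n - (r + q)) = b3 at *
  obtain rfl : b1 = chi T r + chi T (n - r) - a1 := by omega
  obtain rfl : b2 = chi T q + chi T (n - q) - a2 := by omega
  obtain rfl : b3 = chi T (r + q) + chi T (n - (r + q)) - a3 := by omega
  linear_combination h1 + h2 + h3 - 4 * h0

theorem skew_mul (h : Sim n S T) (hn : 0 < n) (x y : ℤ) :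
    ((skew n S x + skew n T x) + (skew n S y + skew n T y) - (skew n S (x + y) + skew n T (x + y))) *
      ((skew n S x - skew n T x) + (skew n S y - skew n T y) -
        (skew n S (x + y) - skew n T (x + y))) = 0 := by
  by_cases hx : (n : ℤ) ∣ x
  · obtain ⟨c, rfl⟩ := hx
    have : ∀ U : Set ℕ, skew n U (n * c + y) = skew n U y := fun U => by
      rw [← skew_emod, Int.mul_add_emod_self_left, skew_emod]
    simp [this, skew_of_dvd]
  by_cases hy : (n : ℤ) ∣ y
  · obtain ⟨c, rfl⟩ := hy
    have : ∀ U : Set ℕ, skew n U (x + n * c) = skew n U x := fun U => by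
      rw [← skew_emod, Int.add_mul_emod_self_left, skew_emod]
    simp [this, skew_of_dvd]
  by_cases hxy : (n : ℤ) ∣ x + y
  · have : ∀ U : Set ℕ, skew n U y = -skew n U x := fun U => by
      obtain ⟨c, hc⟩ := hxy
      obtain rfl : y = -x + n * c := by linear_combination hc
      rw [← skew_emod, Int.add_mul_emod_self_left, skew_emod, skew_neg hn]
    simp [this, skew_of_dvd _ hxy]
  obtain ⟨r, hr0, hr, hrx⟩ := exists_natCast_of_not_dvd hn hx
  obtain ⟨q, hq0, hq, hqy⟩ := exists_natCast_of_not_dvd hn hy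
  have e1 : ∀ U : Set ℕ, skew n U x = skew n U r := fun U => by rw [hrx, skew_emod]
  have e2 : ∀ U : Set ℕ, skew n U y = skew n U q := fun U => by rw [hqy, skew_emod]
  have e3 : ∀ U : Set ℕ, skew n U (x + y) = skew n U (r + q : ℕ) := fun U => by
    rw [Nat.cast_add, hrx, hqy, ← skew_emod n U (x + y), Int.add_emod, skew_emod]
  simp only [e1, e2, e3]
  have hne : r + q ≠ n := fun h' => hxy (by
    rw [Int.dvd_iff_emod_eq_zero, Int.add_emod, ← hrx, ← hqy, ← Nat.cast_add, h']; simp)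
  rcases Nat.lt_or_ge (r + q) n with hlt | hge
  · exact h.skew_mul_of_lt hr0 hq0 hlt
  -- If `r + q > n`, then the sum of the complements is less than `n`, and all arguments change
  -- sign; the product of two odd factors does not.
  · have := h.skew_mul_of_lt (r := n - r) (q := n - q) (by omega) (by omega) (by omega)
    have f : ∀ (U : Set ℕ) (a b : ℕ) (c : ℤ), (a : ℤ) + b = n * c →
        skew n U (a : ℕ) = -skew n U (b : ℕ) := fun U a b c hab => by
      rw [← skew_neg hn, show (a : ℤ) = -b + n * c by linear_combination hab, ← skew_emod,
        Int.add_mul_emod_self_left, skew_emod]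
    simp only [f _ (n - r) r 1 (by omega), f _ (n - q) q 1 (by omega),
      f _ (n - r + (n - q)) (r + q) 2 (by omega)] at this
    linear_combination this

end Sim

end RibbonCount

namespace RibbonCount

/-! ### Periods -/

/-- The greatest common divisor of the numbers from `1` to `N` with property `p`. -/
noncomputable def gcdUpTo (p : ℕ → Prop) : ℕ → ℕ
  | 0 => 0
  | N + 1 => open Classical in
    if p (N + 1) then Nat.gcd (gcdUpTo p N) (N + 1) else gcdUpTo p N

section GcdUpTo

variable {p : ℕ → Prop} {N : ℕ}

theorem gcdUpTo_succ_of_pos (h : p (N + 1)) :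
    gcdUpTo p (N + 1) = Nat.gcd (gcdUpTo p N) (N + 1) := if_pos h

theorem gcdUpTo_succ_of_neg (h : ¬ p (N + 1)) : gcdUpTo p (N + 1) = gcdUpTo p N := if_neg h

theorem gcdUpTo_succ_dvd : gcdUpTo p (N + 1) ∣ gcdUpTo p N := by
  by_cases h : p (N + 1)
  · rw [gcdUpTo_succ_of_pos h]; exact Nat.gcd_dvd_left _ _
  · rw [gcdUpTo_succ_of_neg h]

theorem gcdUpTo_dvd_of_le {M : ℕ} (h : M ≤ N) : gcdUpTo p N ∣ gcdUpTo p M := by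
  induction h with
  | refl => exact dvd_rfl
  | step _ ih => exact gcdUpTo_succ_dvd.trans ih

theorem gcdUpTo_dvd {k : ℕ} (h0 : 0 < k) (hk : k ≤ N) (h : p k) : gcdUpTo p N ∣ k := by
  obtain ⟨k, rfl⟩ := Nat.exists_eq_succ_of_ne_zero h0.ne'
  refine (gcdUpTo_dvd_of_le hk).trans ?_
  rw [gcdUpTo_succ_of_pos h]
  exact Nat.gcd_dvd_right _ _

theorem dvd_gcdUpTo {d : ℕ} (h : ∀ k, 0 < k → k ≤ N → p k → d ∣ k) : d ∣ gcdUpTo p N := by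
  induction N with
  | zero => exact dvd_zero d
  | succ N ih =>
    have ih := ih fun k h0 hk => h k h0 (by omega)
    by_cases hp : p (N + 1)
    · rw [gcdUpTo_succ_of_pos hp]; exact Nat.dvd_gcd ih (h _ (by omega) le_rfl hp)
    · rwa [gcdUpTo_succ_of_neg hp]

theorem gcdUpTo_le : gcdUpTo p N ≤ N := by
  induction N with
  | zero => exact le_rfl
  | succ N ih =>
    by_cases hp : p (N + 1)
    · rw [gcdUpTo_succ_of_pos hp]; exact Nat.le_of_dvd (by omega) (Nat.gcd_dvd_right _ _)
    · rw [gcdUpTo_succ_of_neg hp]; omega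

theorem gcdUpTo_eq_zero (h : ∀ k, 0 < k → k ≤ N → ¬ p k) : gcdUpTo p N = 0 :=
  Nat.eq_zero_of_zero_dvd (dvd_gcdUpTo fun k h0 hk hp => (h k h0 hk hp).elim)

end GcdUpTo

/-! ### Periods on intervals, away from the multiples of a number -/

section Windows

variable {α : Type*} {w : ℤ → α} {a b d : ℤ}

/-- The theorem of Fine and Wilf, for functions on an interval without the multiples of `d`. -/
theorem window_period_gcd {p q : ℕ} (hdp : d ∣ p) (hdq : d ∣ q)
    (hlen : (p : ℤ) + q < b - a ∨ ((p : ℤ) + q ≤ b - a ∧ d ∣ a))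
    (hp : ∀ x, ¬ d ∣ x → a < x → x + p < b → w (x + p) = w x)
    (hq : ∀ x, ¬ d ∣ x → a < x → x + q < b → w (x + q) = w x) :
    ∀ x, ¬ d ∣ x → a < x → x + (Nat.gcd p q : ℕ) < b → w (x + (Nat.gcd p q : ℕ)) = w x := by
  induction hN : p + q using Nat.strong_induction_on generalizing p q with
  | _ N ih =>
    rcases Nat.eq_zero_or_pos p with rfl | hp0
    · rwa [Nat.gcd_zero_left]
    rcases Nat.eq_zero_or_pos q with rfl | hq0
    · rwa [Nat.gcd_zero_right]
    have step : ∀ {p q : ℕ}, 0 < p → p ≤ q → d ∣ p → d ∣ q →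
        ((p : ℤ) + q < b - a ∨ ((p : ℤ) + q ≤ b - a ∧ d ∣ a)) →
        (∀ x, ¬ d ∣ x → a < x → x + p < b → w (x + p) = w x) →
        (∀ x, ¬ d ∣ x → a < x → x + q < b → w (x + q) = w x) →
        ∀ x, ¬ d ∣ x → a < x → x + (q - p : ℕ) < b → w (x + (q - p : ℕ)) = w x := by
      intro p q _ hpq hdp hdq hlen hp hq x hx hax hxb
      rw [Nat.cast_sub hpq] at hxb ⊢
      -- A Euclidean step: shift by `q` and then back by `p`, or in the other order, whichever
      -- intermediate point lies in the window.
      rcases lt_or_ge (x + q) b with h | h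
      · rw [← hq x hx hax h, ← hp (x + (q - p))]
        · congr 1; ring
        · exact fun h' => hx ((dvd_add_left (dvd_sub hdq hdp)).1 h')
        · have : (p : ℤ) ≤ q := by exact_mod_cast hpq
          omega
        · omega
      · have h1 : a < x - p := by
          rcases hlen with h2 | ⟨h2, h3⟩
          · omega
          -- The only position for which the window would be too short is a multiple of `d`. This
          -- saves one unit of length when `d ∣ a`.
          · have : x ≠ a + p := fun h4 => hx (h4 ▸ dvd_add h3 hdp)
            omega
        have h2 : ¬ d ∣ x - p := fun h' => hx (by simpa using dvd_add h' hdp)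
        have h3 := hp (x - p) h2 h1 (by omega)
        have h4 := hq (x - p) h2 h1 (by omega)
        rw [sub_add_cancel] at h3
        rw [h3, ← h4]
        congr 1; ring
    rcases le_total p q with h | h
    · have := ih (p + (q - p)) (by omega) (p := p) (q := q - p) hdp
        (by rw [Nat.cast_sub h]; exact dvd_sub hdq hdp)
        (hlen.imp (fun h1 => by omega) fun h1 => ⟨by omega, h1.2⟩) hp
        (step hp0 h hdp hdq hlen hp hq) rfl
      rwa [Nat.gcd_sub_self_right h] at this
    · have hlen' : (q : ℤ) + p < b - a ∨ ((q : ℤ) + p ≤ b - a ∧ d ∣ a) := by rwa [add_comm]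
      have := ih (p - q + q) (by omega) (p := p - q) (q := q)
        (by rw [Nat.cast_sub h]; exact dvd_sub hdp hdq) hdq
        (hlen.imp (fun h1 => by omega) fun h1 => ⟨by omega, h1.2⟩)
        (step hq0 h hdq hdp hlen' hq hp) hq rfl
      rwa [Nat.gcd_sub_self_left h] at this

theorem window_congr {h : ℕ} (hd : d ∣ h)
    (hh : ∀ x, ¬ d ∣ x → a < x → x + h < b → w (x + h) = w x) {x y : ℤ} (hx : ¬ d ∣ x)
    (hax : a < x) (hxb : x < b) (hay : a < y) (hyb : y < b) (hxy : (h : ℤ) ∣ y - x) :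
    w y = w x := by
  have key : ∀ (k : ℕ) (x : ℤ), ¬ d ∣ x → a < x → x + k * h < b → w (x + k * h) = w x := by
    intro k
    induction k with
    | zero => intro x _ _ _; simp
    | succ k ih =>
      intro x hx hax hxb
      have e : x + (k + 1 : ℕ) * h = x + k * h + h := by push_cast; ring
      have : (0 : ℤ) ≤ k * h := by positivity
      rw [e] at hxb ⊢
      rw [hh _ _ (by omega) hxb, ih x hx hax (by omega)]
      intro h'
      exact hx ((dvd_add_left (hd.mul_left _)).1 h')
  rcases le_total x y with hle | hle
  · rcases Nat.eq_zero_or_pos h with rfl | h0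
    · have : y = x := by simpa [sub_eq_zero] using hxy
      rw [this]
    obtain ⟨c, hc⟩ := hxy
    have hc0 : 0 ≤ c := by
      by_contra hlt
      have : (h : ℤ) * c < 0 := mul_neg_of_pos_of_neg (by omega) (by omega)
      omega
    obtain ⟨k, rfl⟩ := Int.eq_ofNat_of_zero_le hc0
    obtain rfl : y = x + k * h := by linear_combination hc
    exact key k x hx hax hyb
  · rcases Nat.eq_zero_or_pos h with rfl | h0
    · have : y = x := by simpa [sub_eq_zero] using hxy
      rw [this]
    obtain ⟨c, hc⟩ := hxy
    have hc0 : 0 ≤ -c := by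
      by_contra hlt
      have : 0 < (h : ℤ) * c := mul_pos (by omega) (by omega)
      omega
    obtain ⟨k, hk⟩ := Int.eq_ofNat_of_zero_le hc0
    have hxk : x = y + k * h := by rw [← sub_eq_zero] at hk ⊢; linear_combination -hc + h * hk
    have hy : ¬ d ∣ y := fun h' => hx (hxk ▸ dvd_add h' (hd.mul_left _))
    rw [hxk]
    exact (key k y hy hay (hxk ▸ hxb)).symm

end Windows

/-- By Bézout, translating `e` by `f` eventually reaches a multiple of `h`. The factor `k + 1` lets
`k` count the translations before the one that does. -/
theorem exists_dvd_add_mul {h : ℕ} (h0 : 0 < h) {f e : ℤ} (he : (Int.gcd h f : ℤ) ∣ e) :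
    ∃ k : ℕ, (h : ℤ) ∣ e + (k + 1) * f := by
  obtain ⟨t, rfl⟩ := he
  refine ⟨((-t * Int.gcdB h f - 1) % h).toNat, ?_⟩
  have h1 := Int.emod_nonneg (-t * Int.gcdB h f - 1) (by omega : (h : ℤ) ≠ 0)
  rw [Int.toNat_of_nonneg h1]
  have h2 := Int.emod_add_mul_ediv (-t * Int.gcdB h f - 1) h
  have h3 := Int.gcd_eq_gcd_ab h f
  refine ⟨t * Int.gcdA h f - f * ((-t * Int.gcdB h f - 1) / h), ?_⟩
  linear_combination f * h2 + t * h3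

/-- An odd function which is `h`-periodic, and invariant under translation by `f` as far as no
multiples of `h` are involved, vanishes on the multiples of `gcd h f` which are no multiples
of `h`. -/
theorem eq_zero_of_translation {h : ℕ} (h0 : 0 < h) {f : ℤ} {w : ℤ → ℤ}
    (hper : ∀ x y, ¬ (h : ℤ) ∣ x → (h : ℤ) ∣ y - x → w y = w x)
    (hodd : ∀ x, ¬ (h : ℤ) ∣ x → w (-x) = -w x)
    (hf : ∀ x, ¬ (h : ℤ) ∣ x → ¬ (h : ℤ) ∣ x + f → w (x + f) = w x)
    {e : ℤ} (he : (Int.gcd h f : ℤ) ∣ e) (hhe : ¬ (h : ℤ) ∣ e) : w e = 0 := by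
  classical
  -- Translate `e` by `f` as long as no multiple of `h` is met; the last point reached is congruent
  -- to `-f`. The common value `w (-f)` is also taken at `e = f`, so oddness makes it zero.
  have key : ∀ e : ℤ, (Int.gcd h f : ℤ) ∣ e → ¬ (h : ℤ) ∣ e → w e = w (-f) := by
    intro e he hhe
    have hex := exists_dvd_add_mul h0 he
    set k := Nat.find hex with hk
    have hk1 : (h : ℤ) ∣ e + (k + 1) * f := Nat.find_spec hex
    have hk2 : ∀ l < k, ¬ (h : ℤ) ∣ e + (l + 1) * f := fun l hl => Nat.find_min hex hl
    have h1 : ∀ l ≤ k, ¬ (h : ℤ) ∣ e + l * f ∧ w (e + l * f) = w e := by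
      intro l
      induction l with
      | zero => intro _; simpa using hhe
      | succ l ih =>
        intro hl
        obtain ⟨i1, i2⟩ := ih (by omega)
        have i3 := hk2 l (by omega)
        have e1 : e + ((l + 1 : ℕ) : ℤ) * f = e + l * f + f := by push_cast; ring
        have e2 : e + ((l : ℤ) + 1) * f = e + l * f + f := by ring
        rw [e2] at i3
        rw [e1]
        exact ⟨i3, (hf _ i1 i3).trans i2⟩
    obtain ⟨j1, j2⟩ := h1 k le_rfl
    rw [← j2]
    refine (hper _ _ j1 ?_).symm
    have : -f - (e + k * f) = -(e + (k + 1) * f) := by ring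
    rw [this]
    exact hk1.neg_right
  have hg : (Int.gcd h f : ℤ) ∣ f := Int.gcd_dvd_right _ _
  have hhf : ¬ (h : ℤ) ∣ f := fun h' => hhe (by
    have : (h : ℤ) ∣ (Int.gcd h f : ℤ) := Int.dvd_coe_gcd dvd_rfl h'
    exact this.trans he)
  have h1 := key f hg hhf
  have h2 := hodd f hhf
  rw [key e he hhe]
  omega

/-! ### Two odd functions with disjoint supports and vanishing products of defects -/

section Chain

variable {n : ℕ} {u v : ℤ → ℤ}

/-- For `y = j` the second factor of the relation reduces to `v j`, which is nonzero, and `u j = 0`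
since the supports are disjoint. Thus each element of the support of `v` is a period of `u` wherever
`v` vanishes at both ends. -/
theorem eq_of_rel (huv : ∀ x, u x * v x = 0)
    (hrel : ∀ x y, (u x + u y - u (x + y)) * (v x + v y - v (x + y)) = 0) {x j : ℤ}
    (hj : v j ≠ 0) (hx : v x = 0) (hxj : v (x + j) = 0) : u (x + j) = u x := by
  have h1 : u j = 0 := (mul_eq_zero.1 (huv j)).resolve_right hj
  have h2 := hrel x j
  rw [hx, hxj, h1] at h2
  simp only [zero_add, add_zero, sub_zero, mul_eq_zero, hj, or_false] at h2
  omega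

/-- In the window from `-N` to `N` the function `v` vanishes off the multiples of the gcd, so there
`eq_of_rel` makes every element of its support up to `N` a period of `u`. The theorem of Fine and
Wilf merges them one by one: a new period `M + 1` and the previous gcd, at most `M`, have sum less
than the length `2 N + 2`. -/
theorem window_period_gcdUpTo (hv : ∀ x, v (-x) = -v x) (huv : ∀ x, u x * v x = 0)
    (hrel : ∀ x y, (u x + u y - u (x + y)) * (v x + v y - v (x + y)) = 0) (N : ℕ) {x : ℤ}
    (hx : ¬ (gcdUpTo (fun k => v k ≠ 0) N : ℤ) ∣ x) (hx1 : -(N + 1 : ℤ) < x)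
    (hx2 : x + (gcdUpTo (fun k => v k ≠ 0) N : ℤ) < N + 1) :
    u (x + (gcdUpTo (fun k => v k ≠ 0) N : ℤ)) = u x := by
  set F : ℕ → Prop := fun k => v k ≠ 0
  have hv0 : v 0 = 0 := by have := hv 0; rw [neg_zero] at this; omega
  have hF : ∀ x : ℤ, ¬ (gcdUpTo F N : ℤ) ∣ x → -(N + 1 : ℤ) < x → x < N + 1 → v x = 0 := by
    intro x hx h1 h2
    by_contra hne
    obtain ⟨k, rfl | rfl⟩ := x.eq_nat_or_neg
    · rcases Nat.eq_zero_or_pos k with rfl | hk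
      · exact hne hv0
      · exact hx (Int.natCast_dvd_natCast.2 (gcdUpTo_dvd hk (by omega) hne))
    · rcases Nat.eq_zero_or_pos k with rfl | hk
      · exact hne (by simpa using hv0)
      · exact hx (dvd_neg.2 (Int.natCast_dvd_natCast.2 (gcdUpTo_dvd hk (by omega)
          (fun h => hne (by rw [hv]; omega)))))
  have key : ∀ M ≤ N, ∀ x : ℤ, ¬ (gcdUpTo F N : ℤ) ∣ x → -(N + 1 : ℤ) < x →
      x + (gcdUpTo F M : ℤ) < N + 1 → u (x + (gcdUpTo F M : ℤ)) = u x := by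
    intro M
    induction M with
    | zero => intro _ x _ _ _; simp [gcdUpTo]
    | succ M ih =>
      intro hM
      by_cases hp : F (M + 1)
      · rw [gcdUpTo_succ_of_pos hp]
        have hd : (gcdUpTo F N : ℤ) ∣ (M + 1 : ℕ) :=
          Int.natCast_dvd_natCast.2 (gcdUpTo_dvd (by omega) hM hp)
        refine window_period_gcd (Int.natCast_dvd_natCast.2 (gcdUpTo_dvd_of_le (by omega))) hd
          (Or.inl ?_) (ih (by omega)) ?_
        · have := gcdUpTo_le (p := F) (N := M)
          omega
        · intro x hx h1 h2
          exact eq_of_rel huv hrel hp (hF x hx h1 (by omega))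
            (hF _ (fun h' => hx ((dvd_add_left hd).1 h')) (by omega) h2)
      · rw [gcdUpTo_succ_of_neg hp]
        exact ih (by omega)
  exact key N le_rfl x hx hx1 hx2

/-- The gcd starts as `j > e`. If at some moment it dropped from `h` to a divisor of `e`, then `u`
modulo `h` would be invariant under translation by the new support element, off the multiples of
`h`. By `eq_zero_of_translation` it would vanish at `e`. -/
theorem not_gcdUpTo_dvd (hu : ∀ x, u (-x) = -u x) (hv : ∀ x, v (-x) = -v x)
    (huv : ∀ x, u x * v x = 0)
    (hrel : ∀ x y, (u x + u y - u (x + y)) * (v x + v y - v (x + y)) = 0) {e j N : ℕ}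
    (he : 0 < e) (hej : e < j) (hue : u e ≠ 0) (hmin : ∀ k : ℕ, 0 < k → k < j → v k = 0)
    (hvj : v j ≠ 0) (hN : j ≤ N) : ¬ gcdUpTo (fun k => v k ≠ 0) N ∣ e := by
  set F : ℕ → Prop := fun k => v k ≠ 0
  induction hN with
  | refl =>
    obtain ⟨i, rfl⟩ := Nat.exists_eq_succ_of_ne_zero (by omega : j ≠ 0)
    rw [Nat.succ_eq_add_one, gcdUpTo_succ_of_pos hvj,
      gcdUpTo_eq_zero (fun k h0 hk hp => hp (hmin k h0 (by omega))), Nat.gcd_zero_left]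
    exact fun h => absurd (Nat.le_of_dvd he h) (by omega)
  | @step N hN ih =>
    by_cases hp : F (N + 1)
    swap
    · rwa [Nat.succ_eq_add_one, gcdUpTo_succ_of_neg hp]
    rw [Nat.succ_eq_add_one, gcdUpTo_succ_of_pos hp]
    intro hdvd
    set h := gcdUpTo F N with hh
    have hjN : h ∣ j := gcdUpTo_dvd (by omega) hN hvj
    have h0 : 0 < h := Nat.pos_of_dvd_of_pos hjN (by omega)
    have hle : h ≤ N := gcdUpTo_le
    have hwin : ∀ x : ℤ, ¬ (h : ℤ) ∣ x → -(N + 1 : ℤ) < x → x + h < N + 1 → u (x + h) = u x :=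
      fun x => window_period_gcdUpTo hv huv hrel N
    have hv0 : ∀ x : ℤ, ¬ (h : ℤ) ∣ x → -(N + 1 : ℤ) < x → x < N + 1 → v x = 0 := by
      intro x hx h1 h2
      by_contra hne
      obtain ⟨k, rfl | rfl⟩ := x.eq_nat_or_neg
      · rcases Nat.eq_zero_or_pos k with rfl | hk
        · simp at hx
        · exact hx (Int.natCast_dvd_natCast.2 (gcdUpTo_dvd hk (by omega) hne))
      · rcases Nat.eq_zero_or_pos k with rfl | hk
        · simp at hx
        · exact hx (dvd_neg.2 (Int.natCast_dvd_natCast.2 (gcdUpTo_dvd hk (by omega)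
            (fun h => hne (by rw [hv]; omega)))))
    have hcong : ∀ x y : ℤ, ¬ (h : ℤ) ∣ x → -(N + 1 : ℤ) < x → x < N + 1 → -(N + 1 : ℤ) < y →
        y < N + 1 → (h : ℤ) ∣ y - x → u y = u x := fun x y hx h1 h2 h3 h4 h5 =>
      window_congr dvd_rfl hwin hx h1 h2 h3 h4 h5
    have hmod0 : ∀ x : ℤ, 0 ≤ x % h := fun x => Int.emod_nonneg x (by omega)
    have hmod1 : ∀ x : ℤ, x % h < h := fun x => Int.emod_lt_of_pos x (by omega)
    have hmod2 : ∀ x : ℤ, (h : ℤ) ∣ x % h - x := fun x => by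
      rw [← neg_sub]; exact (Int.dvd_self_sub_emod).neg_right
    have hmod : ∀ x : ℤ, ¬ (h : ℤ) ∣ x → ¬ (h : ℤ) ∣ x % h := fun x hx h' => hx
      (by have := dvd_sub h' (hmod2 x); rwa [sub_sub_cancel] at this)
    -- The `h`-periodic continuation of `u` from the window, rather than `u` itself, is known to be
    -- periodic at this stage.
    have hez := eq_zero_of_translation h0 (f := (N + 1 : ℕ)) (w := fun x => u (x % h)) (e := e)
      (fun x y _ hxy => by
        show u (y % h) = u (x % h)
        rw [Int.emod_emod_of_dvd y dvd_rfl |>.symm, (Int.emod_emod_of_dvd y dvd_rfl),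
          (Int.emod_eq_emod_iff_emod_sub_eq_zero).2 (Int.emod_eq_zero_of_dvd hxy)])
      (fun x hx => by
        show u (-x % h) = -u (x % h)
        rw [← hu]
        have := hmod0 x; have := hmod1 x; have := hmod0 (-x); have := hmod1 (-x)
        refine hcong _ _ ?_ (by omega) (by omega) (by omega) (by omega) ?_
        · rw [dvd_neg]; exact hmod x hx
        · have e1 : -x % h - -(x % h) = (-x % h - -x) + (x % h - x) := by ring
          rw [e1]; exact dvd_add (hmod2 _) (hmod2 _))
      (fun x hx hxf => by
        show u ((x + (N + 1 : ℕ)) % h) = u (x % h)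
        have := hmod0 x; have := hmod1 x
        have := hmod0 (x + (N + 1 : ℕ)); have := hmod1 (x + (N + 1 : ℕ))
        -- The representative between `-h` and `0` is used, so that adding `N + 1` stays inside the
        -- window, where `v` is known to vanish off the multiples of `h`.
        have a1 : ¬ (h : ℤ) ∣ x % h - h := fun h' => hmod x hx (by
          have := dvd_add h' (dvd_refl (h : ℤ)); rwa [sub_add_cancel] at this)
        have a2 : ¬ (h : ℤ) ∣ x % h - h + (N + 1 : ℕ) := fun h' => hxf (by
          have e1 : x + (N + 1 : ℕ) = (x % h - h + (N + 1 : ℕ)) - (x % h - x) + h := by ring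
          rw [e1]; exact dvd_add (dvd_sub h' (hmod2 _)) dvd_rfl)
        have hne : x % h ≠ 0 := fun h' => hmod x hx (h' ▸ dvd_zero _)
        have b1 : u (x % h) = u (x % h - h) := hcong _ _ a1 (by omega) (by omega) (by omega)
          (by omega) (by simp)
        have b2 : u (x % h - h + (N + 1 : ℕ)) = u (x % h - h) :=
          eq_of_rel huv hrel hp (hv0 _ a1 (by omega) (by omega))
            (hv0 _ a2 (by push_cast; omega) (by push_cast; omega))
        rw [b1, ← b2]
        refine hcong _ _ a2 (by push_cast; omega) (by push_cast; omega) (by omega) (by omega) ?_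
        have e1 : (x + (N + 1 : ℕ)) % h - (x % h - h + (N + 1 : ℕ)) =
          ((x + (N + 1 : ℕ)) % h - (x + (N + 1 : ℕ))) - (x % h - x) + h := by ring
        rw [e1]
        exact dvd_add (dvd_sub (hmod2 _) (hmod2 _)) dvd_rfl)
      (by rw [Int.gcd_natCast_natCast]; exact Int.natCast_dvd_natCast.2 hdvd)
      (fun h' => ih (Int.natCast_dvd_natCast.1 h'))
    have hjN' : j ≤ N := hN
    have hmod3 := hmod0 e
    have hmod4 := hmod1 e
    have e1 : u (e % h) = u e := hcong _ _ (fun h' => ih (Int.natCast_dvd_natCast.1 h'))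
      (by omega) (by omega) (by omega) (by omega) (hmod2 _)
    exact hue (e1 ▸ hez)

/-- In the situation of two odd `n`-periodic functions with disjoint supports, the first of which
has the smaller positive element `e` in its support: there is a divisor `m` of `n` such that `v` is
supported on the multiples of `m`, the function `u` is `m`-periodic off the multiples of `m`, and
`e` is no multiple of `m`. -/
theorem exists_modulus (hn : 0 < n) (hu : ∀ x, u (-x) = -u x) (hv : ∀ x, v (-x) = -v x)
    (hun : ∀ x, u (x + n) = u x) (hvn : ∀ x, v (x + n) = v x) (huv : ∀ x, u x * v x = 0)
    (hrel : ∀ x y, (u x + u y - u (x + y)) * (v x + v y - v (x + y)) = 0) {e j : ℕ}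
    (he : 0 < e) (hej : e < j) (hjn : j < n) (hue : u e ≠ 0)
    (hmin : ∀ k : ℕ, 0 < k → k < j → v k = 0) (hvj : v j ≠ 0) :
    ∃ m : ℕ, m ∣ n ∧ (∀ x, v x ≠ 0 → (m : ℤ) ∣ x) ∧ ¬ m ∣ e ∧
      ∀ x, ¬ (m : ℤ) ∣ x → u (x + m) = u x := by
  -- Up to `2 n` the support of the periodic function `v` contains `j` as well as `j + n`, which
  -- forces `m ∣ n`.
  set m := gcdUpTo (fun k => v k ≠ 0) (2 * n) with hm
  have hmj : m ∣ j := gcdUpTo_dvd (by omega) (by omega) hvj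
  have hmn : m ∣ n := by
    have : m ∣ j + n := gcdUpTo_dvd (by omega) (by omega) (by
      show v (j + n : ℕ) ≠ 0
      rw [Nat.cast_add, hvn]; exact hvj)
    exact (Nat.dvd_add_right hmj).1 this
  have hper : ∀ {w : ℤ → ℤ}, (∀ x, w (x + n) = w x) → ∀ x, w (x % n) = w x := by
    intro w hw x
    have hp : Function.Periodic w n := hw
    rw [Int.emod_def, mul_comm]
    exact hp.sub_int_mul_eq _
  have hmle : m ≤ n := Nat.le_of_dvd hn hmn
  have hmod : ∀ x : ℤ, (m : ℤ) ∣ x % n → (m : ℤ) ∣ x := fun x hx => by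
    rw [← Int.emod_add_mul_ediv x n]
    exact dvd_add hx ((Int.natCast_dvd_natCast.2 hmn).mul_right _)
  refine ⟨m, hmn, fun x hx => hmod x ?_, not_gcdUpTo_dvd hu hv huv hrel he hej hue hmin hvj
    (by omega), fun x hx => ?_⟩
  · have h1 := Int.emod_nonneg x (by omega : (n : ℤ) ≠ 0)
    have h2 := Int.emod_lt_of_pos x (by omega : (0 : ℤ) < n)
    rw [← hper hvn] at hx
    obtain ⟨k, hk⟩ := Int.eq_ofNat_of_zero_le h1
    rw [hk] at hx h2 ⊢
    have hk0 : k ≠ 0 := by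
      rintro rfl
      have := hv 0
      simp only [neg_zero] at this
      exact hx (by simp; omega)
    exact Int.natCast_dvd_natCast.2 (gcdUpTo_dvd (by omega) (by omega) hx)
  · have h1 := Int.emod_nonneg x (by omega : (n : ℤ) ≠ 0)
    have h2 := Int.emod_lt_of_pos x (by omega : (0 : ℤ) < n)
    have h3 := window_period_gcdUpTo hv huv hrel (2 * n) (x := x % n) (fun h' => hx (hmod x h'))
      (by omega) (by push_cast; omega)
    rw [← hm, ← hper hun (x % n + m), Int.emod_add_emod, hper hun, hper hun] at h3
    exact h3

end Chain

end RibbonCount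

namespace RibbonCount

open PowerSeries

/-! ### Power series supported on a ray -/

section Ray

variable {A : Type*} [CommRing A] {n m c d : ℕ} {p q W g : A⟦X⟧}

/-- Below the exponent `n`, the power series is supported on the exponents `c + m j`. -/
def OnRay (n m c : ℕ) (p : A⟦X⟧) : Prop := ∀ k < n, coeff k p ≠ 0 → ∃ j, k = c + m * j

theorem OnRay.mul (hp : OnRay n m c p) (hq : OnRay n m d q) : OnRay n m (c + d) (p * q) := by
  intro k hk hne
  rw [coeff_mul] at hne
  obtain ⟨⟨i, j⟩, hij, h⟩ := Finset.exists_ne_zero_of_sum_ne_zero hne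
  rw [Finset.HasAntidiagonal.mem_antidiagonal] at hij
  dsimp only at hij h
  obtain ⟨a, ha⟩ := hp i (by omega) (left_ne_zero_of_mul h)
  obtain ⟨b, hb⟩ := hq j (by omega) (right_ne_zero_of_mul h)
  exact ⟨a + b, by rw [← hij, ha, hb]; ring⟩

theorem OnRay.add (hp : OnRay n m c p) (hq : OnRay n m c q) : OnRay n m c (p + q) := by
  intro k hk hne
  by_cases h : coeff k p = 0
  · exact hq k hk fun h' => hne (by rw [map_add, h, h', add_zero])
  · exact hp k hk h

theorem onRay_X_pow : OnRay n m c (X ^ c : A⟦X⟧) := by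
  intro k _ hne
  rw [coeff_X_pow] at hne
  exact ⟨0, by by_contra h; exact hne (if_neg (by omega))⟩

theorem onRay_zero : OnRay n m c (0 : A⟦X⟧) := fun _ _ h => (h (map_zero _)).elim

/-- The exponents `c` and `d` are the least ones on their rays, so a single pair of exponents
contributes. -/
theorem OnRay.coeff_add_mul (hp : OnRay n m c p) (hq : OnRay n m d q) (h : c + d < n) :
    coeff (c + d) (p * q) = coeff c p * coeff d q := by
  rw [coeff_mul]
  refine Finset.sum_eq_single (c, d) (fun ij hij hne => ?_) (fun h' => ?_)
  · rw [Finset.HasAntidiagonal.mem_antidiagonal] at hij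
    by_contra h0
    obtain ⟨a, ha⟩ := hp ij.1 (by omega) (left_ne_zero_of_mul h0)
    obtain ⟨b, hb⟩ := hq ij.2 (by omega) (right_ne_zero_of_mul h0)
    exact hne (Prod.ext (by dsimp only; omega) (by dsimp only; omega))
  · exact (h' (by rw [Finset.HasAntidiagonal.mem_antidiagonal])).elim

theorem OnRay.of_rec {a : ℕ → A} (hW : OnRay n m 0 W) (hW0 : coeff 0 W = 0) (hg : OnRay n m c g)
    (h0 : coeff 0 p ≠ 0 → c = 0)
    (h : ∀ s, 0 < s → s < n → coeff s p = a s * coeff s (p * W + g)) : OnRay n m c p := by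
  intro k
  induction k using Nat.strong_induction_on with
  | _ k ih =>
    intro hk hne
    rcases Nat.eq_zero_or_pos k with rfl | hk0
    · exact ⟨0, by rw [h0 hne]; simp⟩
    rw [h k hk0 hk, map_add] at hne
    have hne := right_ne_zero_of_mul hne
    by_cases hgk : coeff k g = 0
    · rw [hgk, add_zero, coeff_mul] at hne
      obtain ⟨⟨i, j⟩, hij, h⟩ := Finset.exists_ne_zero_of_sum_ne_zero hne
      rw [Finset.HasAntidiagonal.mem_antidiagonal] at hij
      dsimp only at hij h
      have hj : j ≠ 0 := by
        rintro rfl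
        exact h (by rw [hW0, mul_zero])
      obtain ⟨a, ha⟩ := ih i (by omega) (by omega) (left_ne_zero_of_mul h)
      obtain ⟨b, hb⟩ := hW j (by omega) (right_ne_zero_of_mul h)
      exact ⟨a + b, by rw [← hij, ha, hb]; ring⟩
    · exact hg k hk hgk

theorem OnRay.of_mul (hW : OnRay n m 0 W) (hW1 : coeff 0 W = 1) (h : OnRay n m c (p * W)) :
    OnRay n m c p := by
  intro k
  induction k using Nat.strong_induction_on with
  | _ k ih =>
    intro hk hne
    by_contra hno
    have h0 : coeff k (p * W) = 0 := by
      by_contra h'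
      exact hno (h k hk h')
    rw [coeff_mul, Finset.sum_eq_single (k, 0), hW1, mul_one] at h0
    · exact hne h0
    · intro ij hij hne'
      rw [Finset.HasAntidiagonal.mem_antidiagonal] at hij
      by_contra h'
      have hj : ij.2 ≠ 0 := fun h2 => hne' (Prod.ext (by dsimp only; omega) h2)
      obtain ⟨a, ha⟩ := ih ij.1 (by omega) (by omega) (left_ne_zero_of_mul h')
      obtain ⟨b, hb⟩ := hW ij.2 (by omega) (right_ne_zero_of_mul h')
      exact hno ⟨a + b, by rw [← hij, ha, hb]; ring⟩
    · intro h'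
      exact (h' (by rw [Finset.HasAntidiagonal.mem_antidiagonal, add_zero])).elim

theorem OnRay.not_dvd (hp : OnRay n m c p) (hc : ¬ m ∣ c) {k : ℕ} (hk : k < n)
    (h : coeff k p ≠ 0) : c ≤ k ∧ ¬ m ∣ k := by
  obtain ⟨j, rfl⟩ := hp k hk h
  exact ⟨by omega, fun h' => hc ((Nat.dvd_add_left (dvd_mul_right m j)).1 h')⟩

theorem OnRay.dvd (hp : OnRay n m 0 p) {k : ℕ} (hk : k < n) (h : coeff k p ≠ 0) : m ∣ k := by
  obtain ⟨j, rfl⟩ := hp k hk h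
  simp

/-- Division by a path series does not affect lowest terms. Derivatives of a quotient are known
first after multiplication by its denominator, and this removes the denominator. -/
theorem coeff_of_coeff_mul (hW : coeff 0 W = 1) {k : ℕ} (h : ∀ s < k, coeff s (p * W) = 0) :
    (∀ s < k, coeff s p = 0) ∧ coeff k p = coeff k (p * W) := by
  have key : ∀ s, (∀ r < s, coeff r p = 0) → coeff s (p * W) = coeff s p := by
    intro s hs
    rw [coeff_mul, Finset.sum_eq_single (s, 0), hW, mul_one]
    · intro ij hij hne'
      rw [Finset.HasAntidiagonal.mem_antidiagonal] at hij
      have hj : ij.2 ≠ 0 := fun h2 => hne' (Prod.ext (by dsimp only; omega) h2)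
      rw [hs _ (by omega), zero_mul]
    · intro h'
      exact (h' (by rw [Finset.HasAntidiagonal.mem_antidiagonal, add_zero])).elim
  have h1 : ∀ s < k, coeff s p = 0 := by
    intro s
    induction s using Nat.strong_induction_on with
    | _ s ih =>
      intro hs
      rw [← key s fun r hr => ih r hr (hr.trans hs), h s hs]
  exact ⟨h1, (key k h1).symm⟩

theorem coeff_congr_of_coeff_mul (hW : constantCoeff W = 1) {n : ℕ}
    (h : ∀ k < n, coeff k (p * W) = coeff k (q * W)) {k : ℕ} (hk : k < n) :
    coeff k p = coeff k q := by
  have e : ∀ r : A⟦X⟧, r = r * W * invOfUnit W 1 := fun r => by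
    rw [mul_assoc, mul_invOfUnit _ _ (by simpa using hW), mul_one]
  rw [e p, e q]
  exact coeff_mul_congr_le fun j hj => h j (by omega)

end Ray

/-! ### Quotients of path series -/

section Quot

variable {A B : Type*} [CommRing A] [CommRing B] {n m : ℕ}

/-- The quotient of two path series. -/
noncomputable def quot (S T : Set ℕ) (x : ℕ → A) : A⟦X⟧ :=
  pathSeries S x * invOfUnit (pathSeries T x) 1

theorem quot_mul (S T : Set ℕ) (x : ℕ → A) : quot S T x * pathSeries T x = pathSeries S x := by
  rw [quot, mul_assoc, mul_comm (invOfUnit _ _), mul_invOfUnit _ _ (by simp), mul_one]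

theorem eq_quot {S T : Set ℕ} {x : ℕ → A} {p : A⟦X⟧} (h : p * pathSeries T x = pathSeries S x) :
    p = quot S T x := by
  ext k
  exact coeff_congr_of_coeff_mul (W := pathSeries T x) (n := k + 1) (by simp)
    (fun j _ => by rw [h, quot_mul]) k.lt_succ_self

theorem map_quot (φ : A →+* B) (S T : Set ℕ) (x : ℕ → A) :
    PowerSeries.map φ (quot S T x) = quot S T (fun i => φ (x i)) := by
  refine eq_quot ?_
  rw [← map_pathSeries, ← map_pathSeries, ← _root_.map_mul, quot_mul]

theorem coeff_quot_eq_zero {S T : Set ℕ} {k : ℕ}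
    (h : coeff k (quot S T (MvPolynomial.X : ℕ → MvPolynomial ℕ ℤ)) = 0) (x : ℕ → A) :
    coeff k (quot S T x) = 0 := by
  have := map_quot (MvPolynomial.aeval (R := ℤ) x).toRingHom S T MvPolynomial.X
  simp only [AlgHom.toRingHom_eq_coe, RingHom.coe_coe, MvPolynomial.aeval_X] at this
  rw [← this, coeff_map, h, map_zero]

theorem coeff_part_quot_eq_zero {S T : Set ℕ} {k : ℕ}
    (h : coeff k (quot S T (MvPolynomial.X : ℕ → MvPolynomial ℕ ℤ)) = 0) (x : ℕ → A) (e q : ℕ) :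
    coeff k (part₁₀ (quot S T (biWeight x e q))) = 0 ∧
      coeff k (part₀₁ (quot S T (biWeight x e q))) = 0 := by
  have h1 : coeff k (quot S T (biWeight x e q)) =
      coeff k (0 : (DualNumber (DualNumber A))⟦X⟧) :=
    (coeff_quot_eq_zero h _).trans (map_zero _).symm
  have h2 := part_congr h1
  refine ⟨h2.2.1.trans ?_, h2.2.2.1.trans ?_⟩
  · rw [part₁₀, coeff_basePart, coeff_epsPart, map_zero, TrivSqZeroExt.snd_zero,
      TrivSqZeroExt.fst_zero]
  · rw [part₀₁, coeff_epsPart, coeff_basePart, map_zero, TrivSqZeroExt.fst_zero,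
      TrivSqZeroExt.snd_zero]

/-- The congruence `P_S P_{S*} = P_T P_{T*}` is divided by `P_T P_{S*}`. Hence one and the same
quotient carries information about both ends of the interval. -/
theorem Sim.coeff_quot {S T : Set ℕ} (h : Sim n S T) (x : ℕ → A) {k : ℕ} (hk : k < n) :
    coeff k (quot (refl n T) (refl n S) x) = coeff k (quot S T x) := by
  refine coeff_congr_of_coeff_mul (W := pathSeries T x * pathSeries (refl n S) x) (n := n)
    (by simp) (fun j hj => ?_) hk
  rw [← mul_assoc (quot S T x), quot_mul, h.coeff_mul_eq x hj, mul_comm (pathSeries T x),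
    ← mul_assoc, quot_mul, mul_comm]

theorem coeff_part₁₀_zero {k : ℕ} (h0 : 0 < k) (U : Set ℕ) :
    pathSeries U (0 : ℕ → ℤ) = 1 ∧
      coeff k (part₁₀ (pathSeries U (biWeight (0 : ℕ → ℤ) k 1))) = chi U k := by
  have hs : stepSeries (0 : ℕ → ℤ) = 0 := by ext i; simp [stepSeries]
  have hp : pathSeries U (0 : ℕ → ℤ) = 1 := by
    ext s
    by_cases h : s = 0
    · simp [h]
    · rw [coeff_pathSeries U _ h, hs, mul_zero, map_zero, mul_zero, coeff_one, if_neg h]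
  refine ⟨hp, ?_⟩
  rw [(coeff_part_pathSeries U (0 : ℕ → ℤ) h0 one_pos h0.ne').1, hs, hp]
  simp

/-- In the `k`-th coefficient of the quotient, the variable of index `k` has linear coefficient
`χ_S(k) - χ_T(k)`. -/
theorem mem_iff_of_coeff_quot {S T : Set ℕ} {k : ℕ} (h0 : 0 < k)
    (h : coeff k (quot S T (MvPolynomial.X : ℕ → MvPolynomial ℕ ℤ)) = 0) : k ∈ S ↔ k ∈ T := by
  rw [← chi_eq_iff, ← (coeff_part₁₀_zero h0 S).2, ← (coeff_part₁₀_zero h0 T).2,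
    ← quot_mul S T, part₁₀_mul, part₀₀_pathSeries, (coeff_part₁₀_zero h0 T).1, mul_one, map_add]
  have e : part₀₀ (quot S T (biWeight (0 : ℕ → ℤ) k 1)) = 1 := by
    have := congrArg part₀₀ (quot_mul S T (biWeight (0 : ℕ → ℤ) k 1))
    rwa [part₀₀_mul, part₀₀_pathSeries, part₀₀_pathSeries, (coeff_part₁₀_zero h0 T).1,
      (coeff_part₁₀_zero h0 S).1, mul_one] at this
  rw [e, one_mul, (coeff_part_quot_eq_zero h _ _ _).1, add_zero]

/-- The restriction of the variables to the multiples of `m`. -/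
noncomputable def restr (m : ℕ) (i : ℕ) : MvPolynomial ℕ ℤ :=
  if m ∣ i then MvPolynomial.X i else 0

/-- The multiples of `m` in `S`. -/
def mults (m : ℕ) (S : Set ℕ) : Set ℕ := {s | s ∈ S ∧ m ∣ s}

theorem onRay_stepSeries {x : ℕ → A} (hx : ∀ i, ¬ m ∣ i → x i = 0) :
    OnRay n m 0 (stepSeries x) := by
  intro k _ hne
  by_cases hk : m ∣ k
  · obtain ⟨j, rfl⟩ := hk
    exact ⟨j, by simp⟩
  · refine (hne ?_).elim
    rw [coeff_stepSeries (by rintro rfl; simp at hk), hx k hk]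

theorem onRay_pathSeries (S : Set ℕ) {x : ℕ → A} (hx : ∀ i, ¬ m ∣ i → x i = 0) :
    OnRay n m 0 (pathSeries S x) :=
  OnRay.of_rec (a := fun s => (chi S s : A)) (onRay_stepSeries hx) (coeff_zero_stepSeries x)
    onRay_zero (fun _ => rfl) fun s hs _ => by rw [add_zero, coeff_pathSeries S x hs.ne']

theorem onRay_quot (S T : Set ℕ) {x : ℕ → A} (hx : ∀ i, ¬ m ∣ i → x i = 0) :
    OnRay n m 0 (quot S T x) :=
  OnRay.of_mul (onRay_pathSeries T hx) (coeff_zero_pathSeries T x)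
    (by rw [quot_mul]; exact onRay_pathSeries S hx)

theorem restr_of_not_dvd {m i : ℕ} (h : ¬ m ∣ i) : restr m i = 0 := if_neg h

theorem coeff_pathSeries_mul_restr (S : Set ℕ) {s : ℕ} (hs : m ∣ s) :
    coeff s (pathSeries S (restr m) * stepSeries MvPolynomial.X) =
      coeff s (pathSeries S (restr m) * stepSeries (restr m)) := by
  rw [coeff_mul, coeff_mul]
  refine Finset.sum_congr rfl fun ij hij => ?_
  rw [Finset.HasAntidiagonal.mem_antidiagonal] at hij
  by_cases h : coeff ij.1 (pathSeries S (restr m)) = 0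
  · rw [h, zero_mul, zero_mul]
  · have h1 : m ∣ ij.1 := (onRay_pathSeries (n := ij.1 + 1) S (fun i => restr_of_not_dvd)).dvd
      (by omega) h
    have h2 : m ∣ ij.2 := (Nat.dvd_add_right h1).1 (hij ▸ hs)
    by_cases h0 : ij.2 = 0
    · rw [h0]; simp
    · rw [coeff_stepSeries h0, coeff_stepSeries h0, restr, if_pos h2]

/-- If all steps are multiples of `m`, a chain from `0` meets multiples of `m` only; conversely,
chains through multiples of `m` use no other steps. -/
theorem pathSeries_restr (m : ℕ) (S : Set ℕ) :
    pathSeries S (restr m) = pathSeries (mults m S) MvPolynomial.X := by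
  ext1 k
  refine coeff_eq_coeff_pathSeries (n := k + 1) (by simp) (fun s hs _ => ?_) k k.lt_succ_self
  by_cases hm : m ∣ s
  · rw [coeff_pathSeries_mul_restr S hm, coeff_pathSeries S _ hs.ne',
      chi_congr (S := mults m S) (T := S) ⟨fun h => h.1, fun h => ⟨h, hm⟩⟩]
  · rw [chi_of_notMem (S := mults m S) fun h => hm h.2, Int.cast_zero, zero_mul]
    by_contra h
    exact hm ((onRay_pathSeries (n := s + 1) S (fun i => restr_of_not_dvd)).dvd (by omega) h)

theorem quot_restr (m : ℕ) (S T : Set ℕ) :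
    quot S T (restr m) = quot (mults m S) (mults m T) MvPolynomial.X := by
  rw [quot, quot, pathSeries_restr, pathSeries_restr]

theorem mults_eq_self {S : Set ℕ} (h : ∀ s ∈ S, m ∣ s) : mults m S = S :=
  Set.ext fun s => ⟨fun hs => hs.1, fun hs => ⟨hs, h s hs⟩⟩

/-- All weights at nonmultiples of `m` are set to zero. Since `m ∣ n`, the final step of a chain
through multiples of `m` is not lost. -/
theorem Sim.mults {S T : Set ℕ} (h : Sim n S T) (hm : m ∣ n) :
    Sim n (mults m S) (mults m T) := by
  have := h.total_eq (restr m)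
  rw [total, total, ← coeff_pathSeries_mul_restr S hm, ← coeff_pathSeries_mul_restr T hm,
    pathSeries_restr, pathSeries_restr] at this
  exact this

end Quot

/-! ### Defects -/

section Defect

variable {A : Type*} [CommRing A] {n m c z : ℕ} {S T : Set ℕ} {W g g' h L p p' : A⟦X⟧}

/-- When `p` and `p'` satisfy the recursions of `S` and `T`, the defect `p - L p'` satisfies that of
`S`, with an additional term that compares `χ_S(s)` with `χ_T(r)` for each exponent `s - r` in the
support of `L`. -/
theorem coeff_defect (hp : ∀ s, 0 < s → s < n → coeff s p = (chi S s : A) * coeff s (p * W + g))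
    (hp' : ∀ s, 0 < s → s < n → coeff s p' = (chi T s : A) * coeff s (p' * W + g'))
    (hp0 : coeff 0 p' = 0) (hg : g = h + L * g') (hG0 : coeff 0 (p' * W + g') = 0) {s : ℕ}
    (hs0 : 0 < s) (hs : s < n) :
    coeff s (p - L * p') = (chi S s : A) * coeff s ((p - L * p') * W + h) +
      ∑ zr ∈ Finset.HasAntidiagonal.antidiagonal s,
        coeff zr.1 L * (((chi S s - chi T zr.2 : ℤ) : A) * coeff zr.2 (p' * W + g')) := by
  have e1 : coeff s (L * p') = ∑ zr ∈ Finset.HasAntidiagonal.antidiagonal s,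
      coeff zr.1 L * ((chi T zr.2 : A) * coeff zr.2 (p' * W + g')) := by
    rw [coeff_mul]
    refine Finset.sum_congr rfl fun zr hzr => ?_
    rw [Finset.HasAntidiagonal.mem_antidiagonal] at hzr
    rcases Nat.eq_zero_or_pos zr.2 with h0 | h0
    · rw [h0, hp0, hG0]; simp
    · rw [hp' _ h0 (by omega)]
  have e2 : p * W + g = ((p - L * p') * W + h) + L * (p' * W + g') := by rw [hg]; ring
  rw [map_sub, e1, hp s hs0 hs, e2, map_add _ _ (L * _), coeff_mul _ L, mul_add, Finset.mul_sum,
    add_sub_assoc, ← Finset.sum_sub_distrib]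
  congr 1
  refine Finset.sum_congr rfl fun zr _ => ?_
  push_cast
  ring

/-- Comparison terms with an exponent of `L` below `z` vanish, because such exponents are periods
off the multiples of `m`. The other factor begins in degree `c`, so nothing survives below `c + z`,
and in degree `c + z` only the pair `(z, c)` and the source `h` do. -/
theorem defect_lowest (hn : 0 < n)
    (hp : ∀ s, 0 < s → s < n → coeff s p = (chi S s : A) * coeff s (p * W + g))
    (hp' : ∀ s, 0 < s → s < n → coeff s p' = (chi T s : A) * coeff s (p' * W + g'))
    (hW : coeff 0 W = 0) (hp0 : coeff 0 p = 0) (hp0' : coeff 0 p' = 0) (hg : g = h + L * g')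
    (hG : OnRay n m c (p' * W + g')) (hc : ¬ m ∣ c)
    (hST : ∀ s, 0 < s → s < n → ¬ m ∣ s → chi T s = chi S s)
    (hper : ∀ z' < z, coeff z' L ≠ 0 → ∀ y, 0 < y → ¬ m ∣ y → y + z' < n →
      chi S (y + z') = chi S y)
    (hh : ∀ s < c + z, coeff s h = 0) :
    (∀ s < c + z, s < n → coeff s (p - L * p') = 0) ∧
      (c + z < n → coeff (c + z) (p - L * p') = (chi S (c + z) : A) * coeff (c + z) h +
        coeff z L * (((chi S (c + z) - chi S c : ℤ) : A) * coeff c (p' * W + g'))) := by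
  have hG0 : coeff 0 (p' * W + g') = 0 := by
    by_contra h'
    exact (hG.not_dvd hc hn h').2 (dvd_zero m)
  have hc0 : 0 < c := Nat.pos_of_ne_zero fun h' => hc (h' ▸ dvd_zero m)
  have term : ∀ s, s < n → ∀ zr ∈ Finset.HasAntidiagonal.antidiagonal s, zr.1 < z →
      coeff zr.1 L * (((chi S s - chi T zr.2 : ℤ) : A) * coeff zr.2 (p' * W + g')) = 0 := by
    intro s hs zr hzr hz
    rw [Finset.HasAntidiagonal.mem_antidiagonal] at hzr
    by_contra h'
    have h1 := left_ne_zero_of_mul h'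
    obtain ⟨h3, h4⟩ := hG.not_dvd hc (by omega) (right_ne_zero_of_mul (right_ne_zero_of_mul h'))
    have := hper _ hz h1 zr.2 (by omega) h4 (by omega)
    rw [add_comm, hzr] at this
    rw [this, hST _ (by omega) (by omega) h4] at h'
    simp at h'
  have low : ∀ s < c + z, s < n → coeff s (p - L * p') = 0 := by
    intro s
    induction s using Nat.strong_induction_on with
    | _ s ih =>
      intro hs hsn
      rcases Nat.eq_zero_or_pos s with rfl | hs0
      · simp only [map_sub, hp0, zero_sub, neg_eq_zero, coeff_mul,
          Finset.HasAntidiagonal.antidiagonal_zero, Finset.sum_singleton, hp0', mul_zero]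
      rw [coeff_defect hp hp' hp0' hg hG0 hs0 hsn, map_add, hh s hs, add_zero,
        coeff_mul_congr (q := 0) hW fun k hk => by
          rw [ih k hk (by omega) (by omega), map_zero],
        zero_mul, map_zero, mul_zero, zero_add]
      refine Finset.sum_eq_zero fun zr hzr => ?_
      by_cases hz : zr.1 < z
      · exact term s hsn zr hzr hz
      · rw [Finset.HasAntidiagonal.mem_antidiagonal] at hzr
        have : coeff zr.2 (p' * W + g') = 0 := by
          by_contra h'
          have := (hG.not_dvd hc (by omega) h').1
          omega
        rw [this, mul_zero, mul_zero]
  refine ⟨low, fun hn => ?_⟩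
  rw [coeff_defect hp hp' hp0' hg hG0 (by omega) hn, map_add,
    coeff_mul_congr (q := 0) hW fun k hk => by rw [low k hk (by omega), map_zero],
    zero_mul, map_zero, zero_add]
  congr 1
  rw [Finset.sum_eq_single (z, c)]
  · dsimp only
    rw [hST c hc0 (by omega) hc]
  · intro zr hzr hne
    by_cases hz : zr.1 < z
    · exact term _ hn zr hzr hz
    · rw [Finset.HasAntidiagonal.mem_antidiagonal] at hzr
      have : coeff zr.2 (p' * W + g') = 0 := by
        by_contra h'
        have := (hG.not_dvd hc (by omega) h').1
        exact hne (Prod.ext (by dsimp only; omega) (by dsimp only; omega))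
      rw [this, mul_zero, mul_zero]
  · intro h'
    exact (h' (by rw [Finset.HasAntidiagonal.mem_antidiagonal, add_comm])).elim

variable {x : ℕ → A} {e q : ℕ}

theorem onRay_part_pathSeries (S : Set ℕ) (hx : ∀ i, ¬ m ∣ i → x i = 0) (he : 0 < e) (hq : 0 < q) :
    OnRay n m e (part₁₀ (pathSeries S (biWeight x e q))) ∧
      OnRay n m q (part₀₁ (pathSeries S (biWeight x e q))) ∧
      OnRay n m (e + q) (part₁₁ (pathSeries S (biWeight x e q))) := by
  have hW : OnRay n m 0 (stepSeries x) := onRay_stepSeries hx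
  have h0 := onRay_pathSeries (n := n) S hx
  have h1 : OnRay n m e (part₁₀ (pathSeries S (biWeight x e q))) :=
    OnRay.of_rec (a := fun s => (chi S s : A)) hW (coeff_zero_stepSeries x)
      (by simpa using h0.mul (onRay_X_pow (c := e)))
      (fun h => (h (coeff_zero_part_pathSeries S x).1).elim)
      fun s hs _ => (coeff_part_pathSeries S x he hq hs.ne').1
  have h2 : OnRay n m q (part₀₁ (pathSeries S (biWeight x e q))) :=
    OnRay.of_rec (a := fun s => (chi S s : A)) hW (coeff_zero_stepSeries x)
      (by simpa using h0.mul (onRay_X_pow (c := q)))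
      (fun h => (h (coeff_zero_part_pathSeries S x).2.1).elim)
      fun s hs _ => (coeff_part_pathSeries S x he hq hs.ne').2.1
  refine ⟨h1, h2, OnRay.of_rec (a := fun s => (chi S s : A)) hW (coeff_zero_stepSeries x)
    ((h1.mul (onRay_X_pow (c := q))).add
      (add_comm q e ▸ h2.mul (onRay_X_pow (c := e)) : OnRay n m (e + q) _))
    (fun h => (h (coeff_zero_part_pathSeries S x).2.2).elim) fun s hs _ => ?_⟩
  rw [(coeff_part_pathSeries S x he hq hs.ne').2.2, add_assoc]

theorem part₀₀_quot (S T : Set ℕ) (x : ℕ → A) (e q : ℕ) :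
    part₀₀ (quot S T (biWeight x e q)) = quot S T x := by
  refine eq_quot ?_
  have := congrArg part₀₀ (quot_mul S T (biWeight x e q))
  rwa [part₀₀_mul, part₀₀_pathSeries, part₀₀_pathSeries] at this

theorem part₀₁_defect (S T : Set ℕ) (x : ℕ → A) (e q : ℕ) :
    part₀₁ (pathSeries S (biWeight x e q)) - quot S T x * part₀₁ (pathSeries T (biWeight x e q)) =
      part₀₁ (quot S T (biWeight x e q)) * pathSeries T x := by
  have := congrArg part₀₁ (quot_mul S T (biWeight x e q))
  rw [part₀₁_mul, part₀₀_pathSeries, part₀₀_quot] at this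
  rw [← this]
  ring

theorem coeff_add_of_onRay {p : A⟦X⟧} {W : A⟦X⟧} (hp : OnRay n m c p) (hW : OnRay n m 0 W)
    (hW0 : coeff 0 W = 0) (hc : c < n) : coeff c (p * W) = 0 := by
  have := hp.coeff_add_mul hW (by omega)
  rwa [add_zero, hW0, mul_zero] at this

/-- The lowest term of the derivative of a quotient of path series. -/
theorem part₀₁_quot_lowest (hn : 0 < n) (hx : ∀ i, ¬ m ∣ i → x i = 0) (he : 0 < e)
    (hq : ¬ m ∣ q) (hST : ∀ s, 0 < s → s < n → ¬ m ∣ s → chi T s = chi S s)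
    (hper : ∀ z' < z, coeff z' (quot S T x) ≠ 0 → ∀ y, 0 < y → ¬ m ∣ y → y + z' < n →
      chi S (y + z') = chi S y) (hqz : q + z < n) :
    (∀ s < q + z, coeff s (part₀₁ (quot S T (biWeight x e q))) = 0) ∧
      coeff (q + z) (part₀₁ (quot S T (biWeight x e q))) =
        coeff z (quot S T x) * (chi S (q + z) - chi S q : ℤ) := by
  have hq0 : 0 < q := Nat.pos_of_ne_zero fun h' => hq (h' ▸ dvd_zero m)
  have hr : OnRay n m q (pathSeries T x * X ^ q) := by
    simpa using (onRay_pathSeries T hx).mul (onRay_X_pow (c := q))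
  have hr2 := (onRay_part_pathSeries (n := n) T hx he hq0).2.1
  have hW : OnRay n m 0 (stepSeries x) := onRay_stepSeries hx
  have key := defect_lowest (n := n) (z := z) (S := S) (T := T) (m := m) (c := q)
    (W := stepSeries x)
    (p := part₀₁ (pathSeries S (biWeight x e q))) (p' := part₀₁ (pathSeries T (biWeight x e q)))
    (g := pathSeries S x * X ^ q) (g' := pathSeries T x * X ^ q) (h := 0) (L := quot S T x)
    hn (fun s hs _ => (coeff_part_pathSeries S x he hq0 hs.ne').2.1)
    (fun s hs _ => (coeff_part_pathSeries T x he hq0 hs.ne').2.1)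
    (coeff_zero_stepSeries x) (coeff_zero_part_pathSeries S x).2.1
    (coeff_zero_part_pathSeries T x).2.1
    (by rw [zero_add, ← mul_assoc, quot_mul])
    ((by simpa using hr2.mul hW : OnRay n m q _).add hr) hq hST hper (fun _ _ => map_zero _)
  rw [part₀₁_defect] at key
  obtain ⟨k1, k2⟩ := coeff_of_coeff_mul (coeff_zero_pathSeries T x)
    fun s (hs : s < q + z) => key.1 s hs (by omega)
  refine ⟨k1, k2.trans ?_⟩
  rw [key.2 hqz, map_zero, mul_zero, zero_add, map_add,
    coeff_add_of_onRay hr2 hW (coeff_zero_stepSeries x) (by omega), zero_add]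
  have : coeff q (pathSeries T x * X ^ q) = 1 := by
    have := coeff_mul_X_pow (pathSeries T x) q 0
    rwa [zero_add, coeff_zero_pathSeries] at this
  rw [this, mul_one]

end Defect

/-- If the quotient of the path series is supported on multiples of `m`, then the elements of the
support after restriction of the variables are periods off the multiples of `m`. -/
theorem chi_add_of_quot {N m : ℕ} {S T : Set ℕ}
    (hL : ∀ k < N, coeff k (quot S T (MvPolynomial.X : ℕ → MvPolynomial ℕ ℤ)) ≠ 0 → m ∣ k)
    (hST : ∀ s, 0 < s → s < N → ¬ m ∣ s → chi T s = chi S s) {z : ℕ}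
    (hz : coeff z (quot S T (restr m)) ≠ 0) {y : ℕ} (hy : ¬ m ∣ y) (hyz : y + z < N) :
    chi S (y + z) = chi S y := by
  induction z using Nat.strong_induction_on generalizing y with
  | _ z ih =>
    have key := (part₀₁_quot_lowest (e := 1) (n := N) (by omega) (fun i => restr_of_not_dvd)
      one_pos hy hST (fun z' hz' hne y _ hy hyz => ih z' hz' hne hy hyz) hyz).2
    have hmz : m ∣ z := (onRay_quot (n := z + 1) S T (fun i => restr_of_not_dvd)).dvd (by omega) hz
    -- The exponent `y + z` is no multiple of `m`, so the coefficient of the quotient vanishes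
    -- identically, and so does its derivative. The lowest term formula then leaves a nonzero
    -- coefficient times the jump of `χ_S` from `y` to `y + z`.
    have h0 : coeff (y + z) (part₀₁ (quot S T (biWeight (restr m) 1 y))) = 0 := by
      refine (coeff_part_quot_eq_zero ?_ _ _ _).2
      by_contra h'
      exact hy ((Nat.dvd_add_left hmz).1 (hL _ hyz h'))
    rw [h0] at key
    have := (mul_eq_zero.1 key.symm).resolve_left hz
    have := Int.cast_eq_zero.1 this
    omega

/-! ### Sets of cuts which are periodic off the multiples of a number -/

/-- The set is `z`-periodic on the numbers from `1` to `n - 1` which are no multiples of `d`. -/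
def PerOff (S : Set ℕ) (n d z : ℕ) : Prop :=
  ∀ y, 0 < y → ¬ d ∣ y → y + z < n → (y + z ∈ S ↔ y ∈ S)

namespace PerOff

variable {S : Set ℕ} {n d p q : ℕ}

theorem window (hp : PerOff S n d p) (x : ℤ) (hx : ¬ (d : ℤ) ∣ x) (h0 : 0 < x) (hn : x + p < n) :
    ((x + p).toNat ∈ S) = (x.toNat ∈ S) := by
  obtain ⟨k, rfl⟩ := Int.eq_ofNat_of_zero_le h0.le
  exact propext (hp k (by omega) (fun h => hx (Int.natCast_dvd_natCast.2 h)) (by omega))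

/-- The left end `0` of the interval is a multiple of `d`, so the weak inequality for the lengths
suffices in the theorem of Fine and Wilf. -/
theorem gcd (hp : PerOff S n d p) (hq : PerOff S n d q) (hdp : d ∣ p) (hdq : d ∣ q)
    (h : p + q ≤ n) : PerOff S n d (Nat.gcd p q) := by
  intro y h0 hy hyn
  have := window_period_gcd (w := fun x : ℤ => (x.toNat ∈ S)) (a := 0) (b := n) (d := d)
    (Int.natCast_dvd_natCast.2 hdp) (Int.natCast_dvd_natCast.2 hdq)
    (Or.inr ⟨by omega, dvd_zero _⟩) hp.window hq.window y
    (fun h => hy (Int.natCast_dvd_natCast.1 h)) (by omega) (by omega)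
  exact iff_of_eq this

theorem congr (hp : PerOff S n d p) (hdp : d ∣ p) {x y : ℕ} (h0 : 0 < x) (hx : x < n)
    (hdx : ¬ d ∣ x) (hy : 0 < y) (hyn : y < n) (h : (p : ℤ) ∣ y - x) : y ∈ S ↔ x ∈ S := by
  have := window_congr (w := fun x : ℤ => (x.toNat ∈ S)) (a := 0) (b := n) (d := d)
    (Int.natCast_dvd_natCast.2 hdp) hp.window (x := x) (y := y)
    (fun h => hdx (Int.natCast_dvd_natCast.1 h)) (by omega) (by omega) (by omega) (by omega) h
  exact iff_of_eq this

/-- Periods are joined in increasing order. The bound on the lengths is needed only where the gcd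
really drops, which is what `SuppStructure` will supply. -/
theorem gcdUpTo {r : ℕ → Prop} {N : ℕ} (h : ∀ z, 0 < z → z ≤ N → r z → PerOff S n d z ∧ d ∣ z)
    (hr : ∀ z ≤ N, r z → RibbonCount.gcdUpTo r (z - 1) ≠ 0 → ¬ RibbonCount.gcdUpTo r (z - 1) ∣ z →
      z + RibbonCount.gcdUpTo r (z - 1) ≤ n) : PerOff S n d (RibbonCount.gcdUpTo r N) := by
  induction N with
  | zero => intro y _ _ _; rfl
  | succ N ih =>
    have ih := ih (fun z h0 hz => h z h0 (by omega)) (fun z hz => hr z (by omega))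
    by_cases hp : r (N + 1)
    swap
    · rwa [gcdUpTo_succ_of_neg hp]
    rw [gcdUpTo_succ_of_pos hp]
    by_cases h0 : RibbonCount.gcdUpTo r N = 0
    · rw [h0, Nat.gcd_zero_left]
      exact (h _ (by omega) le_rfl hp).1
    by_cases h1 : RibbonCount.gcdUpTo r N ∣ N + 1
    · rwa [Nat.gcd_eq_left h1]
    exact ih.gcd (h _ (by omega) le_rfl hp).1
      (dvd_gcdUpTo fun k k0 hk hk2 => (h k k0 (by omega) hk2).2) (h _ (by omega) le_rfl hp).2
      (by rw [add_comm]; exact hr _ le_rfl hp h0 h1)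

end PerOff

/-! ### Factoring path series of periodic sets of cuts -/

section Structured

variable {A : Type*} [CommRing A] {n p : ℕ}

/-- Each chain is split at the last multiple of `p` that it meets. By periodicity the rest is a
translate of a chain through `V`. -/
theorem pathSeries_factor {U V : Set ℕ} (x : ℕ → A) (hV : ∀ s, p ∣ s → s ∉ V)
    (hUV : ∀ s < n, ¬ p ∣ s → ∀ r < s, p ∣ r → (s ∈ U ↔ s - r ∈ V)) {s : ℕ} (hs : s < n) :
    coeff s (pathSeries U x) =
      coeff s ((mk fun k => if p ∣ k then coeff k (pathSeries U x) else 0) * pathSeries V x) := by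
  set Θ : A⟦X⟧ := mk fun k => if p ∣ k then coeff k (pathSeries U x) else 0 with hΘ
  have hΘ0 : ∀ k, ¬ p ∣ k → coeff k Θ = 0 := fun k hk => by rw [hΘ, coeff_mk, if_neg hk]
  induction s using Nat.strong_induction_on with
  | _ s ih =>
    by_cases hps : p ∣ s
    · rw [coeff_mul, Finset.sum_eq_single (s, 0)]
      · rw [coeff_zero_pathSeries, mul_one, hΘ, coeff_mk, if_pos hps]
      · intro ij hij hne
        rw [Finset.HasAntidiagonal.mem_antidiagonal] at hij
        by_cases h : p ∣ ij.1
        · have h2 : p ∣ ij.2 := (Nat.dvd_add_right h).1 (hij ▸ hps)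
          have h0 : ij.2 ≠ 0 := fun h2 => hne (Prod.ext (by dsimp only; omega) h2)
          rw [coeff_pathSeries V x h0, chi_of_notMem (hV _ h2), Int.cast_zero, zero_mul, mul_zero]
        · rw [hΘ0 _ h, zero_mul]
      · intro h'
        exact (h' (by rw [Finset.HasAntidiagonal.mem_antidiagonal, add_zero])).elim
    · have h0 : s ≠ 0 := by rintro rfl; simp at hps
      rw [coeff_pathSeries U x h0, coeff_mul_congr (coeff_zero_stepSeries x)
        fun k hk => ih k hk (by omega), mul_assoc, coeff_mul, coeff_mul, Finset.mul_sum]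
      refine Finset.sum_congr rfl fun ij hij => ?_
      rw [Finset.HasAntidiagonal.mem_antidiagonal] at hij
      by_cases h : p ∣ ij.1
      · have h2 : ¬ p ∣ ij.2 := fun h2 => hps (hij ▸ dvd_add h h2)
        have h3 : ij.2 ≠ 0 := by intro h3; simp [h3] at h2
        rw [coeff_pathSeries V x h3, chi_congr (hUV s hs hps ij.1 (by omega) h),
          show s - ij.1 = ij.2 by omega]
        ring
      · rw [hΘ0 _ h, zero_mul, zero_mul, mul_zero]

/-- If two sets of cuts agree off the multiples of `p` and are `p`-periodic there, then the quotient
of their path series is supported on the multiples of `p`. -/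
theorem dvd_of_coeff_quot {S T : Set ℕ} (hST : ∀ s, 0 < s → s < n → ¬ p ∣ s → (s ∈ S ↔ s ∈ T))
    (hper : PerOff S n p p) (x : ℕ → A) {k : ℕ} (hk : k < n) (hne : coeff k (quot S T x) ≠ 0) :
    p ∣ k := by
  set V : Set ℕ := {s | s ∈ S ∧ ¬ p ∣ s}
  have hV : ∀ s, p ∣ s → s ∉ V := fun s hs h => h.2 hs
  have hSV : ∀ s < n, ¬ p ∣ s → ∀ r < s, p ∣ r → (s ∈ S ↔ s - r ∈ V) := by
    intro s hs hps r hr hpr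
    have h1 : ¬ p ∣ s - r := fun h => hps (by
      have := dvd_add h hpr; rwa [Nat.sub_add_cancel hr.le] at this)
    rw [hper.congr dvd_rfl (x := s - r) (by omega) (by omega) h1 (by omega) hs]
    · exact ⟨fun h => ⟨h, h1⟩, fun h => h.1⟩
    · rw [Nat.cast_sub hr.le, sub_sub_cancel]
      exact Int.natCast_dvd_natCast.2 hpr
  have hTV : ∀ s < n, ¬ p ∣ s → ∀ r < s, p ∣ r → (s ∈ T ↔ s - r ∈ V) := fun s hs hps r hr hpr => by
    rw [← hST s (by omega) hs hps, hSV s hs hps r hr hpr]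
  have h1 := fun s (hs : s < n) => pathSeries_factor x hV hSV hs
  have h2 := fun s (hs : s < n) => pathSeries_factor x hV hTV hs
  set ΘS : A⟦X⟧ := mk fun k => if p ∣ k then coeff k (pathSeries S x) else 0
  set ΘT : A⟦X⟧ := mk fun k => if p ∣ k then coeff k (pathSeries T x) else 0
  have ray : ∀ U : Set ℕ, OnRay n p 0
      (mk fun k => if p ∣ k then coeff k (pathSeries U x) else 0 : A⟦X⟧) := by
    intro U k _ hk
    rw [coeff_mk] at hk
    obtain ⟨j, rfl⟩ : p ∣ k := by by_contra h; exact hk (if_neg h)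
    exact ⟨j, (zero_add _).symm⟩
  -- The two path series share the factor belonging to `V`, so below `n` the quotient is that of the
  -- first factors, both of which live on multiples of `p`.
  have h3 : ∀ k < n, coeff k (quot S T x * ΘT) = coeff k ΘS := fun k hk => by
    refine coeff_congr_of_coeff_mul (W := pathSeries V x) (n := n) (by simp) (fun j hj => ?_) hk
    rw [← h1 j hj, ← quot_mul S T x, mul_assoc, mul_comm (quot S T x), mul_comm (quot S T x)]
    exact coeff_mul_congr_le fun i hi => (h2 i (by omega)).symm
  have h4 : OnRay n p 0 (quot S T x * ΘT) := fun k hk hne => ray S k hk (h3 k hk ▸ hne)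
  exact (OnRay.of_mul (ray T) (by simp) h4).dvd hk hne

end Structured

end RibbonCount

namespace RibbonCount

open PowerSeries

/-! ### The support of a quotient of path series -/

/-- The number `z` is in the support of the quotient of the path series of `S` and `T`. -/
def QuotSupp (S T : Set ℕ) (z : ℕ) : Prop :=
  coeff z (quot S T (MvPolynomial.X : ℕ → MvPolynomial ℕ ℤ)) ≠ 0

section

variable {n m : ℕ} {S T : Set ℕ}

theorem quotSupp_of_ne {f : ℕ} (h0 : 0 < f) (h : ¬ (f ∈ S ↔ f ∈ T)) : QuotSupp S T f :=
  fun h' => h (mem_iff_of_coeff_quot h0 h')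

theorem QuotSupp.dvd {z : ℕ} (hS : ∀ s ∈ S, m ∣ s) (hT : ∀ s ∈ T, m ∣ s) (h : QuotSupp S T z) :
    m ∣ z := by
  rw [QuotSupp, ← mults_eq_self hS, ← mults_eq_self hT, ← quot_restr] at h
  exact (onRay_quot (n := z + 1) S T (fun i => restr_of_not_dvd)).dvd (by omega) h

theorem Sim.ne_sub (h : Sim n S T) {f : ℕ} (h0 : 0 < f) (hf : f < n) (hne : ¬ (f ∈ S ↔ f ∈ T)) :
    ¬ (n - f ∈ S ↔ n - f ∈ T) := by
  rw [← chi_eq_iff] at hne ⊢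
  have := h.chi_add_chi h0 hf
  omega

theorem Sim.quotSupp_dvd (h : Sim n S T) {f g : ℕ} (h0 : 0 < f) (hf : f < n)
    (hne : ¬ (f ∈ S ↔ f ∈ T)) (hg : ∀ k, 0 < k → k < n → ¬ (k ∈ S ↔ k ∈ T) → g ∣ k) : g ∣ n := by
  have h1 := hg f h0 hf hne
  have h2 := hg (n - f) (by omega) (by omega) (h.ne_sub h0 hf hne)
  have := dvd_add h2 h1
  rwa [Nat.sub_add_cancel hf.le] at this

theorem PerOff.of_mults {p q : ℕ} (hpq : p ∣ q) (h1 : PerOff S n p q)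
    (h2 : PerOff (mults p S) n q q) : PerOff S n q q := by
  intro y h0 hy hyn
  by_cases hp : p ∣ y
  · have := h2 y h0 hy hyn
    exact ⟨fun h => (this.1 ⟨h, dvd_add hp hpq⟩).1, fun h => (this.2 ⟨h, hp⟩).1⟩
  · exact h1 y h0 hp hyn

theorem mem_iff_of_mults {p q : ℕ} (h1 : ∀ s, 0 < s → s < n → ¬ p ∣ s → (s ∈ S ↔ s ∈ T))
    (h2 : ∀ s, 0 < s → s < n → ¬ q ∣ s → (s ∈ mults p S ↔ s ∈ mults p T)) :
    ∀ s, 0 < s → s < n → ¬ q ∣ s → (s ∈ S ↔ s ∈ T) := by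
  intro s h0 hs hq
  by_cases hp : p ∣ s
  · have := h2 s h0 hs hq
    exact ⟨fun h => (this.1 ⟨h, hp⟩).1, fun h => (this.2 ⟨h, hp⟩).1⟩
  · exact h1 s h0 hs hp

theorem mults_ne {p f : ℕ} (hf : p ∣ f) (hne : ¬ (f ∈ S ↔ f ∈ T)) :
    ¬ (f ∈ mults p S ↔ f ∈ mults p T) := fun h => hne
  ⟨fun h' => (h.1 ⟨h', hf⟩).1, fun h' => (h.2 ⟨h', hf⟩).1⟩

theorem chi_eq_of_dvd {p N : ℕ} (hF : ∀ k, 0 < k → k < n → ¬ (k ∈ S ↔ k ∈ T) → p ∣ k)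
    (hN : N ≤ n) : ∀ s, 0 < s → s < N → ¬ p ∣ s → chi T s = chi S s := by
  intro s h0 hs hp
  by_contra h
  exact hp (hF s h0 (by omega) fun h' => h (chi_congr h'.symm))

theorem eq_of_dvd_of_lt_two_mul {p x : ℕ} (h : p ∣ x) (h0 : 0 < x) (hx : x < 2 * p) : x = p := by
  obtain ⟨c, rfl⟩ := h
  have hc : c < 2 := by
    by_contra hc
    have : p * 2 ≤ p * c := Nat.mul_le_mul_left p (by omega)
    omega
  have : c ≠ 0 := by rintro rfl; simp at h0
  obtain rfl : c = 1 := by omega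
  rw [mul_one]

/-- What the induction on the modulus proves about the support of the quotient. -/
structure SuppStructure (n : ℕ) (S T : Set ℕ) : Prop where
  add_le : ∀ ζ < n, QuotSupp S T ζ → gcdUpTo (QuotSupp S T) (ζ - 1) ≠ 0 →
    ¬ gcdUpTo (QuotSupp S T) (ζ - 1) ∣ ζ → ζ + gcdUpTo (QuotSupp S T) (ζ - 1) ≤ n
  dvd : gcdUpTo (QuotSupp S T) (n - 1) ∣ n
  mem_iff : ∀ s, 0 < s → s < n → ¬ gcdUpTo (QuotSupp S T) (n - 1) ∣ s → (s ∈ S ↔ s ∈ T)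
  perOff : PerOff S n (gcdUpTo (QuotSupp S T) (n - 1)) (gcdUpTo (QuotSupp S T) (n - 1))

/-- Suppose that `ζ + p > n`. Then `S` and `T` differ at multiples of `p` only, and the inductive
hypothesis applies to their restrictions to these. Exponents of the restricted quotient are periods
of `S` below `ζ` and, by reflection, near the right end. The two ranges overlap enough to get a
period `p1`, a multiple of `p`, on the whole interval. Then the full quotient is supported on
multiples of `p1`, contradicting `¬ p ∣ ζ`. -/
theorem SuppStructure.add_le_of (hS : ∀ s ∈ S, m ∣ s) (hT : ∀ s ∈ T, m ∣ s) (h : Sim n S T)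
    (hne : ∃ f, 0 < f ∧ f < n ∧ ¬ (f ∈ S ↔ f ∈ T))
    (ih : ∀ p, m ∣ p → m ≠ p → p < n → (∃ f, 0 < f ∧ f < n ∧ ¬ (f ∈ mults p S ↔ f ∈ mults p T)) →
      Sim n (mults p S) (mults p T) → SuppStructure n (mults p S) (mults p T)) {ζ : ℕ}
    (hζn : ζ < n) (hζ : QuotSupp S T ζ)
    (hpζ : ¬ gcdUpTo (QuotSupp S T) (ζ - 1) ∣ ζ) :
    ζ + gcdUpTo (QuotSupp S T) (ζ - 1) ≤ n := by
  by_contra hlt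
  set p := gcdUpTo (QuotSupp S T) (ζ - 1) with hp
  have hζ0 : ζ ≠ 0 := by rintro h; rw [h] at hpζ; exact hpζ (dvd_zero _)
  have hple : p ≤ ζ - 1 := gcdUpTo_le
  -- A difference at `k ≥ ζ` is mirrored at `n - k`. That is positive and smaller than `p`, but as
  -- an exponent below `ζ` it would be a multiple of `p`.
  have hF : ∀ k, 0 < k → k < n → ¬ (k ∈ S ↔ k ∈ T) → p ∣ k := by
    intro k h0 hk hne
    rcases Nat.lt_or_ge k ζ with hkζ | hkζ
    · exact gcdUpTo_dvd h0 (by omega) (quotSupp_of_ne h0 hne)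
    · have : p ∣ n - k := gcdUpTo_dvd (by omega) (by omega)
        (quotSupp_of_ne (by omega) (h.ne_sub h0 hk hne))
      have := Nat.le_of_dvd (by omega) this
      omega
  obtain ⟨f, hf0, hfn, hf⟩ := hne
  have hpn : p ∣ n := h.quotSupp_dvd hf0 hfn hf hF
  have hmp : m ∣ p := dvd_gcdUpTo fun k _ _ hk => hk.dvd hS hT
  have hmne : m ≠ p := fun h' => hpζ (h' ▸ hζ.dvd hS hT)
  set S' := mults p S
  set T' := mults p T
  have hs : SuppStructure n S' T' := ih p hmp hmne (by omega)
    ⟨f, hf0, hfn, mults_ne (hF f hf0 hfn hf) hf⟩ (h.mults hpn)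
  have hdvd : ∀ z, QuotSupp S' T' z → p ∣ z := fun z hz => hz.dvd (fun s hs => hs.2) fun s hs => hs.2
  have hL : ∀ k < ζ, QuotSupp S T k → p ∣ k := by
    intro k hk hne
    rcases Nat.eq_zero_or_pos k with rfl | h0
    · exact dvd_zero _
    · exact gcdUpTo_dvd h0 (by omega) hne
  have hST := chi_eq_of_dvd hF le_rfl
  have hleft : ∀ z, QuotSupp S' T' z → ∀ y, ¬ p ∣ y → y + z < ζ → chi S (y + z) = chi S y :=
    fun z hz y hy hyz => chi_add_of_quot hL (chi_eq_of_dvd hF hζn.le)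
      (by rw [quot_restr]; exact hz) hy hyz
  have hright : ∀ z, QuotSupp S' T' z → ∀ y, 0 < y → ¬ p ∣ y → y + z < ζ →
      chi S (n - (y + z)) = chi S (n - y) := by
    intro z hz y hy0 hy hyz
    have aux : ∀ s, 0 < s → s < n → ¬ p ∣ s → chi T (n - s) = chi S (n - s) := by
      intro s h0 hs hps
      refine hST _ (by omega) (by omega) fun h' => hps ?_
      have := Nat.dvd_sub hpn h'
      rwa [Nat.sub_sub_self hs.le] at this
    have key := chi_add_of_quot (S := refl n T) (T := refl n S) (N := ζ) (m := p)
      (fun k hk hne => hL k hk (by rwa [h.coeff_quot _ (by omega)] at hne))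
      (fun s h0 hs hps => by rw [chi_refl, chi_refl, aux s h0 (by omega) hps])
      (z := z) (by rw [h.coeff_quot _ (by omega), quot_restr]; exact hz) hy hyz
    rw [chi_refl, chi_refl] at key
    rwa [aux y hy0 (by omega) hy, aux (y + z) (by omega) (by omega)
      (fun h' => hy ((Nat.dvd_add_left (hdvd z hz)).1 h'))] at key
  -- If `y + z ≥ ζ`, then `n - (y + z) < p`, so `n - y < p + z ≤ n - p < ζ`, and the mirrored
  -- statement applies.
  have hfull : ∀ z, QuotSupp S' T' z → z + 2 * p ≤ n → PerOff S n p z := by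
    intro z hz hzn y hy0 hy hyz
    rw [← chi_eq_iff]
    rcases Nat.lt_or_ge (y + z) ζ with h1 | h1
    · exact hleft z hz y hy h1
    · have hy' : ¬ p ∣ n - (y + z) := fun h' => hy ((Nat.dvd_add_left (hdvd z hz)).1 (by
        have := Nat.dvd_sub hpn h'
        rwa [Nat.sub_sub_self hyz.le] at this))
      have := hright z hz (n - (y + z)) (by omega) hy' (by omega)
      rw [Nat.sub_sub_self hyz.le, show n - (n - (y + z) + z) = y by omega] at this
      exact this.symm
  -- Exponents up to `n - 2 p` are covered by `hfull`. The only other multiple of `p` below `n` can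
  -- be `n - p`, which is treated separately in `hall`.
  set p1 := gcdUpTo (QuotSupp S' T') (n - 2 * p) with hp1
  have hpp1 : p ∣ p1 := dvd_gcdUpTo fun k _ _ hk => hdvd k hk
  have hper : PerOff S n p p1 := PerOff.gcdUpTo
    (fun z h0 hz hz' => ⟨hfull z hz' (by omega), hdvd z hz'⟩)
    fun z hz hz' => hs.add_le z (by omega) hz'
  -- Otherwise each difference `f` and its mirror image `n - f` exceed `n - 2 p`, so both are less
  -- than `2 p` and hence equal to `p`. But a midpoint cannot be a difference, by `chi_add_chi`.
  have hp10 : p1 ≠ 0 := by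
    intro h0
    have hno : ∀ k, 0 < k → k ≤ n - 2 * p → ¬ QuotSupp S' T' k := fun k hk0 hk hk' => by
      have : p1 ∣ k := gcdUpTo_dvd hk0 hk hk'
      rw [h0, zero_dvd_iff] at this
      omega
    have hf' := h.ne_sub hf0 hfn hf
    have hpf := hF f hf0 hfn hf
    have hpf' := hF (n - f) (by omega) (by omega) hf'
    have a1 : ¬ f ≤ n - 2 * p := fun hle => hno f hf0 hle (quotSupp_of_ne hf0 (mults_ne hpf hf))
    have a2 : ¬ n - f ≤ n - 2 * p := fun hle => hno (n - f) (by omega) hle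
      (quotSupp_of_ne (by omega) (mults_ne hpf' hf'))
    have b1 := eq_of_dvd_of_lt_two_mul hpf' (by omega) (by omega)
    have b2 := eq_of_dvd_of_lt_two_mul hpf hf0 (by omega)
    have := h.chi_add_chi hf0 hfn
    rw [show n - f = f by omega] at this
    exact hf (chi_eq_iff.1 (by omega))
  have hall : ∀ z, 0 < z → z < n → QuotSupp S' T' z → p1 ∣ z := by
    intro z hz0 hzn hz
    by_cases hle : z ≤ n - 2 * p
    · exact gcdUpTo_dvd hz0 hle hz
    by_contra hnd
    have e1 : n - z = p := eq_of_dvd_of_lt_two_mul (Nat.dvd_sub hpn (hdvd z hz)) (by omega)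
      (by omega)
    have e2 : gcdUpTo (QuotSupp S' T') (z - 1) = p1 := by
      refine Nat.dvd_antisymm (gcdUpTo_dvd_of_le (by omega)) (dvd_gcdUpTo fun k hk0 hk hk' => ?_)
      refine gcdUpTo_dvd hk0 ?_ hk'
      by_contra hk2
      have := eq_of_dvd_of_lt_two_mul (Nat.dvd_sub hpn (hdvd k hk')) (by omega) (by omega)
      omega
    have := hs.add_le z hzn hz (by rwa [e2]) (by rwa [e2])
    rw [e2] at this
    have h1 : p1 ≤ p := by omega
    have h2 := Nat.le_of_dvd (Nat.pos_of_ne_zero hp10) hpp1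
    exact hnd ((by omega : p1 = p) ▸ hdvd z hz)
  have e : gcdUpTo (QuotSupp S' T') (n - 1) = p1 :=
    Nat.dvd_antisymm (gcdUpTo_dvd_of_le (by omega))
      (dvd_gcdUpTo fun k hk0 hk hk' => hall k hk0 (by omega) hk')
  have hs1 := hs.mem_iff
  have hs2 := hs.perOff
  rw [e] at hs1 hs2
  have hFi : ∀ s, 0 < s → s < n → ¬ p ∣ s → (s ∈ S ↔ s ∈ T) := fun s h0 hs hps => by
    by_contra h'
    exact hps (hF s h0 hs h')
  exact hpζ (hpp1.trans (dvd_of_coeff_quot (mem_iff_of_mults hFi hs1) (hper.of_mults hpp1 hs2) _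
    hζn hζ))

/-- The modulus grows in the induction. Restricted to the multiples of the gcd `g` of the support,
the pair is structured with some gcd `g'`, a multiple of `g`. Its exponents are periods off the
multiples of `g`, so the original pair is structured modulo `g'`. This forces the support of the
original quotient into the multiples of `g'`, whence `g' = g`. -/
theorem SuppStructure.of (hS : ∀ s ∈ S, m ∣ s) (hT : ∀ s ∈ T, m ∣ s) (h : Sim n S T)
    (hne : ∃ f, 0 < f ∧ f < n ∧ ¬ (f ∈ S ↔ f ∈ T)) : SuppStructure n S T := by
  induction hk : n - m using Nat.strong_induction_on generalizing m S T with
  | _ k ihk =>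
  have ih : ∀ p, m ∣ p → m ≠ p → p < n →
      (∃ f, 0 < f ∧ f < n ∧ ¬ (f ∈ mults p S ↔ f ∈ mults p T)) →
      Sim n (mults p S) (mults p T) → SuppStructure n (mults p S) (mults p T) := by
    intro p hmp hmne hp hf hsim
    obtain ⟨f, hf0, hfn, hf'⟩ := id hf
    have hpf : p ∣ f := by
      by_contra h'
      exact hf' ⟨fun h => (h' h.2).elim, fun h => (h' h.2).elim⟩
    have := Nat.le_of_dvd (Nat.pos_of_dvd_of_pos hpf hf0) hmp
    exact ihk (n - p) (by omega) (fun s hs => hs.2) (fun s hs => hs.2) hsim hf rfl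
  have hle : ∀ ζ < n, QuotSupp S T ζ → gcdUpTo (QuotSupp S T) (ζ - 1) ≠ 0 →
      ¬ gcdUpTo (QuotSupp S T) (ζ - 1) ∣ ζ → ζ + gcdUpTo (QuotSupp S T) (ζ - 1) ≤ n :=
    fun ζ hζn hζ _ => SuppStructure.add_le_of hS hT h hne ih hζn hζ
  obtain ⟨f, hf0, hfn, hf⟩ := hne
  set g := gcdUpTo (QuotSupp S T) (n - 1) with hg
  have hF : ∀ k, 0 < k → k < n → ¬ (k ∈ S ↔ k ∈ T) → g ∣ k := fun k h0 hk hne =>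
    gcdUpTo_dvd h0 (by omega) (quotSupp_of_ne h0 hne)
  have hgn : g ∣ n := h.quotSupp_dvd hf0 hfn hf hF
  have hFi : ∀ s, 0 < s → s < n → ¬ g ∣ s → (s ∈ S ↔ s ∈ T) := fun s h0 hs hps => by
    by_contra h'
    exact hps (hF s h0 hs h')
  refine ⟨hle, hgn, hFi, ?_⟩
  have hmg : m ∣ g := dvd_gcdUpTo fun k _ _ hk => hk.dvd hS hT
  -- If the modulus does not grow, `S` has no elements off the multiples of `g`, and periodicity
  -- there is trivial.
  by_cases hne : m = g
  · rw [← hg, ← hne]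
    intro y h0 hy hyn
    exact ⟨fun h' => (hy ((Nat.dvd_add_left dvd_rfl).1 (hS _ h'))).elim,
      fun h' => (hy (hS _ h')).elim⟩
  have hgn' : g < n := by
    have := Nat.le_of_dvd hf0 (hF f hf0 hfn hf)
    omega
  set S' := mults g S
  set T' := mults g T
  have hs : SuppStructure n S' T' := ih g hmg hne hgn'
    ⟨f, hf0, hfn, mults_ne (hF f hf0 hfn hf) hf⟩ (h.mults hgn)
  have hdvd : ∀ z, QuotSupp S' T' z → g ∣ z := fun z hz => hz.dvd (fun s hs => hs.2) fun s hs => hs.2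
  set g' := gcdUpTo (QuotSupp S' T') (n - 1) with hg'
  have hper : PerOff S n g g' := PerOff.gcdUpTo (fun z h0 hz hz' => ⟨fun y hy0 hy hyz => by
      rw [← chi_eq_iff]
      refine chi_add_of_quot (N := n) (m := g) (T := T) (fun k hk hk' => ?_)
        (chi_eq_of_dvd hF le_rfl) (by rw [quot_restr]; exact hz') hy hyz
      rcases Nat.eq_zero_or_pos k with rfl | h0
      · exact dvd_zero _
      · exact gcdUpTo_dvd h0 (by omega) hk', hdvd z hz'⟩)
    fun z hz hz' => hs.add_le z (by omega) hz'
  have hgg' : g ∣ g' := dvd_gcdUpTo fun k _ _ hk => hdvd k hk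
  have hper' := hper.of_mults hgg' hs.perOff
  have hg'g : g' ∣ g := dvd_gcdUpTo fun k hk0 hk hk' =>
    dvd_of_coeff_quot (mem_iff_of_mults hFi hs.mem_iff) hper' _ (by omega) hk'
  have e := Nat.dvd_antisymm hgg' hg'g
  rw [← hg, e]
  exact hper'

end

end RibbonCount

namespace RibbonCount

open PowerSeries

/-! ### Mixed second derivatives -/

theorem coeff_add_mul_of_lower {A : Type*} [CommRing A] {p q : A⟦X⟧} {a b : ℕ}
    (hp : ∀ s < a, coeff s p = 0) (hq : ∀ s < b, coeff s q = 0) :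
    coeff (a + b) (p * q) = coeff a p * coeff b q := by
  have ray : ∀ {p : A⟦X⟧} {a : ℕ}, (∀ s < a, coeff s p = 0) → ∀ n, OnRay n 1 a p := by
    intro p a hp n k _ hne
    have : a ≤ k := by
      by_contra h
      exact hne (hp k (by omega))
    exact ⟨k - a, by omega⟩
  exact (ray hp (a + b + 1)).coeff_add_mul (ray hq _) (by omega)

theorem coeff_mul_eq_zero_of_lower {A : Type*} [CommRing A] {p : A⟦X⟧} {a : ℕ}
    (hp : ∀ s < a, coeff s p = 0) (q : A⟦X⟧) : ∀ s < a, coeff s (p * q) = 0 := by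
  intro s hs
  rw [coeff_mul_congr_le (q := 0) fun k hk => by rw [hp k (by omega), map_zero], zero_mul,
    map_zero]

section Second

variable {A : Type*} [CommRing A] {n m z e q : ℕ} {S T : Set ℕ} {x : ℕ → A}

theorem coeff_part₁₀_self (S : Set ℕ) (hx : ∀ i, ¬ m ∣ i → x i = 0) (he : 0 < e) (hq : 0 < q) :
    coeff e (part₁₀ (pathSeries S (biWeight x e q))) = (chi S e : A) ∧
      coeff q (part₀₁ (pathSeries S (biWeight x e q))) = (chi S q : A) := by
  have h1 : ∀ k, coeff k (pathSeries S x * X ^ k) = 1 := fun k => by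
    have := coeff_mul_X_pow (pathSeries S x) k 0
    rwa [zero_add, coeff_zero_pathSeries] at this
  refine ⟨?_, ?_⟩
  · rw [(coeff_part_pathSeries S x he hq he.ne').1, map_add,
      coeff_add_of_onRay (onRay_part_pathSeries (n := e + 1) S hx he hq).1 (onRay_stepSeries hx)
        (coeff_zero_stepSeries x) (by omega), h1, zero_add, mul_one]
  · rw [(coeff_part_pathSeries S x he hq hq.ne').2.1, map_add,
      coeff_add_of_onRay (onRay_part_pathSeries (n := q + 1) S hx he hq).2.1 (onRay_stepSeries hx)
        (coeff_zero_stepSeries x) (by omega), h1, zero_add, mul_one]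

theorem part₁₀_defect (S T : Set ℕ) (x : ℕ → A) (e q : ℕ) :
    part₁₀ (pathSeries S (biWeight x e q)) - quot S T x * part₁₀ (pathSeries T (biWeight x e q)) =
      part₁₀ (quot S T (biWeight x e q)) * pathSeries T x := by
  have := congrArg part₁₀ (quot_mul S T (biWeight x e q))
  rw [part₁₀_mul, part₀₀_pathSeries, part₀₀_quot] at this
  rw [← this]
  ring

theorem part₁₁_defect (S T : Set ℕ) (x : ℕ → A) (e q : ℕ) :
    part₁₁ (pathSeries S (biWeight x e q)) - quot S T x * part₁₁ (pathSeries T (biWeight x e q)) =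
      part₀₁ (quot S T (biWeight x e q)) * part₁₀ (pathSeries T (biWeight x e q)) +
      part₁₀ (quot S T (biWeight x e q)) * part₀₁ (pathSeries T (biWeight x e q)) +
      part₁₁ (quot S T (biWeight x e q)) * pathSeries T x := by
  have := congrArg part₁₁ (quot_mul S T (biWeight x e q))
  rw [part₁₁_mul, part₀₀_pathSeries, part₀₀_quot] at this
  rw [← this]
  ring

/-- Here the source is itself a defect: that of the derivative at `q`, shifted by `e`, gives the
first summand, while the one at `e` vanishes by `h10`. The second summand compares `e + q + z` with
`e + q`, which is reached from `0` by the two perturbed steps in either order. -/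
theorem part₁₁_defect_lowest (hx : ∀ i, ¬ m ∣ i → x i = 0) (he : ¬ m ∣ e)
    (hq : ¬ m ∣ q) (heq : ¬ m ∣ e + q)
    (hST : ∀ s, 0 < s → s < n → ¬ m ∣ s → chi T s = chi S s)
    (hper : ∀ z' < z, coeff z' (quot S T x) ≠ 0 → ∀ y, 0 < y → ¬ m ∣ y → y + z' < n →
      chi S (y + z') = chi S y) (hn : e + q + z < n)
    (h10 : ∀ s < n, coeff s (part₁₀ (quot S T (biWeight x e q))) = 0) :
    (∀ s < e + q + z, coeff s (part₁₁ (pathSeries S (biWeight x e q)) -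
        quot S T x * part₁₁ (pathSeries T (biWeight x e q))) = 0) ∧
      coeff (e + q + z) (part₁₁ (pathSeries S (biWeight x e q)) -
        quot S T x * part₁₁ (pathSeries T (biWeight x e q))) =
      coeff z (quot S T x) * (chi S (e + q + z) * (chi S (q + z) - chi S q) +
        (chi S (e + q + z) - chi S (e + q)) * (chi S e + chi S q) : ℤ) := by
  have he0 : 0 < e := Nat.pos_of_ne_zero fun h' => he (h' ▸ dvd_zero m)
  have hq0 : 0 < q := Nat.pos_of_ne_zero fun h' => hq (h' ▸ dvd_zero m)
  obtain ⟨r1, r2, r3⟩ := onRay_part_pathSeries (n := n) T hx he0 hq0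
  have hW : OnRay n m 0 (stepSeries x) := onRay_stepSeries hx
  obtain ⟨l1, l2⟩ := part₀₁_quot_lowest (e := e) (by omega) hx he0 hq hST hper
    (by omega : q + z < n)
  have d1 := coeff_mul_eq_zero_of_lower l1 (pathSeries T x)
  have d2 : coeff (q + z) (part₀₁ (quot S T (biWeight x e q)) * pathSeries T x) =
      coeff z (quot S T x) * (chi S (q + z) - chi S q : ℤ) := by
    have := coeff_add_mul_of_lower (q := pathSeries T x) (b := 0) l1 (by simp)
    rwa [add_zero, coeff_zero_pathSeries, mul_one, l2] at this
  have d3 := coeff_mul_eq_zero_of_lower h10 (pathSeries T x)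
  set D01 := part₀₁ (quot S T (biWeight x e q)) * pathSeries T x with hD01
  set D10 := part₁₀ (quot S T (biWeight x e q)) * pathSeries T x with hD10
  have hD10' := part₁₀_defect S T x e q
  have hD01' := part₀₁_defect S T x e q
  have hh : ∀ s < e + q + z, coeff s (D01 * X ^ e + D10 * X ^ q) = 0 := by
    intro s hs
    rw [map_add, coeff_mul_X_pow', coeff_mul_X_pow']
    have : (if e ≤ s then coeff (s - e) D01 else 0) = 0 := by
      split_ifs
      · exact d1 _ (by omega)
      · rfl
    rw [this, d3 _ (by omega), ite_self, add_zero]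
  have hh' : coeff (e + q + z) (D01 * X ^ e + D10 * X ^ q) =
      coeff z (quot S T x) * (chi S (q + z) - chi S q : ℤ) := by
    rw [map_add, coeff_mul_X_pow', coeff_mul_X_pow', d3 _ (by omega), ite_self, add_zero,
      if_pos (by omega), show e + q + z - e = q + z by omega, d2]
  have key := defect_lowest (n := n) (z := z) (S := S) (T := T) (m := m) (c := e + q)
    (W := stepSeries x) (L := quot S T x) (h := D01 * X ^ e + D10 * X ^ q)
    (p := part₁₁ (pathSeries S (biWeight x e q))) (p' := part₁₁ (pathSeries T (biWeight x e q)))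
    (g := part₁₀ (pathSeries S (biWeight x e q)) * X ^ q +
        part₀₁ (pathSeries S (biWeight x e q)) * X ^ e)
    (g' := part₁₀ (pathSeries T (biWeight x e q)) * X ^ q +
        part₀₁ (pathSeries T (biWeight x e q)) * X ^ e)
    (by omega)
    (fun s hs _ => by rw [← add_assoc]; exact (coeff_part_pathSeries S x he0 hq0 hs.ne').2.2)
    (fun s hs _ => by rw [← add_assoc]; exact (coeff_part_pathSeries T x he0 hq0 hs.ne').2.2)
    (coeff_zero_stepSeries x) (coeff_zero_part_pathSeries S x).2.2
    (coeff_zero_part_pathSeries T x).2.2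
    (by rw [hD01, hD10]; linear_combination X ^ q * hD10' + X ^ e * hD01')
    ((r3.mul hW).add ((r1.mul onRay_X_pow).add
      (add_comm q e ▸ r2.mul (onRay_X_pow (c := e)) : OnRay n m (e + q) _)))
    heq hST hper hh
  refine ⟨fun s hs => key.1 s hs (by omega), ?_⟩
  rw [key.2 hn, hh', map_add, coeff_add_of_onRay r3 hW (coeff_zero_stepSeries x) (by omega),
    zero_add, map_add, coeff_mul_X_pow, add_comm e q, coeff_mul_X_pow,
    (coeff_part₁₀_self T hx he0 hq0).1, (coeff_part₁₀_self T hx he0 hq0).2,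
    hST e he0 (by omega) he, hST q hq0 (by omega) hq]
  push_cast
  ring

end Second

/-- Two similar sets of cuts which agree off the multiples of a divisor `m` of `n`, whose asymmetry
is `m`-periodic off the multiples of `m`, and for which the elements below `z` in the support of
the quotient of the path series are periods. -/
structure Adm (n m : ℕ) (S T : Set ℕ) (z : ℕ) : Prop where
  sim : Sim n S T
  dvd : m ∣ n
  agree : ∀ s, 0 < s → s < n → ¬ m ∣ s → chi T s = chi S s
  per : ∀ z' < z, coeff z' (quot S T (restr m)) ≠ 0 → ∀ y, 0 < y → ¬ m ∣ y → y + z' < n →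
    chi S (y + z') = chi S y
  ne : coeff z (quot S T (restr m)) ≠ 0
  skew : ∀ x y, 0 < x → x < n → 0 < y → y < n → ¬ m ∣ x → (m : ℤ) ∣ y - x →
    chi S y - chi S (n - y) = chi S x - chi S (n - x)

/-! ### Violations of periodicity by an admissible pair -/

namespace Adm

variable {n m z : ℕ} {S T : Set ℕ}

theorem dvd_z (h : Adm n m S T z) : m ∣ z :=
  (onRay_quot (n := z + 1) S T (fun i => restr_of_not_dvd)).dvd (by omega) h.ne

theorem not_dvd_sub (h : Adm n m S T z) {s : ℕ} (hs : s < n) (hm : ¬ m ∣ s) : ¬ m ∣ n - s :=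
  fun h' => hm (by
    have := Nat.dvd_sub h.dvd h'
    rwa [Nat.sub_sub_self hs.le] at this)

theorem agree_sub (h : Adm n m S T z) {s : ℕ} (h0 : 0 < s) (hs : s < n) (hm : ¬ m ∣ s) :
    chi T (n - s) = chi S (n - s) := h.agree _ (by omega) (by omega) (h.not_dvd_sub hs hm)

/-- Reflection exchanges the roles of `S` and `T`, since the quotient is `P_S / P_T` at one end and
`P_{T*} / P_{S*}` at the other. -/
theorem refl (h : Adm n m S T z) (hzn : z < n) : Adm n m (refl n T) (refl n S) z where
  sim := h.sim.symm.refl_left.refl_right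
  dvd := h.dvd
  agree s h0 hs hm := by rw [chi_refl, chi_refl, h.agree_sub h0 hs hm]
  per z' hz' hne y h0 hy hyn := by
    rw [h.sim.coeff_quot _ (by omega)] at hne
    have hmz : m ∣ z' := (onRay_quot (n := z' + 1) S T (fun i => restr_of_not_dvd)).dvd
      (by omega) hne
    have hy2 : ¬ m ∣ y + z' := fun h' => hy ((Nat.dvd_add_left hmz).1 h')
    rw [chi_refl, chi_refl, h.agree_sub (by omega) hyn hy2, h.agree_sub h0 (by omega) hy]
    have := h.per z' hz' hne (n - (y + z')) (by omega) (h.not_dvd_sub hyn hy2) (by omega)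
    rw [show n - (y + z') + z' = n - y by omega] at this
    exact this.symm
  ne := by rw [h.sim.coeff_quot _ hzn]; exact h.ne
  skew x y hx0 hx hy0 hy hm hd := by
    have hmy : ¬ m ∣ y := fun h' => hm (by
      have := dvd_sub (Int.natCast_dvd_natCast.2 h') hd
      rw [sub_sub_cancel] at this
      exact Int.natCast_dvd_natCast.1 this)
    rw [chi_refl, chi_refl, chi_refl, chi_refl, Nat.sub_sub_self hx.le, Nat.sub_sub_self hy.le,
      h.agree_sub hx0 hx hm, h.agree_sub hy0 hy hmy, h.agree _ hx0 hx hm, h.agree _ hy0 hy hmy]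
    have := h.skew x y hx0 hx hy0 hy hm hd
    omega

theorem skew_z (h : Adm n m S T z) {y : ℕ} (h0 : 0 < y) (hy : ¬ m ∣ y) (hyz : y + z < n) :
    chi S (y + z) - chi S (n - (y + z)) = chi S y - chi S (n - y) :=
  h.skew y (y + z) h0 (by omega) (by omega) hyz hy (by
    rw [Nat.cast_add, add_sub_cancel_left]; exact Int.natCast_dvd_natCast.2 h.dvd_z)

/-- Only cuts which agree with their mirror images violate the periodicity. -/
theorem chi_sub_eq (h : Adm n m S T z) {q : ℕ} (hq : ¬ m ∣ q) (hqz : q + z < n)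
    (hne : chi S (q + z) ≠ chi S q) : chi S (n - q) = chi S q := by
  have hq0 : 0 < q := Nat.pos_of_ne_zero fun h' => hq (h' ▸ dvd_zero m)
  -- The jump from `q` to `q + z` and the jump from `n - q` to `n - (q + z)` are equal, and a
  -- nonzero jump between zero and one determines the value where it starts.
  have hr := h.refl (by omega)
  have hsk := h.skew_z hq0 hq hqz
  have k1 := (part₀₁_quot_lowest (e := 1) (by omega) (fun i => restr_of_not_dvd) one_pos hq
    h.agree h.per hqz).2
  have k2 := (part₀₁_quot_lowest (e := 1) (by omega) (fun i => restr_of_not_dvd) one_pos hq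
    hr.agree hr.per hqz).2
  have hq2 : ¬ m ∣ q + z := fun h' => hq ((Nat.dvd_add_left h.dvd_z).1 h')
  rw [(part_congr (h.sim.coeff_quot (biWeight (restr m) 1 q) hqz)).2.2.1, k1,
    h.sim.coeff_quot _ (by omega), mul_right_inj' h.ne, Int.cast_inj, chi_refl, chi_refl,
    h.agree_sub (by omega) hqz hq2, h.agree_sub hq0 (by omega) hq] at k2
  rcases chi_eq_zero_or_one S q with h1 | h1 <;> rcases chi_eq_zero_or_one S (q + z) with h2 | h2 <;>
    rcases chi_eq_zero_or_one S (n - q) with h3 | h3 <;>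
    rcases chi_eq_zero_or_one S (n - (q + z)) with h4 | h4 <;> omega

/-- The asymmetry at `e` is `1`, so the reflected sets contain no number below `n` congruent to `e`
modulo `m`, and their path series have no derivative at `e`. The mixed derivative of the quotient is
thus read off directly on the reflected side, whereas on the original side a cross term with the
jump at `q` enters. Comparing lowest terms leaves an equation between zeros and ones. -/
theorem mixed (h : Adm n m S T z) {q e : ℕ} (hq : ¬ m ∣ q) (he : ¬ m ∣ e) (heq : ¬ m ∣ e + q)
    (hn : e + q + z < n) (he1 : chi S e = 1) (he2 : chi S (n - e) = 0)
    (hne : chi S (q + z) ≠ chi S q) :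
    (chi S (e + q) - chi S (n - (e + q)) = 1) ∨
      (chi S (e + q) - chi S (n - (e + q)) = 0 ∧
        chi S (e + q + z) - chi S (e + q) = chi S (q + z) - chi S q) := by
  have hq0 : 0 < q := Nat.pos_of_ne_zero fun h' => hq (h' ▸ dvd_zero m)
  have he0 : 0 < e := Nat.pos_of_ne_zero fun h' => he (h' ▸ dvd_zero m)
  have hr := h.refl (by omega)
  set x := restr m
  have hx : ∀ i, ¬ m ∣ i → x i = 0 := fun i => restr_of_not_dvd
  have hLr : ∀ k < n, coeff k (quot (RibbonCount.refl n T) (RibbonCount.refl n S)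
      (biWeight x e q)) = coeff k (quot S T (biWeight x e q)) :=
    fun k hk => h.sim.coeff_quot (biWeight x e q) hk
  -- The derivative at `e` lives on the exponents `e + m j`. All of these have asymmetry `1`, so
  -- their mirror images are not in `S`.
  have hQ : ∀ U : Set ℕ, (∀ s, 0 < s → s < n → ¬ m ∣ s → chi U s = chi S s) →
      ∀ s < n, coeff s (part₁₀ (pathSeries (RibbonCount.refl n U) (biWeight x e q))) = 0 := by
    intro U hU s hs
    by_contra hne
    obtain ⟨j, hj⟩ := (onRay_part_pathSeries (n := n) _ hx he0 hq0).1 s hs hne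
    have hms : ¬ m ∣ s := fun h' => he (by
      rw [hj] at h'; exact (Nat.dvd_add_left (dvd_mul_right m j)).1 h')
    have h1 := h.skew e s he0 (by omega) (by omega) hs he (by
      rw [hj]; push_cast; rw [add_sub_cancel_left]; exact dvd_mul_right _ _)
    have h2 : chi S (n - s) = 0 := by
      rcases chi_eq_zero_or_one S s with h3 | h3 <;>
        rcases chi_eq_zero_or_one S (n - s) with h4 | h4 <;> omega
    rw [(coeff_part_pathSeries _ x he0 hq0 (by omega)).1, chi_refl,
      hU _ (by omega) (by omega) (h.not_dvd_sub hs hms), h2, Int.cast_zero, zero_mul] at hne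
    exact hne rfl
  have hS0 := hQ S fun _ _ _ _ => rfl
  have hT0 := hQ T h.agree
  have h10r : ∀ s < n, coeff s (part₁₀ (quot (RibbonCount.refl n T) (RibbonCount.refl n S)
      (biWeight x e q))) = 0 := by
    have h1 := part₁₀_defect (RibbonCount.refl n T) (RibbonCount.refl n S) x e q
    have h2 : ∀ s < n, coeff s (part₁₀ (quot (RibbonCount.refl n T) (RibbonCount.refl n S)
        (biWeight x e q)) * pathSeries (RibbonCount.refl n S) x) = 0 := by
      intro s hs
      rw [← h1, map_sub, hT0 s hs, mul_comm, coeff_mul_eq_zero_of_lower hS0 _ s hs, sub_zero]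
    exact (coeff_of_coeff_mul (coeff_zero_pathSeries _ _) h2).1
  have h10 : ∀ s < n, coeff s (part₁₀ (quot S T (biWeight x e q))) = 0 := fun s hs => by
    rw [← (part_congr (hLr s hs)).2.1, h10r s hs]
  obtain ⟨a1, a2⟩ := part₁₁_defect_lowest hx he hq heq h.agree h.per hn h10
  obtain ⟨b1, b2⟩ := part₁₁_defect_lowest hx he hq heq hr.agree hr.per hn h10r
  rw [part₁₁_defect] at a1 a2 b1 b2
  set L := quot S T (biWeight x e q) with hL
  set L' := quot (RibbonCount.refl n T) (RibbonCount.refl n S) (biWeight x e q) with hL'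
  -- On the reflected side both cross terms vanish.
  have c1 : ∀ s < n, coeff s (part₀₁ L' *
      part₁₀ (pathSeries (RibbonCount.refl n S) (biWeight x e q)) + part₁₀ L' *
        part₀₁ (pathSeries (RibbonCount.refl n S) (biWeight x e q)) + part₁₁ L' *
          pathSeries (RibbonCount.refl n S) x) =
      coeff s (part₁₁ L' * pathSeries (RibbonCount.refl n S) x) := by
    intro s hs
    rw [map_add, map_add, mul_comm (part₀₁ L'), coeff_mul_eq_zero_of_lower hS0 _ s hs,
      coeff_mul_eq_zero_of_lower h10r _ s hs, zero_add, zero_add]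
  rw [c1 _ hn] at b2
  obtain ⟨f1, f2⟩ := coeff_of_coeff_mul (k := e + q + z) (coeff_zero_pathSeries _ _)
    (fun s hs => (c1 s (by omega)).symm.trans (b1 s hs))
  rw [b2, (part_congr (hLr _ hn)).2.2.2] at f2
  have f1' : ∀ s < e + q + z, coeff s (part₁₁ L) = 0 := fun s hs => by
    rw [← (part_congr (hLr s (by omega))).2.2.2, f1 s hs]
  obtain ⟨l1, l2⟩ := part₀₁_quot_lowest (e := e) (by omega) hx he0 hq h.agree h.per
    (by omega : q + z < n)
  -- The surviving cross term on the original side; its second factor starts with `χ_T(e) = χ_S(e) =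
  -- 1`.
  have g1 : coeff (e + q + z) (part₀₁ L * part₁₀ (pathSeries T (biWeight x e q))) =
      coeff z (quot S T x) * (chi S (q + z) - chi S q : ℤ) := by
    have := coeff_add_mul_of_lower (b := e) (q := part₁₀ (pathSeries T (biWeight x e q))) l1 (by
      intro s hs
      by_contra h'
      have := ((onRay_part_pathSeries (n := n) T hx he0 hq0).1.not_dvd he (by omega) h').1
      omega)
    rw [show q + z + e = e + q + z by omega] at this
    rw [this, l2, (coeff_part₁₀_self T hx he0 hq0).1, h.agree e he0 (by omega) he, he1,
      Int.cast_one, mul_one]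
  have g2 : coeff (e + q + z) (part₁₁ L * pathSeries T x) = coeff (e + q + z) (part₁₁ L) := by
    have := coeff_add_mul_of_lower (b := 0) (q := pathSeries T x) f1' (by simp)
    rwa [add_zero, coeff_zero_pathSeries, mul_one] at this
  rw [map_add, map_add, g1, g2, f2, coeff_mul_eq_zero_of_lower h10 _ _ hn, add_zero,
    h.sim.coeff_quot _ (by omega), ← mul_add, mul_right_inj' h.ne, ← Int.cast_add,
    Int.cast_inj] at a2
  have m1 : ¬ m ∣ q + z := fun h' => hq ((Nat.dvd_add_left h.dvd_z).1 h')
  have m2 : ¬ m ∣ e + q + z := fun h' => heq ((Nat.dvd_add_left h.dvd_z).1 h')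
  simp only [chi_refl] at a2
  rw [h.agree_sub (by omega) hn m2, h.agree_sub (by omega) (by omega : q + z < n) m1,
    h.agree_sub hq0 (by omega) hq, h.agree_sub he0 (by omega) he,
    h.agree_sub (by omega) (by omega : e + q < n) heq, he1, he2] at a2
  have s1 := h.skew_z (by omega) heq hn
  have s2 := h.skew_z hq0 hq (by omega)
  have s3 := h.chi_sub_eq hq (by omega) hne
  have s4 : chi S (n - (q + z)) = chi S (q + z) := by omega
  rw [s3, s4] at a2
  have h1 := chi_eq_zero_or_one S q
  have h2 := chi_eq_zero_or_one S (q + z)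
  have h3 := chi_eq_zero_or_one S (e + q)
  have h4 := chi_eq_zero_or_one S (n - (e + q))
  have h5 := chi_eq_zero_or_one S (e + q + z)
  have h6 := chi_eq_zero_or_one S (n - (e + q + z))
  clear s2 s3 s4
  generalize chi S q = a1, chi S (q + z) = a2, chi S (e + q) = a3, chi S (n - (e + q)) = a4,
    chi S (e + q + z) = a5, chi S (n - (e + q + z)) = a6 at *
  rcases h1 with rfl | rfl <;> rcases h2 with rfl | rfl <;> rcases h3 with rfl | rfl <;>
    rcases h4 with rfl | rfl <;> rcases h5 with rfl | rfl <;> rcases h6 with rfl | rfl <;> omega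

end Adm

end RibbonCount

namespace RibbonCount

open PowerSeries

/-! ### The structure of similar sets of cuts -/

namespace Adm

variable {n m z : ℕ} {S T : Set ℕ}

/-- Propagation of a violation of the periodicity from `q` to a larger number. -/
theorem propagate_of_lt (h : Adm n m S T z) {q c : ℕ} (hq : ¬ m ∣ q) (hc : ¬ m ∣ c) (hqc : q < c)
    (he : ¬ m ∣ c - q) (hcz : c + z < n) (hne : chi S (q + z) ≠ chi S q)
    (hu : chi S (c - q) - chi S (n - (c - q)) ≠ 0)
    (huc : chi S c - chi S (n - c) ≠ chi S (c - q) - chi S (n - (c - q))) :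
    chi S (c + z) - chi S c = chi S (q + z) - chi S q := by
  have hec : c - q + q = c := Nat.sub_add_cancel hqc.le
  have hq0 : 0 < q := Nat.pos_of_ne_zero fun h' => hq (h' ▸ dvd_zero m)
  have v1 := chi_eq_zero_or_one S (c - q)
  have v2 := chi_eq_zero_or_one S (n - (c - q))
  by_cases hpos : chi S (c - q) = 1
  · have := h.mixed (e := c - q) hq he (by rwa [hec]) (by omega) hpos (by omega) hne
    rw [hec] at this
    omega
  -- The asymmetry at `c - q` is `-1`. It is `1` for the reflected pair, at which `q` is a violation
  -- too.
  · have m1 : ¬ m ∣ q + z := fun h' => hq ((Nat.dvd_add_left h.dvd_z).1 h')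
    have m2 : ¬ m ∣ c + z := fun h' => hc ((Nat.dvd_add_left h.dvd_z).1 h')
    have w1 := h.chi_sub_eq hq (by omega) hne
    have w2 := h.skew_z hq0 hq (by omega)
    have w3 := h.skew_z (by omega) hc hcz
    have hr := h.refl (by omega)
    have := hr.mixed (e := c - q) hq he (by rwa [hec]) (by omega)
      (by rw [chi_refl, h.agree_sub (by omega) (by omega) he]; omega)
      (by rw [chi_refl, Nat.sub_sub_self (by omega), h.agree _ (by omega) (by omega) he]; omega)
      (by
        rw [chi_refl, chi_refl, h.agree_sub (by omega) (by omega) m1,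
          h.agree_sub hq0 (by omega) hq]
        omega)
    rw [hec] at this
    simp only [chi_refl] at this
    rw [h.agree_sub (by omega) (by omega) m1, h.agree_sub hq0 (by omega) hq,
      h.agree_sub (by omega) hcz m2, h.agree_sub (by omega) (by omega : c < n) hc,
      Nat.sub_sub_self (by omega), h.agree c (by omega) (by omega) hc] at this
    omega

/-- For `c < q` reflection reverses the order: the jump between `q` and `q + z` starts at `n - (q +
z)` in the reflected pair, and `n - (q + z) < n - (c + z)`. -/
theorem propagate (h : Adm n m S T z) {q c : ℕ} (hq : ¬ m ∣ q) (hc : ¬ m ∣ c) (hqz : q + z < n)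
    (he : ¬ (m : ℤ) ∣ c - q) (hcz : c + z < n) (hne : chi S (q + z) ≠ chi S q)
    {u : ℤ → ℤ} (hu : ∀ k : ℕ, 0 < k → k < n → ¬ m ∣ k → u k = 2 * (chi S k - chi S (n - k)))
    (hodd : ∀ x, u (-x) = -u x) (hu0 : u (c - q) ≠ 0) (huc : u c ≠ u (c - q)) :
    chi S (c + z) - chi S c = chi S (q + z) - chi S q := by
  have hq0 : 0 < q := Nat.pos_of_ne_zero fun h' => hq (h' ▸ dvd_zero m)
  have hc0 : 0 < c := Nat.pos_of_ne_zero fun h' => hc (h' ▸ dvd_zero m)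
  rcases lt_trichotomy q c with hlt | rfl | hlt
  · have e1 : ((c - q : ℕ) : ℤ) = c - q := Nat.cast_sub hlt.le
    have he' : ¬ m ∣ c - q := fun h' => he (e1 ▸ Int.natCast_dvd_natCast.2 h')
    have h1 := hu (c - q) (by omega) (by omega) he'
    rw [e1] at h1
    have h2 := hu c hc0 (by omega) hc
    exact h.propagate_of_lt hq hc hlt he' hcz hne (by omega) (by omega)
  · rfl
  · have m1 : ¬ m ∣ q + z := fun h' => hq ((Nat.dvd_add_left h.dvd_z).1 h')
    have m2 : ¬ m ∣ c + z := fun h' => hc ((Nat.dvd_add_left h.dvd_z).1 h')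
    have e1 : ((q - c : ℕ) : ℤ) = q - c := Nat.cast_sub hlt.le
    have he' : ¬ m ∣ q - c := fun h' => he (by
      rw [← neg_sub, dvd_neg]; exact e1 ▸ Int.natCast_dvd_natCast.2 h')
    have h1 := hu (q - c) (by omega) (by omega) he'
    have h3 := hodd (c - q)
    rw [e1] at h1
    rw [neg_sub, h1] at h3
    have h2 := hu c hc0 (by omega) hc
    have h4 := h.skew_z hc0 hc hcz
    have hr := h.refl (by omega)
    have a1 := h.agree q hq0 (by omega) hq
    have a2 := h.agree c hc0 (by omega) hc
    have a3 := h.agree (q + z) (by omega) hqz m1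
    have a4 := h.agree (c + z) (by omega) hcz m2
    have a5 := h.agree_sub (by omega) (by omega) he'
    have a6 := h.agree (q - c) (by omega) (by omega) he'
    have a7 := h.agree_sub (by omega) hcz m2
    have := hr.propagate_of_lt (q := n - (q + z)) (c := n - (c + z)) (h.not_dvd_sub hqz m1)
      (h.not_dvd_sub hcz m2) (by omega)
      (by rwa [show n - (c + z) - (n - (q + z)) = q - c by omega]) (by omega)
      (by
        rw [chi_refl, chi_refl, Nat.sub_sub_self hqz.le,
          show n - (n - (q + z) + z) = q by omega, a1, a3]
        exact hne.symm)
      (by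
        rw [chi_refl, chi_refl, show n - (c + z) - (n - (q + z)) = q - c by omega,
          Nat.sub_sub_self (by omega), a5, a6]
        omega)
      (by
        simp only [chi_refl]
        rw [show n - (c + z) - (n - (q + z)) = q - c by omega, Nat.sub_sub_self hcz.le,
          Nat.sub_sub_self (by omega), a4, a5, a6, a7]
        omega)
    simp only [chi_refl] at this
    rw [Nat.sub_sub_self hqz.le, Nat.sub_sub_self hcz.le,
      show n - (n - (q + z) + z) = q by omega, show n - (n - (c + z) + z) = c by omega,
      a1, a2, a3, a4] at this
    omega

end Adm

theorem periodic_of_step {u : ℤ → ℤ} {m : ℕ} (hum : ∀ x, ¬ (m : ℤ) ∣ x → u (x + m) = u x)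
    {x y : ℤ} (hx : ¬ (m : ℤ) ∣ x) (hxy : (m : ℤ) ∣ y - x) : u y = u x :=
  window_congr (a := min x y - 1) (b := max x y + 1) dvd_rfl (fun x hx _ _ => hum x hx) hx
    (by omega) (by omega) (by omega) (by omega) hxy

/-- A modulus for a pair of functions. -/
def IsModulus (n : ℕ) (u v : ℤ → ℤ) (m : ℕ) : Prop :=
  m ∣ n ∧ (∀ x, v x ≠ 0 → (m : ℤ) ∣ x) ∧ (∃ x, u x ≠ 0 ∧ ¬ (m : ℤ) ∣ x) ∧
    ∀ x, ¬ (m : ℤ) ∣ x → u (x + m) = u x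

/-- If translation by `q` preserved `u` off the multiples of `m`, then `u` would vanish at the
multiples of `gcd m q` that are no multiples of `m`, by `eq_zero_of_translation`. Then `gcd m q`
would be a smaller modulus. -/
theorem IsModulus.exists_translate {n m q : ℕ} {u v : ℤ → ℤ} (hn : 0 < n)
    (hodd : ∀ x, u (-x) = -u x) (hm : IsModulus n u v m)
    (hmin : ∀ k < m, ¬ IsModulus n u v k) (hq : ¬ m ∣ q) :
    ∃ e : ℤ, ¬ (m : ℤ) ∣ e ∧ ¬ (m : ℤ) ∣ e + q ∧ u e ≠ 0 ∧ u (e + q) ≠ u e := by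
  obtain ⟨hmn, hv, ⟨x, hx0, hx⟩, hum⟩ := hm
  have hm0 : 0 < m := Nat.pos_of_dvd_of_pos hmn hn
  suffices h : ∃ e : ℤ, ¬ (m : ℤ) ∣ e ∧ ¬ (m : ℤ) ∣ e + q ∧ u (e + q) ≠ u e by
    obtain ⟨e, he, heq, hne⟩ := h
    -- If `u e = 0`, then `u (e + q) ≠ 0`, and by oddness `-(e + q)` can replace `e`.
    by_cases h0 : u e = 0
    · have h1 := hodd (e + q)
      have h2 := hodd e
      refine ⟨-(e + q), by rwa [dvd_neg], ?_, by omega, ?_⟩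
      · rwa [neg_add, neg_add_cancel_right, dvd_neg]
      · rw [neg_add, neg_add_cancel_right, ← neg_add]; omega
    · exact ⟨e, he, heq, h0, hne⟩
  by_contra hno
  have hno : ∀ e : ℤ, ¬ (m : ℤ) ∣ e → ¬ (m : ℤ) ∣ e + q → u (e + q) = u e := by
    intro e he heq
    by_contra h'
    exact hno ⟨e, he, heq, h'⟩
  have hz : ∀ e : ℤ, (Nat.gcd m q : ℤ) ∣ e → ¬ (m : ℤ) ∣ e → u e = 0 := fun e he hme =>
    eq_zero_of_translation hm0 (f := q) (fun x y hx hxy => periodic_of_step hum hx hxy)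
      (fun x _ => hodd x) hno (by rwa [Int.gcd_natCast_natCast]) hme
  have hgm : (Nat.gcd m q : ℤ) ∣ m := Int.natCast_dvd_natCast.2 (Nat.gcd_dvd_left m q)
  have hgq : (Nat.gcd m q : ℤ) ∣ q := Int.natCast_dvd_natCast.2 (Nat.gcd_dvd_right m q)
  refine hmin (Nat.gcd m q) ?_ ⟨(Nat.gcd_dvd_left m q).trans hmn, fun y hy => hgm.trans (hv y hy),
    ⟨x, hx0, fun h' => hx0 (hz x h' hx)⟩, fun y hy => ?_⟩
  · refine lt_of_le_of_ne (Nat.le_of_dvd hm0 (Nat.gcd_dvd_left m q)) fun h' => hq ?_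
    rw [← h']; exact Nat.gcd_dvd_right m q
  · have aux : ∀ y : ℤ, ¬ (Nat.gcd m q : ℤ) ∣ y → ¬ (m : ℤ) ∣ y := fun y hy h' => hy (hgm.trans h')
    refine window_period_gcd (a := y - 1) (b := y + m + q + 2) (d := (Nat.gcd m q : ℤ)) hgm hgq
      (Or.inl (by omega)) (fun x hx _ _ => hum x (aux x hx)) (fun x hx _ _ => ?_) y hy (by omega) ?_
    · exact hno x (aux x hx) (aux _ fun h' => hx ((dvd_add_left hgq).1 h'))
    · have := Nat.le_of_dvd hm0 (Nat.gcd_dvd_left m q)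
      omega

theorem exists_mod {m n : ℕ} (hm : 0 < m) (x : ℤ) (h : m ≤ n) :
    ∃ y : ℕ, y < m ∧ y < n ∧ (m : ℤ) ∣ y - x := by
  have h1 := Int.emod_nonneg x (by omega : (m : ℤ) ≠ 0)
  have h2 := Int.emod_lt_of_pos x (by omega : (0 : ℤ) < m)
  refine ⟨(x % m).toNat, by omega, by omega, ?_⟩
  rw [Int.toNat_of_nonneg h1, ← neg_sub]
  exact (Int.dvd_self_sub_emod).neg_right

/-- A least modulus `m` is taken, and the sets are restricted to its multiples. The exponents of the
restricted quotient are periods of `S` off the multiples of `m`. Together with the structure of the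
restricted pair, this makes their gcd the required number. -/
theorem Sim.exists_perOff {n : ℕ} {S T : Set ℕ} (h : Sim n S T) {e₀ j₀ : ℕ} (he₀ : 0 < e₀)
    (hej : e₀ < j₀) (hj : j₀ < n) (hu₀ : skew n S e₀ + skew n T e₀ ≠ 0)
    (hmin : ∀ k : ℕ, 0 < k → k < j₀ → skew n S k - skew n T k = 0)
    (hv₀ : skew n S j₀ - skew n T j₀ ≠ 0) :
    ∃ m, 1 < m ∧ m < n ∧ m ∣ n ∧ (∀ s, 0 < s → s < n → ¬ m ∣ s → (s ∈ S ↔ s ∈ T)) ∧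
      PerOff S n m m := by
  classical
  have hn : 0 < n := by omega
  set u : ℤ → ℤ := fun x => skew n S x + skew n T x with hu
  set v : ℤ → ℤ := fun x => skew n S x - skew n T x with hv
  have huodd : ∀ x, u (-x) = -u x := fun x => by simp only [hu, skew_neg hn]; ring
  have hvodd : ∀ x, v (-x) = -v x := fun x => by simp only [hv, skew_neg hn]; ring
  obtain ⟨m₀, h1, h2, h3, h4⟩ := exists_modulus hn huodd hvodd
    (fun x => by simp only [hu, skew_add_self]) (fun x => by simp only [hv, skew_add_self])
    (h.skew_sq hn) (fun x y => by
      have := h.skew_mul hn x y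
      simp only [hu, hv]
      linear_combination this) he₀ hej hj hu₀ hmin hv₀
  have hex : ∃ m, IsModulus n u v m :=
    ⟨m₀, h1, h2, ⟨e₀, hu₀, fun h' => h3 (Int.natCast_dvd_natCast.1 h')⟩, h4⟩
  set m := Nat.find hex with hm
  have hmod : IsModulus n u v m := Nat.find_spec hex
  have hmmin : ∀ k < m, ¬ IsModulus n u v k := fun k hk => Nat.find_min hex hk
  have htr := fun q hq => hmod.exists_translate (q := q) hn huodd hmmin hq
  obtain ⟨hmn, hF, ⟨x, hx0, hx⟩, hum⟩ := hmod
  have hm0 : 0 < m := Nat.pos_of_dvd_of_pos hmn hn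
  have hm1 : m ≠ 1 := fun h' => hx (by rw [h']; exact one_dvd x)
  have hvchi : ∀ s : ℕ, 0 < s → s < n → v s = 2 * (chi S s - chi T s) := fun s h0 hs => by
    simp only [hv]
    rw [skew_natCast S h0 hs, skew_natCast T h0 hs]
    have := h.chi_add_chi h0 hs
    omega
  have hagree : ∀ s, 0 < s → s < n → ¬ m ∣ s → chi T s = chi S s := by
    intro s h0 hs hms
    by_contra hne
    refine hms (Int.natCast_dvd_natCast.1 (hF s ?_))
    rw [hvchi s h0 hs]
    omega
  have hnsub : ∀ s, s < n → ¬ m ∣ s → ¬ m ∣ n - s := fun s hs hm h' => hm (by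
    have := Nat.dvd_sub hmn h'
    rwa [Nat.sub_sub_self hs.le] at this)
  have huchi : ∀ s : ℕ, 0 < s → s < n → ¬ m ∣ s → u s = 2 * (chi S s - chi S (n - s)) := by
    intro s h0 hs hms
    simp only [hu]
    rw [skew_natCast S h0 hs, skew_natCast T h0 hs, hagree s h0 hs hms,
      hagree (n - s) (by omega) (by omega) (hnsub s hs hms)]
    ring
  have hmj : m ∣ j₀ := Int.natCast_dvd_natCast.1 (hF j₀ hv₀)
  have hjne : ¬ (j₀ ∈ S ↔ j₀ ∈ T) := fun h' => hv₀ (by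
    have := hvchi j₀ (by omega) hj
    simp only [hv] at this
    rw [this, chi_congr h']; ring)
  -- The mirror image of the first difference `j₀` is a difference as well, hence not smaller; and
  -- it is not equal to `j₀` by `chi_add_chi`.
  have hjn : 2 * j₀ < n := by
    have h1 := h.ne_sub (by omega) hj hjne
    have h2 := hvchi (n - j₀) (by omega) (by omega)
    rw [← chi_eq_iff] at h1
    have h3 : ¬ (n - j₀ < j₀) := fun h' => by
      have := hmin (n - j₀) (by omega) h'
      simp only [hv] at h2
      omega
    have h4 : n - j₀ ≠ j₀ := fun h' => by
      have := h.chi_add_chi (by omega) hj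
      rw [h'] at this
      exact hjne (chi_eq_iff.1 (by omega))
    omega
  set S' := RibbonCount.mults m S
  set T' := RibbonCount.mults m T
  have hs : SuppStructure n S' T' := SuppStructure.of (m := m) (fun s hs => hs.2) (fun s hs => hs.2)
    (h.mults hmn) ⟨j₀, by omega, hj, mults_ne hmj hjne⟩
  have hdvd : ∀ z, QuotSupp S' T' z → m ∣ z := fun z hz => hz.dvd (fun s hs => hs.2) fun s hs => hs.2
  -- A violation at `q` spreads with the same sign to the whole residue class of `q` modulo `m`. An
  -- indicator function cannot jump in the same direction all along such a class.
  have claim : ∀ z, QuotSupp S' T' z → PerOff S n m z := by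
    intro z
    induction z using Nat.strong_induction_on with
    | _ z ih =>
    intro hz q hq0 hq hqz
    rw [← chi_eq_iff]
    by_contra hne
    have hmz := hdvd z hz
    have hz0 : 0 < z := Nat.pos_of_ne_zero fun h' => hne (by rw [h', add_zero])
    have hadm : Adm n m S T z :=
      { sim := h
        dvd := hmn
        agree := hagree
        per := fun z' hz' hne' y h0 hy hyn =>
          chi_eq_iff.2 (ih z' hz' (by rwa [quot_restr] at hne') y h0 hy hyn)
        ne := by rw [quot_restr]; exact hz
        skew := fun x y hx0 hx hy0 hy hm hd => by
          have h1 := periodic_of_step hum (fun h' => hm (Int.natCast_dvd_natCast.1 h')) hd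
          have h2 : ¬ m ∣ y := fun h' => hm (by
            have := dvd_sub (Int.natCast_dvd_natCast.2 h') hd
            rw [sub_sub_cancel] at this
            exact Int.natCast_dvd_natCast.1 this)
          rw [huchi x hx0 hx hm, huchi y hy0 hy h2] at h1
          omega }
    have hzm : z + m ≤ n := by
      have := Nat.le_of_dvd (by omega) (Nat.dvd_sub hmn hmz)
      omega
    have hq' : ¬ (m : ℤ) ∣ q := fun h' => hq (Int.natCast_dvd_natCast.1 h')
    -- Propagation requires a difference that is no multiple of `m` and has nonzero `u`, so the
    -- class of `q` is reached by a detour through the class of `e + q`.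
    obtain ⟨e, he, heq, hue, hueq⟩ := htr q hq
    have cong : ∀ {y : ℕ} {x : ℤ}, (m : ℤ) ∣ y - x → ¬ (m : ℤ) ∣ x → ¬ m ∣ y ∧ u y = u x :=
      fun {y x} hyx hx => ⟨fun h' => hx (by
        have := dvd_sub (Int.natCast_dvd_natCast.2 h') hyx
        rwa [sub_sub_cancel] at this), periodic_of_step hum hx hyx⟩
    obtain ⟨y, hy1, hy2, hy3⟩ := exists_mod hm0 (e + q) (show m ≤ n - z by omega)
    obtain ⟨hy4, hy5⟩ := cong hy3 heq
    have hyq : (m : ℤ) ∣ (y - q) - e := by convert hy3 using 1; ring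
    have hyq2 : ¬ (m : ℤ) ∣ (y : ℤ) - q := fun h' => he (by
      have := dvd_sub h' hyq
      rwa [sub_sub_cancel] at this)
    have hyq3 : u (y - q) = u e := periodic_of_step hum he hyq
    have hδy := hadm.propagate hq hy4 hqz hyq2 (by omega) hne huchi huodd (by rwa [hyq3])
      (by rw [hyq3, hy5]; exact hueq)
    have huq : u q = 0 := by
      rw [huchi q hq0 (by omega) hq, hadm.chi_sub_eq hq hqz hne]; ring
    have hall : ∀ w : ℕ, (m : ℤ) ∣ w - q → w + z < n →
        chi S (w + z) - chi S w = chi S (q + z) - chi S q := by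
      intro w hw hwz
      obtain ⟨hw1, hw2⟩ := cong hw hq'
      have d1 : (m : ℤ) ∣ (w - y) - (-e) := by
        rw [show (w - y : ℤ) - (-e) = w - q - (y - (e + q)) by ring]
        exact dvd_sub hw hy3
      have d2 : ¬ (m : ℤ) ∣ -e := by rwa [dvd_neg]
      have d3 : u (w - y) = -u e := by rw [periodic_of_step hum d2 d1, huodd]
      rw [← hδy]
      refine hadm.propagate hy4 hw1 (by omega) (fun h' => d2 (by
        have := dvd_sub h' d1
        rwa [sub_sub_cancel] at this)) hwz (by omega) huchi huodd (by omega) ?_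
      rw [d3, hw2, huq]
      omega
    have c1 := chi_eq_zero_or_one S q
    have c2 := chi_eq_zero_or_one S (q + z)
    set p := gcdUpTo (QuotSupp S' T') (z - 1) with hp
    by_cases hp0 : p = 0
    · have hzj : z ≤ j₀ := by
        by_contra hlt
        have : p ∣ j₀ := gcdUpTo_dvd (by omega) (by omega)
          (quotSupp_of_ne (by omega) (mults_ne hmj hjne))
        rw [hp0, zero_dvd_iff] at this
        omega
      have h2z : 2 * z + m ≤ n := by
        have := Nat.le_of_dvd (by omega) (Nat.dvd_sub hmn (hmz.mul_left 2))
        omega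
      -- Here `z` is the first positive exponent, so `z ≤ j₀ < n / 2`. There is room for two
      -- successive jumps, at `w` and at `w + z`, which cannot have the same sign.
      obtain ⟨w, hw1, hw2, hw3⟩ := exists_mod hm0 q (show m ≤ n by omega)
      have k1 := hall w hw3 (by omega)
      have k2 := hall (w + z) (by
        rw [show ((w + z : ℕ) : ℤ) - q = w - q + z by push_cast; ring]
        exact dvd_add hw3 (Int.natCast_dvd_natCast.2 hmz)) (by omega)
      have c3 := chi_eq_zero_or_one S w
      have c4 := chi_eq_zero_or_one S (w + z + z)
      omega
    · have hper : PerOff S n m p := PerOff.gcdUpTo (fun z' _ hz' hz'2 =>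
        ⟨ih z' (by omega) hz'2, hdvd z' hz'2⟩)
        (fun z' hz' hz'2 => hs.add_le z' (by omega) hz'2)
      have hmp : m ∣ p := dvd_gcdUpTo fun k _ _ hk => hdvd k hk
      by_cases hpz : p ∣ z
      · exact hne (chi_congr (hper.congr hmp hq0 (by omega) hq (by omega) hqz (by
          rw [Nat.cast_add, add_sub_cancel_left]; exact Int.natCast_dvd_natCast.2 hpz)))
      have hzp : z + p ≤ n := hs.add_le z (by omega) hz hp0 hpz
      have hmp' := Nat.le_of_dvd (Nat.pos_of_ne_zero hp0) hmp
      obtain ⟨w, hw1, hw2, hw3⟩ := exists_mod hm0 q (show m ≤ n by omega)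
      -- The number `r` is chosen so that `r + z` and `w` are congruent modulo the period `p`. Then
      -- the end of the jump at `r` has the same value as the start of the equal jump at `w`.
      obtain ⟨r, hr1, hr2, hr3⟩ := exists_mod (Nat.pos_of_ne_zero hp0) (w - z : ℤ)
        (show p ≤ n by omega)
      have hmr : (m : ℤ) ∣ r - q := by
        rw [show (r : ℤ) - q = r - (w - z) - z + (w - q) by ring]
        exact dvd_add (dvd_sub ((Int.natCast_dvd_natCast.2 hmp).trans hr3)
          (Int.natCast_dvd_natCast.2 hmz)) hw3
      obtain ⟨hw4, -⟩ := cong hw3 hq'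
      obtain ⟨hr4, -⟩ := cong hmr hq'
      have k1 := hall w hw3 (by omega)
      have k2 := hall r hmr (by omega)
      have hw0 : w ≠ 0 := fun h' => hw4 (h' ▸ dvd_zero m)
      have k3 : chi S (r + z) = chi S w := chi_congr (hper.congr hmp (by omega) hw2 hw4 (by omega)
        (by omega) (by convert hr3 using 1; push_cast; ring))
      have c3 := chi_eq_zero_or_one S w
      have c4 := chi_eq_zero_or_one S (w + z)
      have c5 := chi_eq_zero_or_one S r
      omega
  set g := gcdUpTo (QuotSupp S' T') (n - 1) with hg
  have hmg : m ∣ g := dvd_gcdUpTo fun k _ _ hk => hdvd k hk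
  have hper : PerOff S n m g := PerOff.gcdUpTo (fun z _ _ hz => ⟨claim z hz, hdvd z hz⟩)
    (fun z' hz' hz'2 => hs.add_le z' (by omega) hz'2)
  have hg0 : 0 < g := Nat.pos_of_dvd_of_pos hs.dvd hn
  have hgj : g ∣ j₀ := gcdUpTo_dvd (by omega) (by omega)
    (quotSupp_of_ne (by omega) (mults_ne hmj hjne))
  have l1 := Nat.le_of_dvd hg0 hmg
  have l2 := Nat.le_of_dvd (by omega) hgj
  exact ⟨g, by omega, by omega, hs.dvd,
    mem_iff_of_mults (fun s h0 hs hms => chi_eq_iff.1 (hagree s h0 hs hms).symm) hs.mem_iff,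
    hper.of_mults hmg hs.perOff⟩

theorem mem_iff_of_skew {n : ℕ} {S T : Set ℕ} (h : Sim n S T)
    (h0 : ∀ k : ℕ, 0 < k → k < n → skew n S k - skew n T k = 0) :
    ∀ s, 0 < s → s < n → (s ∈ S ↔ s ∈ T) := by
  intro s hs0 hs
  have h1 := h0 s hs0 hs
  rw [skew_natCast S hs0 hs, skew_natCast T hs0 hs] at h1
  have := h.chi_add_chi hs0 hs
  exact chi_eq_iff.1 (by omega)

/-- Two similar sets of cuts coincide up to reflection, or they coincide up to reflection off the
multiples of a proper divisor of `n`, and are periodic there. -/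
theorem Sim.structure {n : ℕ} {S T : Set ℕ} (h : Sim n S T) :
    ∃ T', (T' = T ∨ T' = refl n T) ∧ ((∀ s, 0 < s → s < n → (s ∈ S ↔ s ∈ T')) ∨
      ∃ m, 1 < m ∧ m < n ∧ m ∣ n ∧ (∀ s, 0 < s → s < n → ¬ m ∣ s → (s ∈ S ↔ s ∈ T')) ∧
        PerOff S n m m) := by
  classical
  by_cases hv : ∀ k : ℕ, 0 < k → k < n → skew n S k - skew n T k = 0
  · exact ⟨T, Or.inl rfl, Or.inl (mem_iff_of_skew h hv)⟩
  have hn : 0 < n := by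
    by_contra hn
    exact hv fun k _ hk => by omega
  have hr : ∀ x, skew n (refl n T) x = -skew n T x := skew_refl hn T
  by_cases hu : ∀ k : ℕ, 0 < k → k < n → skew n S k + skew n T k = 0
  · exact ⟨RibbonCount.refl n T, Or.inr rfl, Or.inl (mem_iff_of_skew h.refl_right fun k h0 hk => by
      rw [hr, sub_neg_eq_add]; exact hu k h0 hk)⟩
  push Not at hu hv
  set e := Nat.find hu with he
  set j := Nat.find hv with hj
  obtain ⟨he0, hen, hue⟩ := Nat.find_spec hu
  obtain ⟨hj0, hjn, hvj⟩ := Nat.find_spec hv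
  rw [← he] at he0 hen hue
  rw [← hj] at hj0 hjn hvj
  have hemin : ∀ k : ℕ, 0 < k → k < e → skew n S k + skew n T k = 0 := fun k h0 hk => by
    by_contra h'
    exact Nat.find_min hu hk ⟨h0, by omega, h'⟩
  have hjmin : ∀ k : ℕ, 0 < k → k < j → skew n S k - skew n T k = 0 := fun k h0 hk => by
    by_contra h'
    exact Nat.find_min hv hk ⟨h0, by omega, h'⟩
  -- Reflecting `T` exchanges the sum and the difference of the asymmetries, so either may come
  -- first. A tie is impossible, as their product vanishes.
  rcases lt_trichotomy e j with hlt | heq | hlt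
  · exact ⟨T, Or.inl rfl, Or.inr (h.exists_perOff he0 hlt hjn hue hjmin hvj)⟩
  · have := h.skew_sq hn j
    rw [mul_eq_zero] at this
    rw [heq] at hue
    exact (this.elim hue hvj).elim
  · refine ⟨RibbonCount.refl n T, Or.inr rfl, Or.inr (h.refl_right.exists_perOff hj0 hlt hen ?_ ?_ ?_)⟩
    · rw [hr]; exact hvj
    · intro k h0 hk
      rw [hr, sub_neg_eq_add]
      exact hemin k h0 hk
    · rw [hr, sub_neg_eq_add]; exact hue

end RibbonCount

namespace RibbonCount

open PowerSeries

/-! ### The set of cuts of a composition -/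

/-- The partial sums of a list, including `0` and the sum. -/
def cuts : List ℕ → Set ℕ
  | [] => {0}
  | a :: l => {s | s = 0 ∨ (a ≤ s ∧ s - a ∈ cuts l)}

theorem mem_cuts_nil {s : ℕ} : s ∈ cuts [] ↔ s = 0 := Iff.rfl

theorem mem_cuts_cons {a s : ℕ} {l : List ℕ} :
    s ∈ cuts (a :: l) ↔ s = 0 ∨ (a ≤ s ∧ s - a ∈ cuts l) := Iff.rfl

theorem zero_mem_cuts (l : List ℕ) : 0 ∈ cuts l := by
  cases l with
  | nil => rfl
  | cons a l => exact Or.inl rfl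

theorem sum_mem_cuts (l : List ℕ) : l.sum ∈ cuts l := by
  induction l with
  | nil => rfl
  | cons a l ih => exact Or.inr ⟨by simp, by simpa using ih⟩

theorem le_sum_of_mem_cuts {l : List ℕ} {s : ℕ} (h : s ∈ cuts l) : s ≤ l.sum := by
  induction l generalizing s with
  | nil => exact (mem_cuts_nil.1 h).le
  | cons a l ih =>
    rcases mem_cuts_cons.1 h with h | ⟨h1, h2⟩
    · omega
    · have := ih h2
      rw [List.sum_cons]; omega

theorem mem_cuts_append {l₁ l₂ : List ℕ} {s : ℕ} :
    s ∈ cuts (l₁ ++ l₂) ↔ s ∈ cuts l₁ ∨ (l₁.sum ≤ s ∧ s - l₁.sum ∈ cuts l₂) := by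
  induction l₁ generalizing s with
  | nil =>
    rw [List.nil_append, mem_cuts_nil, List.sum_nil, Nat.sub_zero]
    exact ⟨fun h => Or.inr ⟨Nat.zero_le _, h⟩, fun h => h.elim (fun h => h ▸ zero_mem_cuts l₂)
      fun h => h.2⟩
  | cons a l ih =>
    rw [List.cons_append, mem_cuts_cons, mem_cuts_cons, ih, List.sum_cons, Nat.sub_sub]
    constructor
    · rintro (h | ⟨h1, h2 | ⟨h2, h3⟩⟩)
      · exact Or.inl (Or.inl h)
      · exact Or.inl (Or.inr ⟨h1, h2⟩)
      · exact Or.inr ⟨by omega, h3⟩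
    · rintro ((h | ⟨h1, h2⟩) | ⟨h1, h2⟩)
      · exact Or.inl h
      · exact Or.inr ⟨h1, Or.inl h2⟩
      · exact Or.inr ⟨by omega, Or.inr ⟨by omega, h2⟩⟩

theorem mem_cuts_reverse {l : List ℕ} {s : ℕ} (hs : s ≤ l.sum) :
    s ∈ cuts l.reverse ↔ l.sum - s ∈ cuts l := by
  induction l generalizing s with
  | nil => simp at hs; simp [hs]
  | cons a l ih =>
    rw [List.sum_cons] at hs
    rw [List.reverse_cons, mem_cuts_append, List.sum_reverse, mem_cuts_cons, List.sum_cons,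
      mem_cuts_cons, mem_cuts_nil]
    rcases le_or_gt s l.sum with h | h
    · rw [ih h, show a + l.sum - s - a = l.sum - s by omega]
      constructor
      · rintro (h1 | ⟨h1, h2 | h2⟩)
        · exact Or.inr ⟨by omega, h1⟩
        · rw [show l.sum - s = 0 by omega]
          exact Or.inr ⟨by omega, zero_mem_cuts l⟩
        · rw [show l.sum - s = 0 by omega]
          exact Or.inr ⟨by omega, zero_mem_cuts l⟩
      · rintro (h1 | h1)
        · exact Or.inr ⟨by omega, Or.inr (by omega)⟩
        · exact Or.inl h1.2
    · constructor
      · rintro (h1 | ⟨h1, h2 | h2⟩)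
        · have := le_sum_of_mem_cuts h1
          rw [List.sum_reverse] at this
          omega
        · omega
        · exact Or.inl (by omega)
      · rintro (h1 | h1)
        · exact Or.inr ⟨by omega, Or.inr (by omega)⟩
        · omega

theorem eq_of_cuts {l l' : List ℕ} (hl : ∀ a ∈ l, 0 < a) (hl' : ∀ a ∈ l', 0 < a)
    (hsum : l.sum = l'.sum) (h : ∀ s, 0 < s → s < l.sum → (s ∈ cuts l ↔ s ∈ cuts l')) :
    l = l' := by
  induction l generalizing l' with
  | nil =>
    cases l' with
    | nil => rfl
    | cons b l' =>
      have := hl' b (by simp)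
      rw [List.sum_nil, List.sum_cons] at hsum
      omega
  | cons a l ih =>
    have ha := hl a (by simp)
    cases l' with
    | nil =>
      rw [List.sum_nil, List.sum_cons] at hsum
      omega
    | cons b l' =>
      have hb := hl' b (by simp)
      rw [List.sum_cons, List.sum_cons] at hsum
      simp only [List.sum_cons, mem_cuts_cons] at h
      have hab : a = b := by
        rcases lt_trichotomy a b with hlt | heq | hlt
        · have := h a ha (by omega)
          rw [Nat.sub_self] at this
          have := this.1 (Or.inr ⟨le_rfl, zero_mem_cuts l⟩)
          omega
        · exact heq
        · have := h b hb (by omega)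
          rw [Nat.sub_self] at this
          have := this.2 (Or.inr ⟨le_rfl, zero_mem_cuts l'⟩)
          omega
      subst hab
      congr 1
      refine ih (fun c hc => hl c (by simp [hc])) (fun c hc => hl' c (by simp [hc])) (by omega)
        fun s h0 hs => ?_
      have := h (a + s) (by omega) (by omega)
      rw [Nat.add_sub_cancel_left] at this
      constructor
      · intro h1
        rcases this.1 (Or.inr ⟨by omega, h1⟩) with h2 | h2
        · omega
        · exact h2.2
      · intro h1
        rcases this.2 (Or.inr ⟨by omega, h1⟩) with h2 | h2
        · omega
        · exact h2.2

/-- The first unit forms a part of its own if `1 ∈ S`; otherwise it is added to the first part of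
the list for the shifted set. -/
theorem exists_cuts (n : ℕ) (S : Set ℕ) : ∃ l : List ℕ, (∀ a ∈ l, 0 < a) ∧ l.sum = n ∧
    ∀ s, 0 < s → s < n → (s ∈ cuts l ↔ s ∈ S) := by
  induction n generalizing S with
  | zero => exact ⟨[], by simp, rfl, fun s _ h => by omega⟩
  | succ n ih =>
    obtain ⟨l, hl, hsum, h⟩ := ih {s | s + 1 ∈ S}
    rcases l with - | ⟨a, l⟩
    · rw [List.sum_nil] at hsum
      exact ⟨[1], by simp, by simp [← hsum], fun s h0 hs => by omega⟩
    · have ha := hl a (by simp)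
      rw [List.sum_cons] at hsum
      by_cases h1 : 1 ∈ S
      · refine ⟨1 :: a :: l, by simpa using hl, by rw [List.sum_cons, List.sum_cons]; omega,
          fun s h0 hs => ?_⟩
        rw [mem_cuts_cons]
        rcases Nat.lt_or_ge 1 s with h2 | h2
        · have := h (s - 1) (by omega) (by omega)
          rw [this, Set.mem_ofPred_eq, Nat.sub_add_cancel h0]
          exact ⟨fun h3 => h3.elim (fun h4 => by omega) fun h4 => h4.2, fun h3 => Or.inr ⟨h0, h3⟩⟩
        · obtain rfl : s = 1 := by omega
          exact ⟨fun _ => h1, fun _ => Or.inr ⟨le_rfl, zero_mem_cuts _⟩⟩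
      · refine ⟨(a + 1) :: l, fun b hb => ?_, by rw [List.sum_cons]; omega, fun s h0 hs => ?_⟩
        · rcases List.mem_cons.1 hb with rfl | hb
          · omega
          · exact hl b (by simp [hb])
        rw [mem_cuts_cons]
        rcases Nat.lt_or_ge 1 s with h2 | h2
        · have := h (s - 1) (by omega) (by omega)
          rw [mem_cuts_cons, Set.mem_ofPred_eq, Nat.sub_add_cancel h0, Nat.sub_sub,
            add_comm 1 a] at this
          rw [← this]
          constructor
          · rintro (h3 | h3)
            · omega
            · exact Or.inr ⟨by omega, h3.2⟩
          · rintro (h3 | h3)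
            · omega
            · exact Or.inr ⟨by omega, h3.2⟩
        · obtain rfl : s = 1 := by omega
          constructor
          · rintro (h3 | h3) <;> omega
          · exact fun h3 => (h1 h3).elim

namespace IsComp

variable {α β : List ℕ}

theorem sum_pos (h : IsComp α) : 0 < α.sum := by
  obtain ⟨h0, h1⟩ := h
  cases α with
  | nil => exact (h0 rfl).elim
  | cons a l =>
    have := h1 a (by simp)
    rw [List.sum_cons]; omega

theorem of_sum_pos (h : ∀ a ∈ α, 0 < a) (hs : 0 < α.sum) : IsComp α :=
  ⟨fun h0 => by simp [h0] at hs, h⟩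

theorem reverse (h : IsComp α) : IsComp α.reverse :=
  ⟨by simpa using h.1, fun a ha => h.2 a (List.mem_reverse.1 ha)⟩

theorem one : IsComp [1] := ⟨by simp, by simp⟩

end IsComp

/-! ### Near concatenation and the composition product in terms of cuts -/

theorem nearConcat_nil_right (α : List ℕ) : nearConcat α [] = α := by
  induction α with
  | nil => rfl
  | cons a α ih =>
    cases α with
    | nil => rfl
    | cons b α => rw [nearConcat, ih]

theorem sum_nearConcat (α β : List ℕ) : (nearConcat α β).sum = α.sum + β.sum := by
  induction α with
  | nil => simp [nearConcat]
  | cons a α ih =>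
    cases α with
    | nil =>
      cases β with
      | nil => rfl
      | cons b β => simp [nearConcat, add_assoc]
    | cons b α =>
      rw [nearConcat, List.sum_cons, ih]
      simp only [List.sum_cons]
      ring

theorem pos_nearConcat {α β : List ℕ} (hα : ∀ a ∈ α, 0 < a) (hβ : ∀ b ∈ β, 0 < b) :
    ∀ a ∈ nearConcat α β, 0 < a := by
  induction α with
  | nil => exact hβ
  | cons a α ih =>
    cases α with
    | nil =>
      cases β with
      | nil => exact hα
      | cons b β =>
        intro c hc
        rcases List.mem_cons.1 hc with rfl | hc
        · have := hα a (by simp)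
          omega
        · exact hβ c (by simp [hc])
    | cons b α =>
      intro c hc
      rw [nearConcat] at hc
      rcases List.mem_cons.1 hc with rfl | hc
      · exact hα _ (by simp)
      · exact ih (fun d hd => hα d (by simp [List.mem_cons.1 hd])) c hc

theorem mem_cuts_nearConcat {α β : List ℕ} (hα : IsComp α) (hβ : IsComp β) {s : ℕ} :
    s ∈ cuts (nearConcat α β) ↔
      (s < α.sum ∧ s ∈ cuts α) ∨ (α.sum < s ∧ s - α.sum ∈ cuts β) := by
  obtain ⟨hα0, hα1⟩ := hα
  obtain ⟨hβ0, hβ1⟩ := hβ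
  induction α generalizing s with
  | nil => exact (hα0 rfl).elim
  | cons a α ih =>
    have ha := hα1 a (by simp)
    cases α with
    | nil =>
      obtain ⟨b, β, rfl⟩ := List.exists_cons_of_ne_nil hβ0
      have hb := hβ1 b (by simp)
      rw [nearConcat, mem_cuts_cons, mem_cuts_cons, mem_cuts_cons, mem_cuts_nil, List.sum_cons,
        List.sum_nil, add_zero, Nat.sub_sub]
      constructor
      · rintro (h | h)
        · exact Or.inl ⟨by omega, Or.inl h⟩
        · exact Or.inr ⟨by omega, Or.inr ⟨by omega, h.2⟩⟩
      · rintro (⟨h1, h2 | h2⟩ | ⟨h1, h2 | h2⟩)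
        · exact Or.inl h2
        · omega
        · omega
        · exact Or.inr ⟨by omega, h2.2⟩
    | cons b α =>
      rw [nearConcat, mem_cuts_cons, ih (by simp) (fun c hc => hα1 c (by simp [List.mem_cons.1 hc])),
        mem_cuts_cons (a := a), List.sum_cons (a := a), Nat.sub_sub]
      constructor
      · rintro (h | ⟨h1, ⟨h2, h3⟩ | ⟨h2, h3⟩⟩)
        · exact Or.inl ⟨by omega, Or.inl h⟩
        · exact Or.inl ⟨by omega, Or.inr ⟨h1, h3⟩⟩
        · exact Or.inr ⟨by omega, h3⟩
      · rintro (⟨h1, h2 | h2⟩ | ⟨h1, h2⟩)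
        · exact Or.inl h2
        · exact Or.inr ⟨h2.1, Or.inl ⟨by omega, h2.2⟩⟩
        · exact Or.inr ⟨by omega, Or.inr ⟨by omega, h2⟩⟩

theorem sum_nearPow (β : List ℕ) (k : ℕ) : (nearPow β k).sum = k * β.sum := by
  induction k with
  | zero => simp [nearPow]
  | succ k ih => rw [nearPow, sum_nearConcat, ih]; ring

theorem pos_nearPow {β : List ℕ} (hβ : ∀ b ∈ β, 0 < b) (k : ℕ) : ∀ a ∈ nearPow β k, 0 < a := by
  induction k with
  | zero => simp [nearPow]
  | succ k ih => exact pos_nearConcat hβ ih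

/-- Near concatenation erases the cuts at the junctions of the copies, so only the two ends survive
among the multiples of `β.sum`. -/
theorem mem_cuts_nearPow {β : List ℕ} (hβ : IsComp β) {k : ℕ} (hk : 0 < k) {s : ℕ} :
    s ∈ cuts (nearPow β k) ↔ s ≤ k * β.sum ∧
      ((β.sum ∣ s ∧ (s = 0 ∨ s = k * β.sum)) ∨ (¬ β.sum ∣ s ∧ s % β.sum ∈ cuts β)) := by
  have hm := hβ.sum_pos
  set m := β.sum with hmdef
  have low : ∀ s, s < m → (s ∈ cuts β ↔ (m ∣ s ∧ s = 0) ∨ (¬ m ∣ s ∧ s % m ∈ cuts β)) := by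
    intro s hs
    rw [Nat.mod_eq_of_lt hs]
    by_cases h : m ∣ s
    · have h0 := Nat.eq_zero_of_dvd_of_lt h hs
      rw [h0]
      simp [zero_mem_cuts]
    · simp [h]
  induction k generalizing s with
  | zero => omega
  | succ k ih =>
    rcases Nat.eq_zero_or_pos k with rfl | hk0
    · rw [nearPow, nearPow, nearConcat_nil_right, zero_add, one_mul]
      rcases lt_trichotomy s m with h | h | h
      · rw [low s h]
        constructor
        · rintro (h1 | h1)
          · exact ⟨by omega, Or.inl ⟨h1.1, Or.inl h1.2⟩⟩
          · exact ⟨by omega, Or.inr h1⟩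
        · rintro ⟨h1, ⟨h2, h3 | h3⟩ | h2⟩
          · exact Or.inl ⟨h2, h3⟩
          · omega
          · exact Or.inr h2
      · exact ⟨fun _ => ⟨h.le, Or.inl ⟨h ▸ dvd_rfl, Or.inr h⟩⟩, fun _ => h ▸ sum_mem_cuts β⟩
      · exact ⟨fun h1 => by have := le_sum_of_mem_cuts h1; omega, fun h1 => by omega⟩
    · have hc : IsComp (nearPow β k) := IsComp.of_sum_pos (pos_nearPow hβ.2 k)
        (by rw [sum_nearPow]; positivity)
      have hkm : 0 < k * m := by positivity
      rw [nearPow, mem_cuts_nearConcat hβ hc, propext (ih hk0), ← hmdef, Nat.add_mul, one_mul]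
      rcases lt_trichotomy s m with h | h | h
      · rw [low s h]
        constructor
        · rintro (⟨-, h1 | h1⟩ | h1)
          · exact ⟨by omega, Or.inl ⟨h1.1, Or.inl h1.2⟩⟩
          · exact ⟨by omega, Or.inr h1⟩
          · omega
        · rintro ⟨h1, ⟨h2, h3 | h3⟩ | h2⟩
          · exact Or.inl ⟨h, Or.inl ⟨h2, h3⟩⟩
          · omega
          · exact Or.inl ⟨h, Or.inr h2⟩
      · subst h
        simp
        omega
      · obtain ⟨t, rfl⟩ := Nat.exists_eq_add_of_lt h
        have e : m + t + 1 - m = t + 1 := by omega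
        have e2 : m + t + 1 = t + 1 + m := by omega
        rw [e, e2, Nat.dvd_add_self_right, Nat.add_mod_right]
        constructor
        · rintro (h1 | ⟨-, h1, h2⟩)
          · omega
          · refine ⟨by omega, h2.imp_left fun h3 => ⟨h3.1, Or.inr ?_⟩⟩
            omega
        · rintro ⟨h1, h2⟩
          exact Or.inr ⟨by omega, by omega, h2.imp_left fun h3 => ⟨h3.1, Or.inr (by omega)⟩⟩

theorem sum_compose (α β : List ℕ) : (compose α β).sum = α.sum * β.sum := by
  induction α with
  | nil => simp [compose]
  | cons a α ih =>
    rw [compose, List.flatMap_cons, List.sum_append, ← compose, ih, sum_nearPow, List.sum_cons]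
    ring

theorem pos_compose {α β : List ℕ} (hβ : ∀ b ∈ β, 0 < b) : ∀ a ∈ compose α β, 0 < a := by
  intro a ha
  obtain ⟨k, -, hk⟩ := List.mem_flatMap.1 ha
  exact pos_nearPow hβ k a hk

theorem IsComp.compose {α β : List ℕ} (hα : IsComp α) (hβ : IsComp β) : IsComp (compose α β) :=
  .of_sum_pos (pos_compose hβ.2) (by
    rw [sum_compose]
    exact Nat.mul_pos hα.sum_pos hβ.sum_pos)

/-- Junctions of copies of `β` are cuts exactly where `α` cuts; everything else repeats `β`. This
makes factorisations with right factor of size `m` the same as `m`-periodicity off the multiples of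
`m`. -/
theorem mem_cuts_compose {α β : List ℕ} (hα : ∀ a ∈ α, 0 < a) (hβ : IsComp β) {s : ℕ} :
    s ∈ cuts (compose α β) ↔ s ≤ α.sum * β.sum ∧
      ((β.sum ∣ s ∧ s / β.sum ∈ cuts α) ∨ (¬ β.sum ∣ s ∧ s % β.sum ∈ cuts β)) := by
  have hm := hβ.sum_pos
  induction α generalizing s with
  | nil =>
    simp only [compose, List.flatMap_nil, mem_cuts_nil, List.sum_nil, zero_mul, Nat.le_zero]
    exact ⟨fun h => ⟨h, by simp [h]⟩, fun h => h.1⟩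
  | cons a α ih =>
    have ha := hα a (by simp)
    rw [compose, List.flatMap_cons, mem_cuts_append, ← compose,
      propext (ih (fun c hc => hα c (List.mem_cons_of_mem a hc))), mem_cuts_nearPow hβ ha,
      sum_nearPow, List.sum_cons,
      mem_cuts_cons, Nat.add_mul]
    set m := β.sum
    rcases le_or_gt (a * m) s with h | h
    · obtain ⟨t, rfl⟩ := Nat.exists_eq_add_of_le h
      have e1 : m ∣ a * m + t ↔ m ∣ t := Nat.dvd_add_right (dvd_mul_left m a)
      have e2 : (a * m + t) / m = a + t / m := by rw [add_comm, Nat.add_mul_div_right _ _ hm, add_comm]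
      have e3 : (a * m + t) % m = t % m := by rw [add_comm, Nat.add_mul_mod_self_right]
      have hq : t = 0 → t / m = 0 := by rintro rfl; simp
      rw [e1, e2, e3, Nat.add_sub_cancel_left, Nat.add_sub_cancel_left]
      generalize t / m = q at *
      have ham : 0 < a * m := by positivity
      constructor
      · rintro (⟨h1, h2⟩ | ⟨-, h1, h2⟩)
        · have ht : t = 0 := by omega
          rw [hq ht, ht]
          exact ⟨by omega, Or.inl ⟨dvd_zero m, Or.inr ⟨by omega, zero_mem_cuts α⟩⟩⟩
        · exact ⟨by omega, h2.imp_left fun h3 => ⟨h3.1, Or.inr ⟨by omega, h3.2⟩⟩⟩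
      · rintro ⟨h1, h2⟩
        refine Or.inr ⟨h, by omega, h2.imp_left fun h3 => ⟨h3.1, ?_⟩⟩
        rcases h3.2 with h4 | h4
        · omega
        · exact h4.2
    · have hlt : s / m < a := Nat.div_lt_of_lt_mul (by rwa [mul_comm])
      constructor
      · rintro (⟨h1, h2⟩ | h1)
        · refine ⟨by omega, h2.imp_left fun h3 => ⟨h3.1, Or.inl ?_⟩⟩
          have : s = 0 := by omega
          simp [this]
        · omega
      · rintro ⟨h1, h2⟩
        refine Or.inl ⟨h.le, h2.imp_left fun h3 => ⟨h3.1, Or.inl ?_⟩⟩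
        have h4 : s / m = 0 := by omega
        exact Nat.eq_zero_of_dvd_of_lt h3.1 (by
          by_contra h5
          have := Nat.div_pos (by omega : m ≤ s) hm
          omega)

theorem compose_one (α : List ℕ) (hα : ∀ a ∈ α, 0 < a) : compose α [1] = α := by
  refine eq_of_cuts (pos_compose (by simp)) hα (by simp [sum_compose]) fun s h0 hs => ?_
  rw [sum_compose, List.sum_singleton, mul_one] at hs
  rw [mem_cuts_compose hα IsComp.one]
  simp [hs.le]

theorem one_compose {α : List ℕ} : compose [1] α = α := by
  simp [compose, nearPow, nearConcat_nil_right]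

theorem compose_assoc {α β γ : List ℕ} (hα : ∀ a ∈ α, 0 < a) (hβ : IsComp β) (hγ : IsComp γ) :
    compose (compose α β) γ = compose α (compose β γ) := by
  refine eq_of_cuts (pos_compose hγ.2) (pos_compose (hβ.compose hγ).2)
    (by simp only [sum_compose, mul_assoc]) fun s h0 hs => ?_
  rw [sum_compose, sum_compose] at hs
  rw [mem_cuts_compose (pos_compose hβ.2) hγ, mem_cuts_compose hα (hβ.compose hγ),
    mem_cuts_compose hα hβ, mem_cuts_compose hβ.2 hγ, sum_compose, sum_compose]
  have hm := hβ.sum_pos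
  have hk := hγ.sum_pos
  generalize β.sum = m at *
  generalize γ.sum = k at *
  have e1 : s ≤ α.sum * m * k := hs.le
  have e2 : s ≤ α.sum * (m * k) := by rw [← mul_assoc]; exact e1
  have e3 : s % (m * k) ≤ m * k := (Nat.mod_lt _ (by positivity)).le
  have e4 : k ∣ s % (m * k) ↔ k ∣ s := by
    rw [Nat.dvd_mod_iff (dvd_mul_left k m)]
  have e5 : s % (m * k) % k = s % k := Nat.mod_mod_of_dvd s (dvd_mul_left k m)
  simp only [e1, e2, e3, e4, e5, true_and]
  by_cases hks : k ∣ s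
  · obtain ⟨t, rfl⟩ := hks
    have f1 : k * t / k = t := Nat.mul_div_cancel_left t hk
    have f2 : m * k ∣ k * t ↔ m ∣ t := by rw [mul_comm m k]; exact Nat.mul_dvd_mul_iff_left hk
    have f3 : k * t / (m * k) = t / m := by rw [mul_comm m k, Nat.mul_div_mul_left _ _ hk]
    have f4 : k * t % (m * k) / k = t % m := by
      rw [mul_comm m k, Nat.mul_mod_mul_left, Nat.mul_div_cancel_left _ hk]
    have f5 : t ≤ α.sum * m := by
      have : k * t ≤ k * (α.sum * m) := by rw [mul_comm k (α.sum * m)]; exact e1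
      exact Nat.le_of_mul_le_mul_left this hk
    simp [f1, f2, f3, f4, f5]
  · have : ¬ m * k ∣ s := fun h => hks ((dvd_mul_left k m).trans h)
    simp [hks, this]

theorem reverse_compose {α β : List ℕ} (hα : ∀ a ∈ α, 0 < a) (hβ : IsComp β) :
    (compose α β).reverse = compose α.reverse β.reverse := by
  refine eq_of_cuts (fun a ha => pos_compose hβ.2 a (List.mem_reverse.1 ha))
    (pos_compose hβ.reverse.2) (by simp [sum_compose]) fun s h0 hs => ?_
  rw [List.sum_reverse, sum_compose] at hs
  rw [mem_cuts_reverse (by rw [sum_compose]; exact hs.le), mem_cuts_compose hα hβ,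
    mem_cuts_compose (fun a ha => hα a (List.mem_reverse.1 ha)) hβ.reverse, sum_compose,
    List.sum_reverse, List.sum_reverse]
  have hm := hβ.sum_pos
  set m := β.sum with hmdef
  have e1 : m ∣ α.sum * m - s ↔ m ∣ s := Nat.dvd_sub_iff_right hs.le (dvd_mul_left m _)
  rw [e1]
  simp only [Nat.sub_le, hs.le, true_and]
  by_cases hms : m ∣ s
  · obtain ⟨t, rfl⟩ := hms
    have ht : t < α.sum := by
      rw [mul_comm] at hs; exact Nat.lt_of_mul_lt_mul_right hs
    have f1 : m * t / m = t := Nat.mul_div_cancel_left t hm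
    have f2 : (α.sum * m - m * t) / m = α.sum - t := by
      rw [mul_comm m t, ← Nat.sub_mul, Nat.mul_div_cancel _ hm]
    simp only [dvd_mul_right, true_and, not_true, false_and, or_false, f1, f2]
    rw [mem_cuts_reverse ht.le]
  · have f1 : (α.sum * m - s) % m = m - s % m := by
      have h1 := Nat.div_add_mod s m
      have h2 : s % m < m := Nat.mod_lt _ hm
      have h3 : s / m < α.sum := Nat.div_lt_of_lt_mul (by rwa [mul_comm])
      obtain ⟨c, hc⟩ := Nat.exists_eq_add_of_lt h3
      have h4 : α.sum * m - s = (m - s % m) + m * c := by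
        rw [hc]
        have : (s / m + c + 1) * m = m * (s / m) + m * c + m := by ring
        omega
      have h5 : s % m ≠ 0 := fun h => hms (Nat.dvd_of_mod_eq_zero h)
      rw [h4, Nat.add_mul_mod_self_left, Nat.mod_eq_of_lt (by omega)]
    simp only [hms, false_and, false_or, not_false_eq_true, true_and, f1]
    rw [mem_cuts_reverse (Nat.mod_lt _ hm).le]

/-- The two factors of a composition product are determined by the size of the right factor. -/
theorem compose_inj {δ δ' D D' : List ℕ} (hδ : IsComp δ) (hδ' : IsComp δ') (hD : IsComp D)
    (hD' : IsComp D') (hsum : D.sum = D'.sum) (h : compose δ D = compose δ' D') :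
    δ = δ' ∧ D = D' := by
  have hs := congrArg List.sum h
  rw [sum_compose, sum_compose, hsum] at hs
  have hs := Nat.eq_of_mul_eq_mul_right hD'.sum_pos hs
  have hm := hD.sum_pos
  have key : ∀ s, s ∈ cuts (compose δ D) ↔ s ∈ cuts (compose δ' D') := fun s => by rw [h]
  simp only [mem_cuts_compose hδ.2 hD, mem_cuts_compose hδ'.2 hD', ← hs, ← hsum] at key
  have hδ0 := hδ.sum_pos
  set m := D.sum
  refine ⟨eq_of_cuts hδ.2 hδ'.2 hs fun s h0 hs => ?_, eq_of_cuts hD.2 hD'.2 hsum fun s h0 hs => ?_⟩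
  · have := key (m * s)
    rw [Nat.mul_div_cancel_left _ hm] at this
    simpa [mul_comm m, hs.le, Nat.mul_le_mul_right] using this
  · have := key s
    have h1 : ¬ m ∣ s := fun h' => by have := Nat.le_of_dvd h0 h'; omega
    have h2 : s ≤ δ.sum * m := hs.le.trans (Nat.le_mul_of_pos_left m hδ0)
    rw [Nat.mod_eq_of_lt hs] at this
    simpa [h1, h2] using this

/-- The multiples of `m` among the cuts give the left factor, and the cuts below `m` give the right
one. -/
theorem exists_compose {α : List ℕ} (hα : IsComp α) {m : ℕ} (hm : m ∣ α.sum)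
    (hper : PerOff (cuts α) α.sum m m) : ∃ δ D, IsComp δ ∧ IsComp D ∧ D.sum = m ∧
      α = compose δ D := by
  obtain ⟨k, hk⟩ := hm
  have hn := hα.sum_pos
  have hm0 : 0 < m := Nat.pos_of_ne_zero fun h => by simp [h] at hk; omega
  have hk0 : 0 < k := Nat.pos_of_ne_zero fun h => by simp [h] at hk; omega
  obtain ⟨δ, h1, h2, h3⟩ := exists_cuts k {s | m * s ∈ cuts α}
  obtain ⟨D, h4, h5, h6⟩ := exists_cuts m (cuts α)
  have hD : IsComp D := .of_sum_pos h4 (by omega)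
  refine ⟨δ, D, .of_sum_pos h1 (by omega), hD, h5, eq_of_cuts hα.2 (pos_compose h4)
    (by rw [sum_compose, h2, h5, hk, mul_comm]) fun s h0 hs => ?_⟩
  rw [mem_cuts_compose h1 hD, h2, h5, mul_comm k m, ← hk]
  simp only [hs.le, true_and]
  by_cases hms : m ∣ s
  · obtain ⟨t, rfl⟩ := hms
    have ht : t < k := by rw [hk] at hs; exact Nat.lt_of_mul_lt_mul_left hs
    have ht0 : 0 < t := Nat.pos_of_mul_pos_left h0
    simp [Nat.mul_div_cancel_left _ hm0, h3 t ht0 ht]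
  · have h7 : s % m < m := Nat.mod_lt _ hm0
    have h8 : 0 < s % m := Nat.pos_of_ne_zero fun h => hms (Nat.dvd_of_mod_eq_zero h)
    simp only [hms, false_and, false_or, not_false_eq_true, true_and]
    rw [h6 _ h8 h7]
    refine (hper.congr dvd_rfl h0 hs hms h8 ?_ ?_).symm
    · rw [hk]
      exact lt_of_lt_of_le h7 (Nat.le_mul_of_pos_right m hk0)
    rw [Int.natCast_mod, ← neg_sub]
    exact (Int.dvd_self_sub_emod).neg_right

theorem perOff_compose {δ D : List ℕ} (hδ : IsComp δ) (hD : IsComp D) :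
    PerOff (cuts (compose δ D)) (δ.sum * D.sum) D.sum D.sum := by
  intro y h0 hy hyn
  rw [mem_cuts_compose hδ.2 hD, mem_cuts_compose hδ.2 hD, Nat.dvd_add_self_right,
    Nat.add_mod_right]
  simp [hy, hyn.le, (Nat.le_add_right y D.sum).trans hyn.le]

end RibbonCount

namespace RibbonCount

open PowerSeries

/-! ### Similar compositions -/

section Total

variable {A : Type*} [CommRing A]

theorem pathSeries_congr {S T : Set ℕ} {n : ℕ} (h : ∀ s, 0 < s → s < n → (s ∈ S ↔ s ∈ T))
    (x : ℕ → A) {k : ℕ} (hk : k < n) : coeff k (pathSeries S x) = coeff k (pathSeries T x) :=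
  coeff_eq_coeff_pathSeries (by simp)
    (fun s h0 hs => by rw [coeff_pathSeries S x h0.ne', chi_congr (h s h0 hs)]) k hk

theorem total_congr {S T : Set ℕ} {n : ℕ} (h : ∀ s, 0 < s → s < n → (s ∈ S ↔ s ∈ T))
    (x : ℕ → A) : total n S x = total n T x :=
  coeff_mul_congr (coeff_zero_stepSeries x) fun _ hk => pathSeries_congr h x hk

theorem total_eq_sum (S : Set ℕ) (x : ℕ → A) {s : ℕ} (hs : 0 < s) :
    total s S x = x s + ∑ t ∈ Finset.Ico 1 s, (chi S t : A) * total t S x * x (s - t) := by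
  rw [total, coeff_mul, Finset.Nat.sum_antidiagonal_eq_sum_range_succ_mk, Finset.sum_range_succ,
    Finset.range_eq_Ico, Finset.sum_eq_sum_Ico_succ_bot hs]
  simp only [Nat.sub_self, coeff_zero_stepSeries, mul_zero, add_zero, coeff_zero_pathSeries,
    Nat.sub_zero, one_mul]
  rw [coeff_stepSeries hs.ne']
  congr 1
  refine Finset.sum_congr rfl fun t ht => ?_
  rw [Finset.mem_Ico] at ht
  rw [coeff_pathSeries S x (by omega), coeff_stepSeries (by omega)]
  rfl

theorem total_congr_weight {S : Set ℕ} {x y : ℕ → A} {n : ℕ} (h : ∀ i, 0 < i → i ≤ n → x i = y i)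
    (hn : 0 < n) : total n S x = total n S y := by
  induction n using Nat.strong_induction_on with
  | _ n ih =>
    rw [total_eq_sum S x hn, total_eq_sum S y hn, h n hn le_rfl]
    congr 1
    refine Finset.sum_congr rfl fun t ht => ?_
    rw [Finset.mem_Ico] at ht
    rw [ih t ht.2 (fun i h0 hi => h i h0 (by omega)) ht.1, h _ (by omega) (by omega)]

/-- The total of a set of cuts which is periodic off the multiples of `m`. -/
theorem total_mul {m k : ℕ} (hm : 0 < m) {S V δ : Set ℕ} (x : ℕ → A)
    (hV : ∀ s, m ∣ s → s ∉ V)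
    (hSV : ∀ s < m * k, ¬ m ∣ s → ∀ r < s, m ∣ r → (s ∈ S ↔ s - r ∈ V))
    (hδ : ∀ r, 0 < r → r < k → (m * r ∈ S ↔ r ∈ δ)) :
    total (m * k) S x = total k δ fun i => total (m * i) V x := by
  set y : ℕ → A := fun i => total (m * i) V x with hy
  set Θ : A⟦X⟧ := mk fun k => if m ∣ k then coeff k (pathSeries S x) else 0 with hΘ
  set p : A⟦X⟧ := mk fun r => coeff (m * r) (pathSeries S x) with hp
  have hΘ0 : ∀ r, coeff (m * r) Θ = coeff r p := fun r => by
    rw [hΘ, hp, coeff_mk, coeff_mk, if_pos (dvd_mul_right m r)]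
  have hΘ1 : ∀ k, ¬ m ∣ k → coeff k Θ = 0 := fun k hk => by rw [hΘ, coeff_mk, if_neg hk]
  -- By `pathSeries_factor`, the part of a chain between successive multiples of `m` that it meets
  -- is a chain through `V`; it acts as one step with weight `y`.
  have key : ∀ r ≤ k, coeff (m * r) (pathSeries S x * stepSeries x) =
      coeff r (p * stepSeries y) := by
    intro r hr
    have hle : m * r ≤ m * k := Nat.mul_le_mul_left m hr
    rw [coeff_mul_congr (q := Θ * pathSeries V x) (coeff_zero_stepSeries x) fun j hj =>
      pathSeries_factor x hV hSV (by omega), mul_assoc, coeff_mul, coeff_mul]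
    symm
    refine Finset.sum_of_injOn (fun ab => (m * ab.1, m * ab.2)) ?_ ?_ ?_ ?_
    · rintro ⟨a, b⟩ _ ⟨c, d⟩ _ h
      simp only [Prod.mk.injEq] at h
      exact Prod.ext (Nat.eq_of_mul_eq_mul_left hm h.1) (Nat.eq_of_mul_eq_mul_left hm h.2)
    · rintro ⟨a, b⟩ h
      simp only [Finset.mem_coe, Finset.HasAntidiagonal.mem_antidiagonal] at h ⊢
      rw [← mul_add, h]
    · rintro ⟨i, j⟩ hij hne
      rw [Finset.HasAntidiagonal.mem_antidiagonal] at hij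
      dsimp only at hij ⊢
      by_cases hi : m ∣ i
      · have hj : m ∣ j := (Nat.dvd_add_right hi).1 (hij ▸ dvd_mul_right m r)
        obtain ⟨a, rfl⟩ := hi
        obtain ⟨b, rfl⟩ := hj
        refine (hne ⟨(a, b), ?_, rfl⟩).elim
        rw [← mul_add] at hij
        simpa using Nat.eq_of_mul_eq_mul_left hm hij
      · rw [hΘ1 i hi, zero_mul]
    · rintro ⟨a, b⟩ _
      dsimp only
      rw [hΘ0]
      congr 1
      by_cases hb : b = 0
      · simp [hb]
      · rw [coeff_stepSeries hb]; rfl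
  have h2 : ∀ r < k, coeff r p = coeff r (pathSeries δ y) := by
    refine coeff_eq_coeff_pathSeries (by simp [hp]) fun r h0 hr => ?_
    rw [← key r hr.le, hp, coeff_mk, coeff_pathSeries S x (Nat.mul_pos hm h0).ne',
      chi_congr (hδ r h0 hr)]
  rw [total, key k le_rfl, total]
  exact coeff_mul_congr (coeff_zero_stepSeries y) h2

end Total

/-- Two compositions are similar if they have the same size and their sets of cuts are similar. -/
def SimComp (α β : List ℕ) : Prop := α.sum = β.sum ∧ Sim α.sum (cuts α) (cuts β)

namespace SimComp

variable {α β γ δ δ' D : List ℕ}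

protected theorem trans (h : SimComp α β) (h' : SimComp β γ) : SimComp α γ :=
  ⟨h.1.trans h'.1, h.2.trans (h.1 ▸ h'.2)⟩

theorem of_eq (h : α = β) : SimComp α β := h ▸ ⟨rfl, rfl⟩

theorem reverse_right (h : SimComp α β) : SimComp α β.reverse := by
  refine ⟨by rw [h.1, List.sum_reverse], h.2.refl_right.trans (total_congr (fun s _ hs => ?_) _)⟩
  rw [h.1] at hs ⊢
  exact (mem_cuts_reverse hs.le).symm

end SimComp

theorem mul_sub_mod {s i m : ℕ} (h : s < m * i) (hm : ¬ m ∣ s) : (m * i - s) % m = m - s % m := by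
  have hm0 : 0 < m := Nat.pos_of_ne_zero fun h' => by simp [h'] at h
  have h1 := Nat.div_add_mod s m
  have h2 : s % m < m := Nat.mod_lt _ hm0
  obtain ⟨c, hc⟩ := Nat.exists_eq_add_of_lt (Nat.div_lt_of_lt_mul h)
  have h4 : m * i - s = (m - s % m) + m * c := by
    rw [hc]
    have : m * (s / m + c + 1) = m * (s / m) + m * c + m := by ring
    omega
  have h5 : s % m ≠ 0 := fun h => hm (Nat.dvd_of_mod_eq_zero h)
  rw [h4, Nat.add_mul_mod_self_left, Nat.mod_eq_of_lt (by omega)]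

/-- The cuts of the periodic continuation of a composition which are no multiples of its size. -/
def offCuts (D : List ℕ) : Set ℕ := {s | ¬ D.sum ∣ s ∧ s % D.sum ∈ cuts D}

section

variable {A : Type*} [CommRing A] {α β γ δ δ' D : List ℕ}

theorem total_compose (hδ : IsComp δ) (hD : IsComp D) (x : ℕ → A) :
    total (compose δ D).sum (cuts (compose δ D)) x =
      total δ.sum (cuts δ) fun i => total (D.sum * i) (offCuts D) x := by
  have hm := hD.sum_pos
  rw [sum_compose, mul_comm]
  refine total_mul hm x (fun s hs h => h.1 hs) (fun s hs hms r hr hmr => ?_) fun r h0 hr => ?_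
  · rw [mem_cuts_compose hδ.2 hD, mul_comm δ.sum]
    obtain ⟨c, rfl⟩ := hmr
    have h1 : (s - D.sum * c) % D.sum = s % D.sum := Nat.sub_mul_mod hr.le
    have h2 : ¬ D.sum ∣ s - D.sum * c := fun h => hms (by
      have := dvd_add h (dvd_mul_right D.sum c)
      rwa [Nat.sub_add_cancel hr.le] at this)
    simp only [hs.le, hms, true_and, false_and, false_or, not_false_eq_true]
    rw [← h1]
    exact ⟨fun h => ⟨h2, h⟩, fun h => h.2⟩
  · rw [mem_cuts_compose hδ.2 hD, mul_comm δ.sum, Nat.mul_div_cancel_left _ hm]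
    simp [Nat.mul_le_mul_left, hr.le]

/-- By `total_compose`, the total of a product is the total of the left factor at weights depending
on the right factor only. -/
theorem SimComp.compose_left (h : SimComp δ δ') (hδ : IsComp δ) (hδ' : IsComp δ')
    (hD : IsComp D) : SimComp (compose δ D) (compose δ' D) := by
  refine ⟨by rw [sum_compose, sum_compose, h.1], ?_⟩
  rw [Sim, total_compose hδ hD, h.2.total_eq, h.1, ← total_compose hδ' hD, sum_compose,
    sum_compose, h.1]

/-- The weights that `D` contributes are themselves totals, hence invariant under reflection. -/
theorem simComp_compose_reverse (hδ : IsComp δ) (hD : IsComp D) :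
    SimComp (compose δ D) (compose δ D.reverse) := by
  refine ⟨by rw [sum_compose, sum_compose, List.sum_reverse], ?_⟩
  have e : (compose δ D).sum = (compose δ D.reverse).sum := by
    rw [sum_compose, sum_compose, List.sum_reverse]
  have key : ∀ i, total (D.sum * i) (offCuts D) (MvPolynomial.X : ℕ → MvPolynomial ℕ ℤ) =
      total (D.reverse.sum * i) (offCuts D.reverse) MvPolynomial.X := by
    intro i
    rw [← total_refl, List.sum_reverse]
    refine total_congr (fun s _ hs => ?_) _
    have h1 : D.sum ∣ D.sum * i - s ↔ D.sum ∣ s := Nat.dvd_sub_iff_right hs.le (dvd_mul_right _ i)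
    show (¬ D.sum ∣ D.sum * i - s ∧ (D.sum * i - s) % D.sum ∈ cuts D) ↔
      (¬ D.reverse.sum ∣ s ∧ s % D.reverse.sum ∈ cuts D.reverse)
    rw [h1, List.sum_reverse]
    refine and_congr_right fun hms => ?_
    rw [mul_sub_mod hs hms, mem_cuts_reverse (Nat.mod_lt _ hD.sum_pos).le]
  rw [Sim, total_compose hδ hD, e, total_compose hδ hD.reverse]
  simp only [key]

theorem pathSeries_empty (x : ℕ → A) : pathSeries ∅ x = 1 := by
  ext s
  by_cases h : s = 0
  · simp [h]
  · rw [coeff_pathSeries _ _ h, chi_of_notMem (Set.notMem_empty s), Int.cast_zero, zero_mul,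
      coeff_one, if_neg h]

/-- Keeping only the cuts at multiples of `D.sum`, and giving a step of length `D.sum * i` the
weight of index `i`, recovers the left factor. This is how a common right factor is cancelled. -/
theorem total_mults_compose (hδ : IsComp δ) (hD : IsComp D) :
    total δ.sum (cuts δ) (MvPolynomial.X : ℕ → MvPolynomial ℕ ℤ) =
      total (compose δ D).sum (mults D.sum (cuts (compose δ D)))
        fun j => MvPolynomial.X (j / D.sum) := by
  have hm := hD.sum_pos
  rw [sum_compose, mul_comm, total_mul (V := ∅) (δ := cuts δ) hm]
  · refine total_congr_weight (fun i hi _ => ?_) hδ.sum_pos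
    rw [total, pathSeries_empty, one_mul, coeff_stepSeries (Nat.mul_pos hm hi).ne',
      Nat.mul_div_cancel_left _ hm]
  · exact fun s _ => Set.notMem_empty s
  · intro s hs hms r hr hmr
    exact ⟨fun h => (hms h.2).elim, fun h => h.elim⟩
  · intro r h0 hr
    show (D.sum * r ∈ cuts (compose δ D) ∧ D.sum ∣ D.sum * r) ↔ _
    rw [mem_cuts_compose hδ.2 hD, mul_comm δ.sum, Nat.mul_div_cancel_left _ hm]
    simp [Nat.mul_le_mul_left, hr.le]

theorem SimComp.of_compose (h : SimComp (compose δ D) (compose δ' D)) (hδ : IsComp δ)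
    (hδ' : IsComp δ') (hD : IsComp D) : SimComp δ δ' := by
  have hs := h.1
  rw [sum_compose, sum_compose] at hs
  have hs' := Nat.eq_of_mul_eq_mul_right hD.sum_pos hs
  refine ⟨hs', ?_⟩
  have h2 := h.2.mults (m := D.sum) (by rw [sum_compose]; exact dvd_mul_left _ _)
  rw [Sim, total_mults_compose hδ hD, h2.total_eq, hs', total_mults_compose hδ' hD, h.1]

end

end RibbonCount

namespace RibbonCount

/-! ### Words of compositions -/

/-- The composition product of the letters of a word. -/
def word (L : List (List ℕ)) : List ℕ := L.foldr compose [1]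

/-- The numbers strictly between `0` and the size of `l` are all cuts of `l`, or all not, as
`b` says. -/
def Const (b : Prop) (l : List ℕ) : Prop := ∀ s, 0 < s → s < l.sum → (s ∈ cuts l ↔ b)

theorem IsComp.eq_one {l : List ℕ} (h : IsComp l) (hs : l.sum = 1) : l = [1] :=
  eq_of_cuts h.2 IsComp.one.2 (by simpa using hs) fun s h0 h1 => by omega

theorem IsComp.one_lt_sum {l : List ℕ} (h : IsComp l) (hl : l ≠ [1]) : 1 < l.sum := by
  have := h.sum_pos
  by_contra h'
  exact hl (h.eq_one (by omega))

namespace Const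

variable {b c : Prop} {l l' β γ : List ℕ}

theorem ext (h : Const b l) (h' : Const b l') (hl : IsComp l) (hl' : IsComp l')
    (hs : l.sum = l'.sum) : l = l' :=
  eq_of_cuts hl.2 hl'.2 hs fun s h0 h1 => (h s h0 h1).trans (h' s h0 (hs ▸ h1)).symm

theorem reverse_eq (h : Const b l) (hl : IsComp l) : l.reverse = l := by
  refine ext (b := b) (fun s h0 h1 => ?_) h hl.reverse hl l.sum_reverse
  rw [List.sum_reverse] at h1
  rw [mem_cuts_reverse h1.le]
  exact h _ (by omega) (by omega)

theorem compose_iff (hβ : IsComp β) (hγ : IsComp γ) :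
    Const b (compose β γ) ↔ Const b β ∧ Const b γ := by
  have hm := hγ.sum_pos
  have hk := hβ.sum_pos
  simp only [Const, sum_compose, mem_cuts_compose hβ.2 hγ]
  refine ⟨fun h => ⟨fun s h0 h1 => ?_, fun s h0 h1 => ?_⟩, fun h s h0 h1 => ?_⟩
  · rw [← h (s * γ.sum) (Nat.mul_pos h0 hm) (Nat.mul_lt_mul_of_pos_right h1 hm)]
    simp [Nat.mul_div_cancel _ hm, Nat.mul_le_mul_right, h1.le]
  · have h2 : ¬ γ.sum ∣ s := fun h' => by have := Nat.le_of_dvd h0 h'; omega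
    have h3 : s < β.sum * γ.sum := h1.trans_le (Nat.le_mul_of_pos_left _ hk)
    rw [← h s h0 h3]
    simp [h2, h3.le, Nat.mod_eq_of_lt h1]
  · by_cases hs : γ.sum ∣ s
    · obtain ⟨t, rfl⟩ := hs
      rw [← h.1 t (Nat.pos_of_mul_pos_left h0)
        (Nat.lt_of_mul_lt_mul_left (mul_comm β.sum _ ▸ h1)), Nat.mul_div_cancel_left _ hm]
      simp [h1.le]
    · rw [← h.2 (s % γ.sum) (Nat.pos_of_ne_zero fun h => hs (Nat.dvd_of_mod_eq_zero h))
        (Nat.mod_lt _ hm)]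
      simp [hs, h1.le]

theorem congr (h : Const b l) (h' : b ↔ c) : Const c l := fun s h0 h1 => (h s h0 h1).trans h'

theorem iff (h : Const b l) (h' : Const c l) (hl : 1 < l.sum) : b ↔ c :=
  (h 1 one_pos hl).symm.trans (h' 1 one_pos hl)

end Const

theorem length_eq_one_iff {l : List ℕ} (hl : IsComp l) : l.length = 1 ↔ Const False l := by
  rcases l with _ | ⟨a, _ | ⟨b, t⟩⟩
  · exact (hl.1 rfl).elim
  · refine iff_of_true rfl fun s h0 h1 => iff_of_false ?_ id
    rw [mem_cuts_cons]
    rintro (h | ⟨h2, h3⟩)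
    · omega
    · simp at h1
      omega
  · refine iff_of_false (by simp) fun h => ?_
    have ha := hl.2 a (by simp)
    have hb := hl.2 b (by simp)
    refine (h a ha (by simp only [List.sum_cons]; omega)).1 ?_
    rw [mem_cuts_cons]
    exact Or.inr ⟨le_rfl, by simpa using zero_mem_cuts _⟩

theorem forall_eq_one_iff {l : List ℕ} (hl : ∀ a ∈ l, 0 < a) :
    (∀ a ∈ l, a = 1) ↔ Const True l := by
  induction l with
  | nil => exact iff_of_true (by simp) fun s h0 h1 => by simp at h1
  | cons a t ih =>
    have ih := ih fun a h => hl a (List.mem_cons_of_mem _ h)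
    have ha := hl a (by simp)
    rw [List.forall_mem_cons, ih]
    refine ⟨fun h s h0 h1 => iff_of_true ?_ trivial, fun h => ?_⟩
    · rw [mem_cuts_cons]
      rw [List.sum_cons] at h1
      refine Or.inr ⟨by omega, ?_⟩
      by_cases hs : s - a = 0
      · rw [hs]; exact zero_mem_cuts t
      · exact (h.2 _ (by omega) (by omega)).2 trivial
    · have h1 : a = 1 := by
        by_contra h1
        have := (h 1 one_pos (by rw [List.sum_cons]; omega)).2 trivial
        rw [mem_cuts_cons] at this
        omega
      refine ⟨h1, fun s h0 hs => iff_of_true ?_ trivial⟩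
      have := (h (a + s) (by omega) (by rw [List.sum_cons]; omega)).2 trivial
      rw [mem_cuts_cons] at this
      rcases this with h | ⟨_, h⟩
      · omega
      · rwa [Nat.add_sub_cancel_left] at h

/-- The compositions of length one and those with all parts one are treated together: all, or none,
of the inner positions are cuts. -/
theorem isTrivialFactorisation_iff {β γ : List ℕ} (hβ : IsComp β) (hγ : IsComp γ) :
    IsTrivialFactorisation β γ ↔ β = [1] ∨ γ = [1] ∨ ∃ b, Const b β ∧ Const b γ := by
  rw [IsTrivialFactorisation, length_eq_one_iff hβ, length_eq_one_iff hγ,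
    forall_eq_one_iff hβ.2, forall_eq_one_iff hγ.2, or_assoc]
  refine or_congr_right (or_congr_right ⟨?_, ?_⟩)
  · rintro (h | h)
    exacts [⟨_, h⟩, ⟨_, h⟩]
  · rintro ⟨b, h⟩
    by_cases hb : b
    · rw [eq_true hb] at h; exact Or.inr h
    · rw [eq_false hb] at h; exact Or.inl h

theorem Const.hasOnlyTrivialFactorisations {b : Prop} {l : List ℕ} (h : Const b l) :
    HasOnlyTrivialFactorisations l := by
  rintro β γ hβ hγ rfl
  exact (isTrivialFactorisation_iff hβ hγ).2 (Or.inr (Or.inr ⟨b, (compose_iff hβ hγ).1 h⟩))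

theorem Const.reverse {b : Prop} {l : List ℕ} (h : Const b l) (hl : IsComp l) :
    Const b l.reverse := (h.reverse_eq hl).symm ▸ h

theorem IsTrivialFactorisation.reverse {β γ : List ℕ} (h : IsTrivialFactorisation β γ) :
    IsTrivialFactorisation β.reverse γ.reverse := by
  simpa [IsTrivialFactorisation] using h

theorem HasOnlyTrivialFactorisations.reverse {l : List ℕ} (h : HasOnlyTrivialFactorisations l) :
    HasOnlyTrivialFactorisations l.reverse := by
  intro β γ hβ hγ h'
  have := (h β.reverse γ.reverse hβ.reverse hγ.reverse
    (by rw [← reverse_compose hβ.2 hγ, h', List.reverse_reverse])).reverse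
  rwa [List.reverse_reverse, List.reverse_reverse] at this

/-- A letter: an irreducible composition other than `(1)`. -/
structure IsLetter (δ : List ℕ) : Prop where
  isComp : IsComp δ
  ne_one : δ ≠ [1]
  irred : HasOnlyTrivialFactorisations δ

theorem IsLetter.one_lt_sum {δ : List ℕ} (h : IsLetter δ) : 1 < δ.sum :=
  h.isComp.one_lt_sum h.ne_one

theorem IsLetter.reverse {δ : List ℕ} (h : IsLetter δ) : IsLetter δ.reverse :=
  ⟨h.isComp.reverse, fun h' => h.ne_one (by simpa using congrArg List.reverse h'),
    h.irred.reverse⟩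

/-- A word of letters is reduced if no product of two consecutive letters is trivial. -/
def Reduced (L : List (List ℕ)) : Prop :=
  (∀ δ ∈ L, IsLetter δ) ∧ L.IsChain fun β γ => ¬ ∃ b, Const b β ∧ Const b γ

theorem isComp_word {L : List (List ℕ)} (h : ∀ δ ∈ L, IsComp δ) : IsComp (word L) := by
  induction L with
  | nil => exact IsComp.one
  | cons a L ih =>
    exact (h a (by simp)).compose (ih fun δ hδ => h δ (List.mem_cons_of_mem _ hδ))

theorem Reduced.isComp {L : List (List ℕ)} (h : Reduced L) : IsComp (word L) :=
  isComp_word fun δ hδ => (h.1 δ hδ).isComp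

theorem word_cons (a : List ℕ) (L : List (List ℕ)) : word (a :: L) = compose a (word L) := rfl

theorem word_append {L L' : List (List ℕ)} (h : ∀ δ ∈ L, IsComp δ) (h' : ∀ δ ∈ L', IsComp δ) :
    word (L ++ L') = compose (word L) (word L') := by
  induction L with
  | nil => exact one_compose.symm
  | cons a L ih =>
    rw [List.forall_mem_cons] at h
    rw [List.cons_append, word_cons, ih h.2, word_cons,
      compose_assoc h.1.2 (isComp_word h.2) (isComp_word h')]

theorem word_snoc {L : List (List ℕ)} {D : List ℕ} (h : ∀ δ ∈ L, IsComp δ) (hD : IsComp D) :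
    word (L ++ [D]) = compose (word L) D := by
  rw [word_append h (by simpa using hD), word_cons]
  exact congrArg _ (compose_one _ hD.2)

theorem Reduced.append_left {L L' : List (List ℕ)} (h : Reduced (L ++ L')) : Reduced L :=
  ⟨fun δ hδ => h.1 δ (List.mem_append_left _ hδ), h.2.left_of_append⟩

/-- A factorisation is irreducible if and only if it is a reduced word, or consists of `(1)`. -/
theorem isIrreducibleFactorisation_iff {L : List (List ℕ)} {α : List ℕ} :
    IsIrreducibleFactorisation L α ↔ word L = α ∧ (L = [[1]] ∨ L ≠ [] ∧ Reduced L) := by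
  constructor
  · rintro ⟨hL, hcomp, hw, hch, hirr⟩
    refine ⟨hw, ?_⟩
    by_cases hone : [1] ∈ L
    · left
      obtain ⟨A, B, rfl⟩ := List.append_of_mem hone
      rcases List.eq_nil_or_concat A with rfl | ⟨A, a, rfl⟩
      · rcases B with _ | ⟨b, B⟩
        · rfl
        · rw [List.nil_append, List.isChain_cons_cons] at hch
          exact (hch.1 (Or.inl (Or.inl rfl))).elim
      · rw [List.concat_append, List.isChain_append_cons_cons] at hch
        exact (hch.2.1 (Or.inl (Or.inr rfl))).elim
    · refine Or.inr ⟨hL, fun δ hδ => ⟨hcomp δ hδ, fun h => hone (h ▸ hδ), hirr δ hδ⟩, ?_⟩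
      rw [List.isChain_iff_forall_rel_of_append_cons_cons] at hch ⊢
      intro a b A B h hb
      refine hch h ((isTrivialFactorisation_iff (hcomp a ?_) (hcomp b ?_)).2 (Or.inr (Or.inr hb)))
      all_goals simp [h]
  · rintro ⟨hw, rfl | ⟨hL, h⟩⟩
    · refine ⟨by simp, by simpa using IsComp.one, hw, by simp, ?_⟩
      intro δ hδ
      rw [List.mem_singleton.1 hδ]
      exact Const.hasOnlyTrivialFactorisations (b := True) fun s h0 h1 => by simp at h1; omega
    · refine ⟨hL, fun δ hδ => (h.1 δ hδ).isComp, hw, ?_, fun δ hδ => (h.1 δ hδ).irred⟩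
      have := h.2
      rw [List.isChain_iff_forall_rel_of_append_cons_cons] at this ⊢
      intro a b A B hab htr
      have ha := h.1 a (by simp [hab])
      have hb := h.1 b (by simp [hab])
      rcases (isTrivialFactorisation_iff ha.isComp hb.isComp).1 htr with h' | h' | h'
      exacts [ha.ne_one h', hb.ne_one h', this hab h']

/-- In words the composition `(1)` is the empty product, whereas its irreducible factorisation
consists of the single factor `(1)`. -/
theorem isNormalised_iff {α : List ℕ} :
    IsNormalised α ↔ ∃ L, word L = α ∧ Reduced L ∧ ∀ δ ∈ L, IsLexMin δ := by
  constructor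
  · rintro ⟨L, h, hL⟩
    obtain ⟨h1, rfl | ⟨_, h2⟩⟩ := isIrreducibleFactorisation_iff.1 h
    · exact ⟨[], h1 ▸ one_compose.symm, ⟨by simp, by simp⟩, by simp⟩
    · exact ⟨L, h1, h2, hL⟩
  · rintro ⟨L, h1, h2, hL⟩
    by_cases h0 : L = []
    · subst h0
      exact ⟨[[1]], isIrreducibleFactorisation_iff.2 ⟨h1 ▸ one_compose, Or.inl rfl⟩,
        by simp [IsLexMin]⟩
    · exact ⟨L, isIrreducibleFactorisation_iff.2 ⟨h1, Or.inr ⟨h0, h2⟩⟩, hL⟩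

/-! ### Uniqueness of reduced words -/

section Unique

variable {α δ δ' D D' : List ℕ}

theorem mem_cuts_compose_of_lt (hδ : IsComp δ) (hD : IsComp D) {s : ℕ} (h0 : 0 < s)
    (hs : s < D.sum) : s ∈ cuts (compose δ D) ↔ s ∈ cuts D := by
  have h1 : ¬ D.sum ∣ s := fun h' => by have := Nat.le_of_dvd h0 h'; omega
  have h2 : s < δ.sum * D.sum := hs.trans_le (Nat.le_mul_of_pos_left _ hδ.sum_pos)
  rw [mem_cuts_compose hδ.2 hD]
  simp [h1, h2.le, Nat.mod_eq_of_lt hs]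

theorem mem_cuts_compose_of_not_dvd (hδ : IsComp δ) (hD : IsComp D) {s : ℕ}
    (hs : s < δ.sum * D.sum) (h : ¬ D.sum ∣ s) :
    s ∈ cuts (compose δ D) ↔ s % D.sum ∈ cuts D := by
  rw [mem_cuts_compose hδ.2 hD]
  simp [h, hs.le]

/-- A period of a product which divides the size of the irreducible last factor is trivial. -/
theorem IsLetter.period (hδ : IsComp δ) (hD : IsLetter D) {g : ℕ} (hg : g ∣ D.sum)
    (h : PerOff (cuts (compose δ D)) (compose δ D).sum g g) :
    g = 1 ∨ g = D.sum ∨ ∃ b, Const b D := by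
  obtain ⟨ε, E, hε, hE, hs, hc⟩ := exists_compose hD.isComp hg fun y h0 hy hyn => by
    rw [← mem_cuts_compose_of_lt hδ hD.isComp (by omega) hyn,
      ← mem_cuts_compose_of_lt hδ hD.isComp h0 (by omega)]
    exact h y h0 hy (hyn.trans_le (by
      rw [sum_compose]; exact Nat.le_mul_of_pos_left _ hδ.sum_pos))
  rcases (isTrivialFactorisation_iff hε hE).1 (hD.irred ε E hε hE hc.symm) with h | h | ⟨b, h⟩
  · rw [h, one_compose] at hc
    exact Or.inr (Or.inl (by rw [hc, hs]))
  · exact Or.inl (by rw [← hs, h]; rfl)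
  · exact Or.inr (Or.inr ⟨b, hc ▸ (Const.compose_iff hε hE).2 h⟩)

theorem Const.of_compose_of_le {b : Prop} (hδ : IsComp δ) (hδ' : IsComp δ') (hD : IsComp D)
    (hD' : IsComp D') (h : compose δ D = compose δ' D') (hle : D.sum ≤ D'.sum)
    (hb : Const b D') : Const b D := fun s h0 hs => by
  rw [← mem_cuts_compose_of_lt hδ hD h0 hs, h,
    mem_cuts_compose_of_lt hδ' hD' h0 (hs.trans_le hle)]
  exact hb s h0 (hs.trans_le hle)

/-- By the Chinese remainder theorem there is a position congruent to `x` modulo `D.sum` and to `1`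
modulo `D'.sum`. Its being a cut depends only on `x` by one factorisation, and not on `x` at all by
the other. -/
theorem const_of_coprime (hδ : IsComp δ) (hδ' : IsComp δ') (hD : IsComp D) (hD' : IsComp D')
    (h1 : 1 < D'.sum) (h : compose δ D = compose δ' D') (hc : Nat.Coprime D.sum D'.sum) :
    Const (1 ∈ cuts (compose δ D)) D := by
  intro x h0 hx
  have hs := congrArg List.sum h
  rw [sum_compose, sum_compose] at hs
  have hle : D.sum * D'.sum ≤ δ.sum * D.sum := by
    refine Nat.le_of_dvd (Nat.mul_pos hδ.sum_pos hD.sum_pos) (hc.mul_dvd_of_dvd_of_dvd ?_ ?_)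
    · exact dvd_mul_left _ _
    · rw [hs]; exact dvd_mul_left _ _
  obtain ⟨z, hz, hz'⟩ := Nat.chineseRemainder hc x 1
  have hlt := Nat.mod_lt z (Nat.mul_pos hD.sum_pos hD'.sum_pos)
  have e1 : z % (D.sum * D'.sum) % D.sum = x := by
    rw [Nat.mod_mul_right_mod]; exact Eq.trans hz (Nat.mod_eq_of_lt hx)
  have e2 : z % (D.sum * D'.sum) % D'.sum = 1 := by
    rw [Nat.mod_mul_left_mod]; exact Eq.trans hz' (Nat.mod_eq_of_lt h1)
  set w := z % (D.sum * D'.sum)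
  have f1 : ¬ D.sum ∣ w := fun h => by rw [Nat.mod_eq_zero_of_dvd h] at e1; omega
  have f2 : ¬ D'.sum ∣ w := fun h => by rw [Nat.mod_eq_zero_of_dvd h] at e2; omega
  have g1 := mem_cuts_compose_of_not_dvd hδ hD (hlt.trans_le hle) f1
  have g2 := mem_cuts_compose_of_not_dvd hδ' hD' (hs ▸ hlt.trans_le hle) f2
  rw [e1] at g1
  rw [e2, ← mem_cuts_compose_of_lt hδ' hD' one_pos h1, ← h] at g2
  exact g1.symm.trans g2

/-- Irreducible last factors are equal, or trivial of the same kind. -/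
theorem IsLetter.eq_or_const (hδ : IsComp δ) (hδ' : IsComp δ') (hD : IsLetter D)
    (hD' : IsLetter D') (h : compose δ D = compose δ' D') :
    D = D' ∨ ∃ b, Const b D ∧ Const b D' := by
  have hDc := hD.isComp
  have hDc' := hD'.isComp
  have m1 := hD.one_lt_sum
  have m1' := hD'.one_lt_sum
  have per := perOff_compose hδ hDc
  have per' := perOff_compose hδ' hDc'
  rw [← sum_compose] at per per'
  rw [← h] at per'
  by_cases e : D.sum = D'.sum
  · exact Or.inl (compose_inj hδ hδ' hDc hDc' e h).2
  right
  by_cases d1 : D.sum ∣ D'.sum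
  · rcases hD'.period hδ' d1 (h ▸ per) with h1 | h1 | ⟨b, hb⟩
    · omega
    · omega
    · exact ⟨b, .of_compose_of_le hδ hδ' hDc hDc' h (Nat.le_of_dvd (by omega) d1) hb, hb⟩
  by_cases d2 : D'.sum ∣ D.sum
  · rcases hD.period hδ d2 per' with h1 | h1 | ⟨b, hb⟩
    · omega
    · omega
    · exact ⟨b, hb,
        .of_compose_of_le hδ' hδ hDc' hDc h.symm (Nat.le_of_dvd (by omega) d2) hb⟩
  by_cases hg : Nat.gcd D.sum D'.sum = 1
  · refine ⟨_, const_of_coprime hδ hδ' hDc hDc' m1' h hg, ?_⟩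
    rw [h]
    exact const_of_coprime hδ' hδ hDc' hDc m1 h.symm (Nat.coprime_comm.1 hg)
  have hs := congrArg List.sum h
  rw [sum_compose, sum_compose] at hs
  -- Neither size divides the other, so both left factors have size at least two. This is the length
  -- needed for the theorem of Fine and Wilf, which makes the gcd of the sizes a period.
  have hle : D.sum + D'.sum ≤ (compose δ D).sum := by
    rw [sum_compose]
    have a1 : δ.sum ≠ 1 := fun h1 => d2 (by rw [h1, one_mul] at hs; exact hs ▸ dvd_mul_left _ _)
    have a2 : δ'.sum ≠ 1 := fun h1 => d1 (by
      rw [h1, one_mul] at hs; exact hs ▸ dvd_mul_left _ _)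
    have b1 : 2 * D.sum ≤ δ.sum * D.sum :=
      Nat.mul_le_mul_right _ (by have := hδ.sum_pos; omega)
    have b2 : 2 * D'.sum ≤ δ'.sum * D'.sum :=
      Nat.mul_le_mul_right _ (by have := hδ'.sum_pos; omega)
    omega
  have gd := Nat.gcd_dvd_left D.sum D'.sum
  have gd' := Nat.gcd_dvd_right D.sum D'.sum
  have per2 : PerOff (cuts (compose δ D)) (compose δ D).sum (Nat.gcd D.sum D'.sum) D.sum :=
    fun y h0 hy => per y h0 fun h => hy (gd.trans h)
  have per2' : PerOff (cuts (compose δ D)) (compose δ D).sum (Nat.gcd D.sum D'.sum) D'.sum :=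
    fun y h0 hy => per' y h0 fun h => hy (gd'.trans h)
  have perg := per2.gcd per2' gd gd' hle
  rcases hD.period hδ gd perg with h1 | h1 | ⟨b, hb⟩
  · exact (hg h1).elim
  · exact (d1 (h1 ▸ gd')).elim
  rcases hD'.period hδ' gd' (h ▸ perg) with h2 | h2 | ⟨b', hb'⟩
  · exact (hg h2).elim
  · exact (d2 (h2 ▸ gd)).elim
  refine ⟨b, hb, hb'.congr ?_⟩
  rw [← hb 1 one_pos m1, ← hb' 1 one_pos m1', ← mem_cuts_compose_of_lt hδ hDc one_pos m1, h,
    mem_cuts_compose_of_lt hδ' hDc' one_pos m1']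

theorem exists_const (b : Prop) {n : ℕ} (hn : 0 < n) : ∃ l, IsComp l ∧ l.sum = n ∧ Const b l := by
  obtain ⟨l, h1, h2, h3⟩ := exists_cuts n {_s | b}
  exact ⟨l, .of_sum_pos h1 (by omega), h2, fun s h0 hs => h3 s h0 (h2 ▸ hs)⟩

/-- If a product has two trivial last factors of the same kind, then the complement of the one
has a further such factor, unless the size of the other divides its size. -/
theorem exists_const_factor {b : Prop} (hδ : IsComp δ) (hδ' : IsComp δ') (hD : IsComp D)
    (hD' : IsComp D') (h : compose δ D = compose δ' D') (hb : Const b D) (hb' : Const b D')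
    (hdvd : ¬ D'.sum ∣ D.sum) : ∃ ε U, IsComp ε ∧ IsComp U ∧ U ≠ [1] ∧ Const b U ∧
      δ = compose ε U := by
  have hs := congrArg List.sum h
  rw [sum_compose, sum_compose] at hs
  have hm := hD.sum_pos
  have hm' := hD'.sum_pos
  obtain ⟨u, hu⟩ := Nat.dvd_lcm_left D.sum D'.sum
  have hl : 0 < Nat.lcm D.sum D'.sum := Nat.lcm_pos hm hm'
  have hu0 : 0 < u := Nat.pos_of_ne_zero fun h => by rw [h, mul_zero] at hu; omega
  -- A nonmultiple of the lcm is governed by one of the two constant factors. So the lcm is a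
  -- period, with a constant right factor `E`, which splits as `U ∘ D`.
  have mem : ∀ y, 0 < y → ¬ Nat.lcm D.sum D'.sum ∣ y → y < (compose δ D).sum →
      (y ∈ cuts (compose δ D) ↔ b) := by
    intro y h0 hy hyn
    rw [sum_compose] at hyn
    by_cases hy1 : D.sum ∣ y
    · have hy2 : ¬ D'.sum ∣ y := fun h => hy (Nat.lcm_dvd hy1 h)
      rw [h, mem_cuts_compose_of_not_dvd hδ' hD' (hs ▸ hyn) hy2]
      exact hb' _ (Nat.pos_of_ne_zero fun h => hy2 (Nat.dvd_of_mod_eq_zero h)) (Nat.mod_lt _ hm')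
    · rw [mem_cuts_compose_of_not_dvd hδ hD hyn hy1]
      exact hb _ (Nat.pos_of_ne_zero fun h => hy1 (Nat.dvd_of_mod_eq_zero h)) (Nat.mod_lt _ hm)
  obtain ⟨ε, E, hε, hE, hEs, hc⟩ := exists_compose (hδ.compose hD)
    (m := Nat.lcm D.sum D'.sum) (by
      rw [sum_compose]
      exact Nat.lcm_dvd (dvd_mul_left _ _) (hs ▸ dvd_mul_left _ _)) fun y h0 hy hyn => by
    rw [mem y h0 hy (by omega), mem _ (by omega) (by rwa [Nat.dvd_add_self_right]) hyn]
  obtain ⟨U, hU, hUs, hUb⟩ := exists_const b hu0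
  have hEb : Const b E := fun s h0 h1 => by
    have h2 : s < (compose δ D).sum := by
      rw [hc, sum_compose]
      exact h1.trans_le (Nat.le_mul_of_pos_left _ hε.sum_pos)
    rw [← mem_cuts_compose_of_lt hε hE h0 h1, ← hc]
    exact mem s h0 (fun h => by have := Nat.le_of_dvd h0 h; omega) h2
  have hEU : E = compose U D :=
    hEb.ext ((Const.compose_iff hU hD).2 ⟨hUb, hb⟩) hE (hU.compose hD)
      (by rw [sum_compose, hEs, hUs, hu, mul_comm])
  refine ⟨ε, U, hε, hU, fun h1 => ?_, hUb, ?_⟩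
  · rw [h1] at hUs
    have hu1 : u = 1 := hUs.symm.trans rfl
    rw [hu1, mul_one] at hu
    exact hdvd (hu ▸ Nat.dvd_lcm_right D.sum D'.sum)
  · rw [hEU, ← compose_assoc hε.2 hU hD] at hc
    exact (compose_inj hδ (hε.compose hU) hD hD rfl hc).1

/-- By `IsLetter.eq_or_const`, the last letter of `L` would be constant of the same kind as its
neighbour `D`. -/
theorem Reduced.not_const_factor {b : Prop} {L : List (List ℕ)} (hL : Reduced (L ++ [D]))
    (hb : Const b D) {ε U : List ℕ} (hε : IsComp ε) (hU : IsComp U) (hU1 : U ≠ [1])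
    (hUb : Const b U) (h : word L = compose ε U) : False := by
  have hUl : IsLetter U := ⟨hU, hU1, hUb.hasOnlyTrivialFactorisations⟩
  rcases List.eq_nil_or_concat L with rfl | ⟨L, B, rfl⟩
  · have := congrArg List.sum h
    rw [sum_compose] at this
    have h1 : 1 = ε.sum * U.sum := this
    have := hUl.one_lt_sum
    have := Nat.eq_one_of_mul_eq_one_left h1.symm
    omega
  · have hL' := hL.append_left
    rw [List.concat_eq_append] at hL hL' h
    have hB := hL'.1 B (by simp)
    have hc : ∀ δ ∈ L, IsComp δ := fun δ hδ => (hL'.1 δ (by simp [hδ])).isComp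
    rw [word_snoc hc hB.isComp] at h
    have hch := hL.2
    rw [List.append_assoc, List.singleton_append, List.isChain_append_cons_cons] at hch
    rcases hB.eq_or_const (isComp_word hc) hε hUl h with rfl | ⟨b', h1, h2⟩
    · exact hch.2.1 ⟨b, hUb, hb⟩
    · exact hch.2.1 ⟨b, h1.congr (h2.iff hUb hUl.one_lt_sum), hb⟩

theorem Reduced.eq_nil {L : List (List ℕ)} (hL : Reduced L) (h : word L = [1]) : L = [] := by
  rcases L with _ | ⟨a, L⟩
  · rfl
  · have ha := (hL.1 a (by simp)).one_lt_sum
    have := congrArg List.sum h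
    rw [word_cons, sum_compose] at this
    have := Nat.eq_one_of_mul_eq_one_right this
    omega

/-- Last letters coincide or are constant of the same kind. In the second case, unless each size
divides the other, `exists_const_factor` produces a further constant factor next to one of them,
against reducedness. Then the last letter is cancelled. -/
theorem Reduced.unique {L L' : List (List ℕ)} (hL : Reduced L) (hL' : Reduced L')
    (h : word L = word L') : L = L' := by
  induction L using List.reverseRecOn generalizing L' with
  | nil => exact (hL'.eq_nil h.symm).symm
  | append_singleton L D ih =>
    rcases List.eq_nil_or_concat L' with rfl | ⟨L', D', rfl⟩
    · exact hL.eq_nil h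
    rw [List.concat_eq_append] at hL' h ⊢
    have hD := hL.1 D (by simp)
    have hD' := hL'.1 D' (by simp)
    have hc : ∀ δ ∈ L, IsComp δ := fun δ hδ => (hL.1 δ (by simp [hδ])).isComp
    have hc' : ∀ δ ∈ L', IsComp δ := fun δ hδ => (hL'.1 δ (by simp [hδ])).isComp
    rw [word_snoc hc hD.isComp, word_snoc hc' hD'.isComp] at h
    have hw := isComp_word hc
    have hw' := isComp_word hc'
    have key : D = D' := by
      rcases hD.eq_or_const hw hw' hD' h with h1 | ⟨b, hb, hb'⟩
      · exact h1
      by_cases d1 : D'.sum ∣ D.sum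
      · by_cases d2 : D.sum ∣ D'.sum
        · exact hb.ext hb' hD.isComp hD'.isComp (Nat.dvd_antisymm d2 d1)
        · obtain ⟨ε, U, hε, hU, hU1, hUb, he⟩ :=
            exists_const_factor hw' hw hD'.isComp hD.isComp h.symm hb' hb d2
          exact (hL'.not_const_factor hb' hε hU hU1 hUb he).elim
      · obtain ⟨ε, U, hε, hU, hU1, hUb, he⟩ :=
          exists_const_factor hw hw' hD.isComp hD'.isComp h hb hb' d1
        exact (hL.not_const_factor hb hε hU hU1 hUb he).elim
    subst key
    rw [ih hL.append_left hL'.append_left (compose_inj hw hw' hD.isComp hD.isComp rfl h).1]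

end Unique

end RibbonCount

namespace RibbonCount

/-! ### Words with letters reversed -/

/-- A pair of a composition and itself or its reversal. -/
structure RevPair (p : List ℕ × List ℕ) : Prop where
  isComp : IsComp p.1
  snd : p.2 = p.1 ∨ p.2 = p.1.reverse

/-- The word of the first components of a list of pairs. -/
def fstWord (P : List (List ℕ × List ℕ)) : List ℕ := word (P.map Prod.fst)

/-- The word of the second components of a list of pairs. -/
def sndWord (P : List (List ℕ × List ℕ)) : List ℕ := word (P.map Prod.snd)

variable {P P' : List (List ℕ × List ℕ)} {p q : List ℕ × List ℕ}

namespace RevPair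

theorem isComp_snd (h : RevPair p) : IsComp p.2 := by
  rcases h.snd with h' | h' <;> rw [h']
  exacts [h.isComp, h.isComp.reverse]

theorem reverse_snd (h : RevPair p) : RevPair (p.1, p.2.reverse) := by
  refine ⟨h.isComp, ?_⟩
  rcases h.snd with h' | h' <;> simp [h']

theorem isLetter_snd (h : RevPair p) (hl : IsLetter p.1) : IsLetter p.2 := by
  rcases h.snd with h' | h' <;> rw [h']
  exacts [hl, hl.reverse]

theorem snd_eq {b : Prop} (h : RevPair p) (hb : Const b p.1) : p.2 = p.1 :=
  h.snd.elim id fun h' => h'.trans (hb.reverse_eq h.isComp)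

theorem const_snd {b : Prop} (h : RevPair p) (hb : Const b p.2) : Const b p.1 := by
  rcases h.snd with h' | h'
  · rwa [h'] at hb
  · have := hb.reverse h.isComp_snd
    rwa [h', List.reverse_reverse] at this

theorem self {δ : List ℕ} (h : IsComp δ) : RevPair (δ, δ) := ⟨h, Or.inl rfl⟩

theorem forall_fst (h : ∀ p ∈ P, RevPair p) : ∀ δ ∈ P.map Prod.fst, IsComp δ := by
  intro δ hδ
  obtain ⟨p, hp, rfl⟩ := List.mem_map.1 hδ
  exact (h p hp).isComp

theorem forall_snd (h : ∀ p ∈ P, RevPair p) : ∀ δ ∈ P.map Prod.snd, IsComp δ := by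
  intro δ hδ
  obtain ⟨p, hp, rfl⟩ := List.mem_map.1 hδ
  exact (h p hp).isComp_snd

end RevPair

theorem fstWord_cons (p : List ℕ × List ℕ) (P) : fstWord (p :: P) = compose p.1 (fstWord P) := rfl

theorem sndWord_cons (p : List ℕ × List ℕ) (P) : sndWord (p :: P) = compose p.2 (sndWord P) := rfl

theorem fstWord_append (h : ∀ p ∈ P, RevPair p) (h' : ∀ p ∈ P', RevPair p) :
    fstWord (P ++ P') = compose (fstWord P) (fstWord P') := by
  rw [fstWord, List.map_append, word_append (RevPair.forall_fst h) (RevPair.forall_fst h')]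
  rfl

theorem sndWord_append (h : ∀ p ∈ P, RevPair p) (h' : ∀ p ∈ P', RevPair p) :
    sndWord (P ++ P') = compose (sndWord P) (sndWord P') := by
  rw [sndWord, List.map_append, word_append (RevPair.forall_snd h) (RevPair.forall_snd h')]
  rfl

theorem isComp_fstWord (h : ∀ p ∈ P, RevPair p) : IsComp (fstWord P) :=
  isComp_word (RevPair.forall_fst h)

theorem isComp_sndWord (h : ∀ p ∈ P, RevPair p) : IsComp (sndWord P) :=
  isComp_word (RevPair.forall_snd h)

theorem sndWord_reverse (h : ∀ p ∈ P, RevPair p) :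
    sndWord (P.map fun p => (p.1, p.2.reverse)) = (sndWord P).reverse := by
  induction P with
  | nil => rfl
  | cons p P ih =>
    rw [List.forall_mem_cons] at h
    rw [List.map_cons, sndWord_cons, sndWord_cons, ih h.2,
      reverse_compose h.1.isComp_snd.2 (isComp_sndWord h.2)]

theorem fstWord_reverse : fstWord (P.map fun p => (p.1, p.2.reverse)) = fstWord P := by
  rw [fstWord, List.map_map]
  rfl

/-- Reversing letters gives similar words. -/
theorem simComp_fstWord_sndWord (h : ∀ p ∈ P, RevPair p) : SimComp (fstWord P) (sndWord P) := by
  suffices H : ∀ Q, IsComp Q → SimComp (compose Q (fstWord P)) (compose Q (sndWord P)) by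
    simpa [one_compose] using H [1] IsComp.one
  induction P with
  | nil => exact fun Q _ => .of_eq rfl
  | cons p P ih =>
    rw [List.forall_mem_cons] at h
    intro Q hQ
    have hp := h.1.isComp
    have hp' := h.1.isComp_snd
    have h1 := isComp_fstWord h.2
    have h2 := isComp_sndWord h.2
    rw [fstWord_cons, sndWord_cons, ← compose_assoc hQ.2 hp h1, ← compose_assoc hQ.2 hp' h2]
    refine (ih h.2 _ (hQ.compose hp)).trans ?_
    refine SimComp.compose_left ?_ (hQ.compose hp) (hQ.compose hp') h2
    rcases h.1.snd with h' | h' <;> rw [h']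
    exacts [.of_eq rfl, simComp_compose_reverse hQ hp]

/-- A list of pairs with reduced first word. -/
def ReducedPairs (P : List (List ℕ × List ℕ)) : Prop :=
  (∀ p ∈ P, RevPair p) ∧ Reduced (P.map Prod.fst)

/-- Constant letters are symmetric, so reversing letters creates no new trivial neighbours. -/
theorem ReducedPairs.snd (h : ReducedPairs P) : Reduced (P.map Prod.snd) := by
  refine ⟨fun δ hδ => ?_, ?_⟩
  · obtain ⟨p, hp, rfl⟩ := List.mem_map.1 hδ
    exact (h.1 p hp).isLetter_snd (h.2.1 _ (List.mem_map_of_mem hp))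
  · have := h.2.2
    rw [List.isChain_map, List.isChain_iff_forall_rel_of_append_cons_cons] at this ⊢
    rintro p q A B hP ⟨b, hb, hb'⟩
    exact this hP ⟨b, (h.1 p (by simp [hP])).const_snd hb, (h.1 q (by simp [hP])).const_snd hb'⟩

/-- Every composition other than `(1)` is a product of irreducible ones, with any choice of
reversal. -/
theorem RevPair.split (n : ℕ) : ∀ p, RevPair p → p.1.sum ≤ n → ∃ P,
    (∀ p ∈ P, RevPair p ∧ IsLetter p.1) ∧ fstWord P = p.1 ∧ sndWord P = p.2 := by
  induction n with
  | zero => intro p hp h; have := hp.isComp.sum_pos; omega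
  | succ n ih =>
    intro p hp hn
    by_cases h1 : p.1 = [1]
    · refine ⟨[], by simp, h1.symm, ?_⟩
      rcases hp.snd with h | h <;> rw [h, h1] <;> rfl
    by_cases hirr : HasOnlyTrivialFactorisations p.1
    · refine ⟨[p], ?_, ?_, ?_⟩
      · intro q hq
        rw [List.mem_singleton.1 hq]
        exact ⟨hp, hp.isComp, h1, hirr⟩
      · exact compose_one _ hp.isComp.2
      · exact compose_one _ hp.isComp_snd.2
    · rw [HasOnlyTrivialFactorisations] at hirr
      push Not at hirr
      obtain ⟨β, γ, hβ, hγ, hc, htr⟩ := hirr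
      rw [isTrivialFactorisation_iff hβ hγ] at htr
      push Not at htr
      have b1 := hβ.one_lt_sum htr.1
      have c1 := hγ.one_lt_sum htr.2.1
      have hs := congrArg List.sum hc
      rw [sum_compose] at hs
      have b2 : β.sum < p.1.sum := by rw [← hs]; exact (Nat.lt_mul_iff_one_lt_right (by omega)).2 c1
      have c2 : γ.sum < p.1.sum := by rw [← hs]; exact (Nat.lt_mul_iff_one_lt_left (by omega)).2 b1
      obtain ⟨β', γ', hβ', hγ', hp2⟩ : ∃ β' γ', RevPair (β, β') ∧ RevPair (γ, γ') ∧
          p.2 = compose β' γ' := by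
        rcases hp.snd with h | h
        · exact ⟨β, γ, .self hβ, .self hγ, by rw [h, hc]⟩
        · exact ⟨_, _, (RevPair.self hβ).reverse_snd, (RevPair.self hγ).reverse_snd,
            by rw [h, ← hc, reverse_compose hβ.2 hγ]⟩
      obtain ⟨A, hA, a1, a2⟩ := ih _ hβ' (by dsimp only; omega)
      obtain ⟨B, hB, b1, b2⟩ := ih _ hγ' (by dsimp only; omega)
      refine ⟨A ++ B, fun q hq => ?_, ?_, ?_⟩
      · exact (List.mem_append.1 hq).elim (hA q) (hB q)
      · rw [fstWord_append (fun p hp => (hA p hp).1) fun p hp => (hB p hp).1, a1, b1, hc]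
      · rw [sndWord_append (fun p hp => (hA p hp).1) fun p hp => (hB p hp).1, a2, b2, hp2]

/-- Neighbouring constants of the same kind are merged into one letter. As they are symmetric, the
merged letter is paired with itself. -/
theorem ReducedPairs.insert (hp : RevPair p) (hl : IsLetter p.1) (h : ReducedPairs P) :
    ∃ P', ReducedPairs P' ∧ fstWord P' = fstWord (p :: P) ∧ sndWord P' = sndWord (p :: P) := by
  rcases P with _ | ⟨q, P⟩
  · exact ⟨[p], ⟨by simpa using hp, by simpa using hl, by simp⟩, rfl, rfl⟩
  have hq := h.1 q (by simp)
  have hql : IsLetter q.1 := h.2.1 q.1 (by simp)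
  have hP : ∀ p ∈ P, RevPair p := fun p hp => h.1 p (List.mem_cons_of_mem _ hp)
  by_cases htr : ∃ b, Const b p.1 ∧ Const b q.1
  · obtain ⟨b, hb, hb'⟩ := htr
    have hc := (Const.compose_iff hp.isComp hq.isComp).2 ⟨hb, hb'⟩
    have hco := hp.isComp.compose hq.isComp
    have hpq : IsLetter (compose p.1 q.1) := by
      refine ⟨hco, fun h1 => ?_, hc.hasOnlyTrivialFactorisations⟩
      have := congrArg List.sum h1
      rw [sum_compose] at this
      have := Nat.eq_one_of_mul_eq_one_left this
      have := hql.one_lt_sum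
      omega
    refine ⟨(compose p.1 q.1, compose p.1 q.1) :: P, ⟨?_, ?_, ?_⟩, ?_, ?_⟩
    · rw [List.forall_mem_cons]
      exact ⟨.self hco, hP⟩
    · rw [List.map_cons, List.forall_mem_cons]
      exact ⟨hpq, fun δ hδ => h.2.1 δ (by simp only [List.map_cons]; exact List.mem_cons_of_mem _ hδ)⟩
    · have := h.2.2
      rcases P with _ | ⟨r, P⟩
      · simp
      · rw [List.map_cons, List.map_cons, List.isChain_cons_cons] at this ⊢
        refine ⟨?_, this.2⟩
        rintro ⟨c, h1, h2⟩
        exact this.1 ⟨c, ((Const.compose_iff hp.isComp hq.isComp).1 h1).2, h2⟩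
    · rw [fstWord_cons, fstWord_cons, fstWord_cons,
        compose_assoc hp.isComp.2 hq.isComp (isComp_fstWord hP)]
    · rw [sndWord_cons, sndWord_cons, sndWord_cons, hp.snd_eq hb, hq.snd_eq hb',
        compose_assoc hp.isComp.2 hq.isComp (isComp_sndWord hP)]
  · refine ⟨p :: q :: P, ⟨?_, ?_, ?_⟩, rfl, rfl⟩
    · rw [List.forall_mem_cons]
      exact ⟨hp, h.1⟩
    · rw [List.map_cons, List.forall_mem_cons]
      exact ⟨hl, h.2.1⟩
    · rw [List.map_cons, List.map_cons, List.isChain_cons_cons]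
      exact ⟨htr, by simpa using h.2.2⟩

theorem exists_reducedPairs (h : ∀ p ∈ P, RevPair p) :
    ∃ P', ReducedPairs P' ∧ fstWord P' = fstWord P ∧ sndWord P' = sndWord P := by
  have step : ∀ P, (∀ p ∈ P, RevPair p ∧ IsLetter p.1) →
      ∃ P', ReducedPairs P' ∧ fstWord P' = fstWord P ∧ sndWord P' = sndWord P := by
    intro P h
    induction P with
    | nil => exact ⟨[], ⟨by simp, by simp, by simp⟩, rfl, rfl⟩
    | cons p P ih =>
      rw [List.forall_mem_cons] at h
      obtain ⟨P', hP', h1, h2⟩ := ih h.2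
      obtain ⟨P'', hP'', h3, h4⟩ := hP'.insert h.1.1 h.1.2
      exact ⟨P'', hP'', by rw [h3, fstWord_cons, h1, fstWord_cons],
        by rw [h4, sndWord_cons, h2, sndWord_cons]⟩
  obtain ⟨Q, hQ, h1, h2⟩ : ∃ Q, (∀ p ∈ Q, RevPair p ∧ IsLetter p.1) ∧
      fstWord Q = fstWord P ∧ sndWord Q = sndWord P := by
    induction P with
    | nil => exact ⟨[], by simp, rfl, rfl⟩
    | cons p P ih =>
      rw [List.forall_mem_cons] at h
      obtain ⟨B, hB, b1, b2⟩ := ih h.2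
      obtain ⟨A, hA, a1, a2⟩ := RevPair.split _ p h.1 le_rfl
      refine ⟨A ++ B, fun q hq => (List.mem_append.1 hq).elim (hA q) (hB q), ?_, ?_⟩
      · rw [fstWord_append (fun p hp => (hA p hp).1) fun p hp => (hB p hp).1, a1, b1, fstWord_cons]
      · rw [sndWord_append (fun p hp => (hA p hp).1) fun p hp => (hB p hp).1, a2, b2, sndWord_cons]
  obtain ⟨P', hP', h3, h4⟩ := step Q hQ
  exact ⟨P', hP', h3.trans h1, h4.trans h2⟩

/-- Every composition is a reduced word. -/
theorem exists_reduced {α : List ℕ} (hα : IsComp α) : ∃ L, Reduced L ∧ word L = α := by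
  obtain ⟨P, hP, h, -⟩ := exists_reducedPairs (P := [(α, α)]) (by simpa using RevPair.self hα)
  exact ⟨_, hP.2, h.trans (compose_one _ hα.2)⟩

/-- Similar compositions are words with letters reversed. -/
theorem SimComp.exists_pairs (n : ℕ) : ∀ {α γ : List ℕ}, SimComp α γ → IsComp α → IsComp γ →
    α.sum ≤ n → ∃ P, (∀ p ∈ P, RevPair p) ∧ fstWord P = α ∧ sndWord P = γ := by
  induction n with
  | zero => intro α γ _ hα _ h; have := hα.sum_pos; omega
  | succ n ih =>
    intro α γ h hα hγ hn
    obtain ⟨T, hT, hST⟩ := h.2.structure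
    obtain ⟨β, hβ, hβγ, hβT⟩ : ∃ β, IsComp β ∧ (γ = β ∨ γ = β.reverse) ∧
        ∀ s, 0 < s → s < α.sum → (s ∈ T ↔ s ∈ cuts β) := by
      rcases hT with rfl | rfl
      · exact ⟨γ, hγ, Or.inl rfl, fun _ _ _ => Iff.rfl⟩
      · refine ⟨γ.reverse, hγ.reverse, Or.inr (by simp), fun s _ hs => ?_⟩
        rw [h.1] at hs
        rw [mem_cuts_reverse hs.le, h.1]
        rfl
    have hsum : α.sum = β.sum := by
      rw [h.1]
      rcases hβγ with h' | h' <;> simp [h']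
    have hsim : SimComp α β := by
      rcases hβγ with rfl | rfl
      · exact h
      · simpa using h.reverse_right
    suffices H : ∃ P, (∀ p ∈ P, RevPair p) ∧ fstWord P = α ∧ sndWord P = β by
      obtain ⟨P, hP, h1, h2⟩ := H
      rcases hβγ with rfl | rfl
      · exact ⟨P, hP, h1, h2⟩
      · refine ⟨P.map fun p => (p.1, p.2.reverse), fun q hq => ?_, ?_, ?_⟩
        · obtain ⟨p, hp, rfl⟩ := List.mem_map.1 hq
          exact (hP p hp).reverse_snd
        · rw [fstWord_reverse, h1]
        · rw [sndWord_reverse hP, h2]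
    rcases hST with hST | ⟨m, m1, mn, md, hST, hper⟩
    · have : α = β := eq_of_cuts hα.2 hβ.2 hsum fun s h0 hs => (hST s h0 hs).trans (hβT s h0 hs)
      subst this
      exact ⟨[(α, α)], by simpa using RevPair.self hα, compose_one _ hα.2, compose_one _ hα.2⟩
    have agree : ∀ s, 0 < s → s < α.sum → ¬ m ∣ s → (s ∈ cuts α ↔ s ∈ cuts β) :=
      fun s h0 hs hms => (hST s h0 hs hms).trans (hβT s h0 hs)
    obtain ⟨δ, D, hδ, hD, hDs, hc⟩ := exists_compose hα md hper
    obtain ⟨δ', D', hδ', hD', hDs', hc'⟩ := exists_compose hβ (hsum ▸ md) fun y h0 hy hyn => by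
      rw [← hsum] at hyn
      rw [← agree y h0 (by omega) hy, ← agree _ (by omega) hyn (by rwa [Nat.dvd_add_self_right])]
      exact hper y h0 hy hyn
    -- Below `m` there are no positive multiples of `m`, so the two sets of cuts agree there and the
    -- right factors are equal.
    have hDD : D = D' := eq_of_cuts hD.2 hD'.2 (hDs.trans hDs'.symm) fun s h0 hs => by
      rw [← mem_cuts_compose_of_lt hδ hD h0 hs, ← mem_cuts_compose_of_lt hδ' hD' h0 (by omega),
        ← hc, ← hc']
      exact agree s h0 (by omega) fun h' => by have := Nat.le_of_dvd h0 h'; omega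
    subst hDD
    subst hc hc'
    have hlt : δ.sum < (compose δ D).sum := by
      rw [sum_compose]
      exact (Nat.lt_mul_iff_one_lt_right hδ.sum_pos).2 (by omega)
    obtain ⟨P, hP, h1, h2⟩ := ih (hsim.of_compose hδ hδ' hD) hδ hδ' (by omega)
    have hDP : ∀ p ∈ [(D, D)], RevPair p := by simpa using RevPair.self hD
    refine ⟨P ++ [(D, D)], fun q hq => (List.mem_append.1 hq).elim (hP q) (hDP q), ?_, ?_⟩
    · rw [fstWord_append hP hDP, h1]
      exact congrArg _ (compose_one _ hD.2)
    · rw [sndWord_append hP hDP, h2]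
      exact congrArg _ (compose_one _ hD.2)

theorem IsNormalised.isComp {α : List ℕ} (h : IsNormalised α) : IsComp α := by
  obtain ⟨L, rfl, hL, -⟩ := isNormalised_iff.1 h
  exact hL.isComp

/-- Similar normalised compositions are equal. -/
theorem SimComp.eq_of_isNormalised {α γ : List ℕ} (h : SimComp α γ) (hα : IsNormalised α)
    (hγ : IsNormalised γ) : α = γ := by
  obtain ⟨Q, hQ, h1, h2⟩ := SimComp.exists_pairs _ h hα.isComp hγ.isComp le_rfl
  obtain ⟨P, hP, h3, h4⟩ := exists_reducedPairs hQ
  obtain ⟨L, rfl, hL, hmin⟩ := isNormalised_iff.1 hα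
  obtain ⟨L', rfl, hL', hmin'⟩ := isNormalised_iff.1 hγ
  have e1 : P.map Prod.fst = L := hP.2.unique hL (h3.trans h1)
  have e2 : P.map Prod.snd = L' := hP.snd.unique hL' (h4.trans h2)
  rw [← e1, ← e2]
  congr 1
  refine List.map_congr_left fun p hp => ?_
  have m1 : IsLexMin p.1 := hmin _ (e1 ▸ List.mem_map_of_mem hp)
  have m2 : IsLexMin p.2 := hmin' _ (e2 ▸ List.mem_map_of_mem hp)
  rcases (hP.1 p hp).snd with h' | h'
  · exact h'.symm
  · rw [IsLexMin, h', List.reverse_reverse] at m2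
    rw [h']
    exact le_antisymm m1 m2

/-- Every composition is similar to a normalised one. -/
theorem exists_isNormalised {α : List ℕ} (hα : IsComp α) : ∃ γ, IsNormalised γ ∧ SimComp α γ := by
  obtain ⟨L, hL, rfl⟩ := exists_reduced hα
  set f : List ℕ → List ℕ × List ℕ := fun δ => (δ, min δ δ.reverse)
  have hf : (L.map f).map Prod.fst = L := by rw [List.map_map]; exact List.map_id L
  have hP : ReducedPairs (L.map f) := by
    refine ⟨fun q hq => ?_, hf.symm ▸ hL⟩
    obtain ⟨δ, hδ, rfl⟩ := List.mem_map.1 hq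
    exact ⟨(hL.1 δ hδ).isComp, min_choice _ _⟩
  have := simComp_fstWord_sndWord hP.1
  rw [fstWord, hf] at this
  refine ⟨_, isNormalised_iff.2 ⟨_, rfl, hP.snd, fun δ hδ => ?_⟩, this⟩
  rw [List.map_map] at hδ
  obtain ⟨ε, hε, rfl⟩ := List.mem_map.1 hδ
  show min ε ε.reverse ≤ (min ε ε.reverse).reverse
  rcases le_total ε ε.reverse with h | h
  · rw [min_eq_left h]; exact h
  · rw [min_eq_right h, List.reverse_reverse]; exact h

end RibbonCount

namespace RibbonCount

/-! ### Counting normalised compositions -/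

section Counting

variable {P Q R : List ℕ → Prop}

theorem finite_comps (P : List ℕ → Prop) (n : ℕ) : {l | P l ∧ IsComp l ∧ l.sum = n}.Finite := by
  refine (Set.finite_range (Composition.blocks (n := n))).subset ?_
  rintro l ⟨-, h, hs⟩
  exact ⟨⟨l, fun {i} hi => h.2 i hi, hs⟩, rfl⟩

/-- The compositions of `n` with property `P`. -/
noncomputable def comps (P : List ℕ → Prop) (n : ℕ) : Finset (List ℕ) := (finite_comps P n).toFinset

theorem mem_comps {n : ℕ} {l : List ℕ} : l ∈ comps P n ↔ P l ∧ IsComp l ∧ l.sum = n :=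
  Set.Finite.mem_toFinset _

theorem numComps_eq {n : ℕ} (hn : n ≠ 0) : numComps P n = (comps P n).card := by
  rw [numComps, comps, ← Nat.card_eq_card_finite_toFinset]
  refine Nat.card_congr (Equiv.ofBijective (fun c => ⟨c.1.blocks, c.2, ⟨fun h => hn ?_, fun a h =>
    c.1.blocks_pos h⟩, c.1.blocks_sum⟩) ⟨?_, ?_⟩)
  · rw [← c.1.blocks_sum, h]; rfl
  · rintro ⟨c, hc⟩ ⟨c', hc'⟩ h
    simp only [Subtype.mk.injEq] at h ⊢
    exact Composition.ext h
  · rintro ⟨l, hl, h, hs⟩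
    exact ⟨⟨⟨l, fun {i} hi => h.2 i hi, hs⟩, hl⟩, rfl⟩

theorem comps_zero : comps P 0 = ∅ := by
  refine Finset.eq_empty_of_forall_notMem fun l hl => ?_
  obtain ⟨-, h, hs⟩ := mem_comps.1 hl
  have := h.sum_pos
  omega

theorem dirichletGF_apply (n : ℕ) : dirichletGF P n = (comps P n).card := by
  show (if n = 0 then (0 : ℚ) else (numComps P n : ℚ)) = _
  by_cases hn : n = 0
  · subst hn
    simp [comps_zero]
  · rw [if_neg hn, numComps_eq hn]

theorem dirichletGF_congr (h : ∀ l, IsComp l → (P l ↔ Q l)) : dirichletGF P = dirichletGF Q := by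
  ext n
  rw [dirichletGF_apply, dirichletGF_apply]
  congr 2
  ext l
  rw [mem_comps, mem_comps]
  exact ⟨fun ⟨h1, h2⟩ => ⟨(h l h2.1).1 h1, h2⟩, fun ⟨h1, h2⟩ => ⟨(h l h2.1).2 h1, h2⟩⟩

theorem dirichletGF_or (P Q : List ℕ → Prop) :
    dirichletGF (fun l => P l ∨ Q l) + dirichletGF (fun l => P l ∧ Q l) =
      dirichletGF P + dirichletGF Q := by
  classical
  ext n
  simp only [ArithmeticFunction.add_apply, dirichletGF_apply]
  norm_cast
  have h1 : comps (fun l => P l ∨ Q l) n = comps P n ∪ comps Q n := by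
    ext l
    simp only [Finset.mem_union, mem_comps]
    tauto
  have h2 : comps (fun l => P l ∧ Q l) n = comps P n ∩ comps Q n := by
    ext l
    simp only [Finset.mem_inter, mem_comps]
    tauto
  rw [h1, h2, Finset.card_union_add_card_inter]

theorem dirichletGF_false : dirichletGF (fun _ => False) = 0 := by
  ext n
  rw [dirichletGF_apply, ArithmeticFunction.zero_apply, Nat.cast_eq_zero, Finset.card_eq_zero]
  exact Finset.eq_empty_of_forall_notMem fun l hl => (mem_comps.1 hl).1

theorem dirichletGF_add (h : ∀ l, IsComp l → (R l ↔ P l ∨ Q l)) (h' : ∀ l, P l → ¬ Q l) :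
    dirichletGF R = dirichletGF P + dirichletGF Q := by
  rw [← dirichletGF_or, dirichletGF_congr h, eq_comm, add_eq_left, ← dirichletGF_false]
  exact dirichletGF_congr fun l _ => iff_of_false (fun h => h' l h.1 h.2) id

theorem dirichletGF_reverse (P : List ℕ → Prop) :
    dirichletGF (fun l => P l.reverse) = dirichletGF P := by
  ext n
  rw [dirichletGF_apply, dirichletGF_apply]
  congr 1
  refine Finset.card_nbij' List.reverse List.reverse ?_ ?_ ?_ ?_
  · intro l hl
    obtain ⟨h1, h2, h3⟩ := mem_comps.1 hl
    exact mem_comps.2 ⟨h1, h2.reverse, by rw [List.sum_reverse, h3]⟩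
  · intro l hl
    obtain ⟨h1, h2, h3⟩ := mem_comps.1 hl
    exact mem_comps.2 ⟨by rwa [List.reverse_reverse], h2.reverse, by rw [List.sum_reverse, h3]⟩
  · exact fun l _ => l.reverse_reverse
  · exact fun l _ => l.reverse_reverse

/-- The generating function of the products of two kinds of compositions, if these products
are distinct. -/
theorem dirichletGF_mul (h : ∀ l, IsComp l → (R l ↔ ∃ a b, P a ∧ Q b ∧ IsComp a ∧ IsComp b ∧
      compose a b = l))
    (hinj : ∀ a b a' b', P a → Q b → P a' → Q b' → IsComp a → IsComp b → IsComp a' → IsComp b' →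
      compose a b = compose a' b' → a = a' ∧ b = b') :
    dirichletGF R = dirichletGF P * dirichletGF Q := by
  ext n
  simp only [ArithmeticFunction.mul_apply, dirichletGF_apply]
  norm_cast
  simp only [← Finset.card_product]
  rw [← Finset.card_sigma]
  symm
  refine Finset.card_bij (fun x _ => compose x.2.1 x.2.2) ?_ ?_ ?_
  · rintro ⟨⟨d, e⟩, a, b⟩ hx
    simp only [Finset.mem_sigma, Nat.mem_divisorsAntidiagonal, Finset.mem_product, mem_comps] at hx
    obtain ⟨⟨h1, -⟩, ⟨h2, h3, h4⟩, h5, h6, h7⟩ := hx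
    dsimp only
    have hc := h3.compose h6
    exact mem_comps.2 ⟨(h _ hc).2 ⟨a, b, h2, h5, h3, h6, rfl⟩, hc, by
      rw [sum_compose, h4, h7, h1]⟩
  · rintro ⟨⟨d, e⟩, a, b⟩ hx ⟨⟨d', e'⟩, a', b'⟩ hx' heq
    simp only [Finset.mem_sigma, Nat.mem_divisorsAntidiagonal, Finset.mem_product,
      mem_comps] at hx hx'
    obtain ⟨-, ⟨h2, h3, h4⟩, h5, h6, h7⟩ := hx
    obtain ⟨-, ⟨h2', h3', h4'⟩, h5', h6', h7'⟩ := hx'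
    obtain ⟨rfl, rfl⟩ := hinj a b a' b' h2 h5 h2' h5' h3 h6 h3' h6' heq
    subst h4 h7 h4' h7'
    rfl
  · intro l hl
    obtain ⟨h1, h2, h3⟩ := mem_comps.1 hl
    obtain ⟨a, b, ha, hb, hca, hcb, rfl⟩ := (h l h2).1 h1
    rw [sum_compose] at h3
    have ha0 := hca.sum_pos
    have hb0 := hcb.sum_pos
    refine ⟨⟨(a.sum, b.sum), a, b⟩, ?_, rfl⟩
    simp only [Finset.mem_sigma, Nat.mem_divisorsAntidiagonal, Finset.mem_product, mem_comps]
    exact ⟨⟨h3, h3 ▸ (Nat.mul_pos ha0 hb0).ne'⟩, ⟨ha, hca, trivial⟩, hb, hcb, trivial⟩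

/-- Every size has one constant composition of each kind; `(1)`, having no inner position, is of
both kinds. -/
theorem dirichletGF_const (b : Prop) : dirichletGF (Const b) = (ArithmeticFunction.zeta : ArithmeticFunction ℚ) := by
  ext n
  rw [dirichletGF_apply, ArithmeticFunction.natCoe_apply, ArithmeticFunction.zeta_apply]
  by_cases hn : n = 0
  · subst hn
    simp [comps_zero]
  · rw [if_neg hn, Nat.cast_inj, Finset.card_eq_one]
    obtain ⟨l, h1, h2, h3⟩ := exists_const b (Nat.pos_of_ne_zero hn)
    refine ⟨l, Finset.eq_singleton_iff_unique_mem.2 ⟨mem_comps.2 ⟨h3, h1, h2⟩, fun l' hl' => ?_⟩⟩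
    obtain ⟨h4, h5, h6⟩ := mem_comps.1 hl'
    exact h4.ext h3 h5 h1 (h6.trans h2.symm)

theorem dirichletGF_one : dirichletGF (fun l => l = [1]) = 1 := by
  ext n
  rw [dirichletGF_apply, ArithmeticFunction.one_apply]
  split_ifs with h
  · rw [Nat.cast_eq_one, Finset.card_eq_one]
    refine ⟨[1], Finset.eq_singleton_iff_unique_mem.2 ⟨mem_comps.2 ⟨rfl, .one, h.symm⟩,
      fun l' hl' => (mem_comps.1 hl').1⟩⟩
  · rw [Nat.cast_eq_zero, Finset.card_eq_zero]
    refine Finset.eq_empty_of_forall_notMem fun l hl => h ?_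
    obtain ⟨rfl, -, h3⟩ := mem_comps.1 hl
    exact h3.symm

/-! ### Dirichlet series of reduced words -/

/-- The products of reduced words with letters of a given kind. -/
def WordsIn (X : List ℕ → Prop) (α : List ℕ) : Prop :=
  ∃ L, word L = α ∧ Reduced L ∧ ∀ δ ∈ L, X δ

/-- The products of reduced words with letters of a given kind, with a condition on the last
letter. -/
def WordsEnding (X p : List ℕ → Prop) (α : List ℕ) : Prop :=
  ∃ L D, word (L ++ [D]) = α ∧ Reduced (L ++ [D]) ∧ (∀ δ ∈ L, X δ) ∧ X D ∧ p D

variable {X p q : List ℕ → Prop}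

theorem WordsEnding.not_wordsEnding (h : ∀ D, IsLetter D → p D → ¬ q D) {α : List ℕ}
    (hα : WordsEnding X p α) : ¬ WordsEnding X q α := by
  obtain ⟨L, D, h1, h2, h3, h4, h5⟩ := hα
  rintro ⟨L', D', h1', h2', h3', h4', h5'⟩
  have := h2.unique h2' (h1.trans h1'.symm)
  rw [List.singleton_inj.1 (List.append_inj' this rfl).2] at h5
  exact h D' (h2'.1 D' (by simp)) h5 h5'

theorem wordsIn_iff {α : List ℕ} : WordsIn X α ↔ α = [1] ∨ WordsEnding X (fun _ => True) α := by
  constructor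
  · rintro ⟨L, h1, h2, h3⟩
    rcases List.eq_nil_or_concat L with rfl | ⟨L, D, rfl⟩
    · exact Or.inl h1.symm
    · rw [List.concat_eq_append] at h1 h2 h3
      exact Or.inr ⟨L, D, h1, h2, fun δ hδ => h3 δ (by simp [hδ]), h3 D (by simp), trivial⟩
  · rintro (rfl | ⟨L, D, h1, h2, h3, h4, -⟩)
    · exact ⟨[], rfl, ⟨by simp, by simp⟩, by simp⟩
    · refine ⟨L ++ [D], h1, h2, fun δ hδ => ?_⟩
      rcases List.mem_append.1 hδ with h | h
      · exact h3 δ h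
      · rwa [List.mem_singleton.1 h]

theorem WordsEnding.ne_one {α : List ℕ} (h : WordsEnding X p α) : α ≠ [1] := by
  obtain ⟨L, D, h1, h2, -⟩ := h
  rintro rfl
  simpa using h2.eq_nil h1

theorem wordsEnding_or {α : List ℕ} : WordsEnding X (fun D => p D ∨ q D) α ↔
    WordsEnding X p α ∨ WordsEnding X q α := by
  constructor
  · rintro ⟨L, D, h1, h2, h3, h4, h5 | h5⟩
    exacts [Or.inl ⟨L, D, h1, h2, h3, h4, h5⟩, Or.inr ⟨L, D, h1, h2, h3, h4, h5⟩]
  · rintro (⟨L, D, h1, h2, h3, h4, h5⟩ | ⟨L, D, h1, h2, h3, h4, h5⟩)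
    exacts [⟨L, D, h1, h2, h3, h4, Or.inl h5⟩, ⟨L, D, h1, h2, h3, h4, Or.inr h5⟩]

theorem dirichletGF_wordsEnding_add (h : ∀ D, IsLetter D → p D → ¬ q D) :
    dirichletGF (WordsEnding X fun D => p D ∨ q D) =
      dirichletGF (WordsEnding X p) + dirichletGF (WordsEnding X q) :=
  dirichletGF_add (fun _ _ => wordsEnding_or) fun _ hl => hl.not_wordsEnding h

theorem dirichletGF_wordsIn :
    dirichletGF (WordsIn X) = 1 + dirichletGF (WordsEnding X fun _ => True) := by
  rw [← dirichletGF_one]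
  exact dirichletGF_add (fun _ _ => wordsIn_iff) fun l h h' => h'.ne_one h

/-- The letters that are not constant. -/
def IsMixed (D : List ℕ) : Prop := ∀ b, ¬ Const b D

/-- A nonconstant letter may follow every reduced word, so appending it is a free operation, and
uniqueness of words makes the products distinct. -/
theorem dirichletGF_wordsEnding_isMixed :
    dirichletGF (WordsEnding X IsMixed) =
      dirichletGF (WordsIn X) * dirichletGF (fun D => IsLetter D ∧ X D ∧ IsMixed D) := by
  have red : ∀ L D, Reduced L → IsLetter D → IsMixed D → Reduced (L ++ [D]) := by
    intro L D hL hD hm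
    refine ⟨fun δ hδ => ?_, ?_⟩
    · rcases List.mem_append.1 hδ with h | h
      · exact hL.1 δ h
      · rwa [List.mem_singleton.1 h]
    · rw [List.isChain_append]
      refine ⟨hL.2, by simp, ?_⟩
      rintro x - y hy ⟨b, -, hb⟩
      simp only [List.head?_cons, Option.mem_def, Option.some.injEq] at hy
      exact hm b (hy ▸ hb)
  refine dirichletGF_mul (fun l hl => ⟨?_, ?_⟩) ?_
  · rintro ⟨L, D, h1, h2, h3, h4, h5⟩
    have hD := h2.1 D (by simp)
    have hL := h2.append_left
    exact ⟨word L, D, ⟨L, rfl, hL, h3⟩, ⟨hD, h4, h5⟩, hL.isComp, hD.isComp,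
      h1 ▸ (word_snoc (fun δ hδ => (hL.1 δ hδ).isComp) hD.isComp).symm⟩
  · rintro ⟨a, D, ⟨L, rfl, hL, hX⟩, ⟨hD, h4, h5⟩, -, -, h⟩
    exact ⟨L, D, h ▸ word_snoc (fun δ hδ => (hL.1 δ hδ).isComp) hD.isComp, red L D hL hD h5, hX,
      h4, h5⟩
  · rintro a D a' D' ⟨L, rfl, hL, -⟩ ⟨hD, -, h5⟩ ⟨L', rfl, hL', -⟩ ⟨hD', -, h5'⟩ - - - - h
    rw [← word_snoc (fun δ hδ => (hL.1 δ hδ).isComp) hD.isComp,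
      ← word_snoc (fun δ hδ => (hL'.1 δ hδ).isComp) hD'.isComp] at h
    obtain ⟨rfl, h6⟩ := List.append_inj' ((red L D hL hD h5).unique (red L' D' hL' hD' h5') h) rfl
    exact ⟨rfl, List.singleton_inj.1 h6⟩

/-- Splitting off a constant last letter of a given kind. -/
theorem dirichletGF_wordsIn_eq_mul (hX : ∀ D b, IsComp D → Const b D → X D) (b : Prop) :
    dirichletGF (WordsIn X) =
      (1 + dirichletGF (WordsEnding X fun D => ¬ Const b D)) *
        (ArithmeticFunction.zeta : ArithmeticFunction ℚ) := by
  have h1 : dirichletGF (fun α => α = [1] ∨ WordsEnding X (fun D => ¬ Const b D) α) =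
      1 + dirichletGF (WordsEnding X fun D => ¬ Const b D) := by
    rw [← dirichletGF_one]
    exact dirichletGF_add (fun _ _ => Iff.rfl) fun l h h' => h'.ne_one h
  have key : ∀ α, (α = [1] ∨ WordsEnding X (fun D => ¬ Const b D) α) ↔
      ∃ L, word L = α ∧ Reduced L ∧ (∀ δ ∈ L, X δ) ∧ ∀ L₀ D, L = L₀ ++ [D] → ¬ Const b D := by
    intro α
    constructor
    · rintro (rfl | ⟨L, D, h1, h2, h3, h4, h5⟩)
      · exact ⟨[], rfl, ⟨by simp, by simp⟩, by simp, by simp⟩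
      · refine ⟨L ++ [D], h1, h2, fun δ hδ => ?_, fun L₀ D' h => ?_⟩
        · rcases List.mem_append.1 hδ with h | h
          · exact h3 δ h
          · rwa [List.mem_singleton.1 h]
        · rwa [← List.singleton_inj.1 (List.append_inj' h rfl).2]
    · rintro ⟨L, h1, h2, h3, h4⟩
      rcases List.eq_nil_or_concat L with rfl | ⟨L, D, rfl⟩
      · exact Or.inl h1.symm
      · rw [List.concat_eq_append] at h1 h2 h3 h4
        exact Or.inr ⟨L, D, h1, h2, fun δ hδ => h3 δ (by simp [hδ]), h3 D (by simp),
          h4 L D rfl⟩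
  have red : ∀ L D, Reduced L → (∀ L₀ D, L = L₀ ++ [D] → ¬ Const b D) → IsLetter D →
      Const b D → Reduced (L ++ [D]) := by
    intro L D hL hlast hD hb
    refine ⟨fun δ hδ => ?_, ?_⟩
    · rcases List.mem_append.1 hδ with h | h
      · exact hL.1 δ h
      · rwa [List.mem_singleton.1 h]
    · rw [List.isChain_append]
      refine ⟨hL.2, by simp, ?_⟩
      rintro x hx y hy ⟨c, hc, hc'⟩
      simp only [List.head?_cons, Option.mem_def, Option.some.injEq] at hy
      subst hy
      obtain ⟨L₀, rfl⟩ := List.mem_getLast?_eq_getLast hx |> fun ⟨_, h⟩ =>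
        (⟨L.dropLast, by rw [h]; exact (List.dropLast_append_getLast _).symm⟩ :
          ∃ L₀, L = L₀ ++ [x])
      exact hlast L₀ x rfl (hc.congr (hc'.iff hb hD.one_lt_sum))
  rw [← h1, ← dirichletGF_const b]
  refine dirichletGF_mul (fun l hl => ⟨?_, ?_⟩) ?_
  · rintro ⟨L, h1, h2, h3⟩
    by_cases hlast : ∃ L₀ D, L = L₀ ++ [D] ∧ Const b D
    · obtain ⟨L, D, rfl, hb⟩ := hlast
      have hD := h2.1 D (by simp)
      have hL := h2.append_left
      refine ⟨word L, D, (key _).2 ⟨L, rfl, hL, fun δ hδ => h3 δ (by simp [hδ]), ?_⟩, hb,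
        hL.isComp, hD.isComp,
        h1 ▸ (word_snoc (fun δ hδ => (hL.1 δ hδ).isComp) hD.isComp).symm⟩
      rintro L₀ B rfl hB
      have := h2.2
      rw [List.append_assoc, List.singleton_append, List.isChain_append_cons_cons] at this
      exact this.2.1 ⟨b, hB, hb⟩
    · push Not at hlast
      refine ⟨l, [1], (key _).2 ⟨L, h1, h2, h3, hlast⟩, fun s h0 h1 => ?_, hl, .one,
        compose_one l hl.2⟩
      simp at h1
      omega
  · rintro ⟨a, D, ha, hb, hca, hcD, h⟩
    obtain ⟨L, rfl, h2, h3, h4⟩ := (key a).1 ha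
    by_cases hD : D = [1]
    · subst hD
      rw [compose_one _ hca.2] at h
      exact ⟨L, h, h2, h3⟩
    · refine ⟨L ++ [D], h ▸ word_snoc (fun δ hδ => (h2.1 δ hδ).isComp) hcD,
        red L D h2 h4 ⟨hcD, hD, hb.hasOnlyTrivialFactorisations⟩ hb, fun δ hδ => ?_⟩
      rcases List.mem_append.1 hδ with h | h
      · exact h3 δ h
      · rw [List.mem_singleton.1 h]
        exact hX D b hcD hb
  -- The factor `D = (1)` stands for the absence of a final constant letter of this kind.
  · have norm : ∀ L D, Reduced L → (∀ L₀ D, L = L₀ ++ [D] → ¬ Const b D) → IsComp D →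
        Const b D → ∃ M, Reduced M ∧ word M = compose (word L) D ∧
          ((D = [1] ∧ M = L) ∨ (D ≠ [1] ∧ M = L ++ [D])) := by
      intro L D hL hlast hD hb
      by_cases h1 : D = [1]
      · exact ⟨L, hL, by rw [h1, compose_one _ hL.isComp.2], Or.inl ⟨h1, rfl⟩⟩
      · exact ⟨L ++ [D], red L D hL hlast ⟨hD, h1, hb.hasOnlyTrivialFactorisations⟩ hb,
          word_snoc (fun δ hδ => (hL.1 δ hδ).isComp) hD, Or.inr ⟨h1, rfl⟩⟩
    intro a D a' D' ha hb ha' hb' _ hcD _ hcD' h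
    obtain ⟨L, rfl, h2, -, h4⟩ := (key a).1 ha
    obtain ⟨L', rfl, h2', -, h4'⟩ := (key a').1 ha'
    obtain ⟨M, hM, hw, hcase⟩ := norm L D h2 h4 hcD hb
    obtain ⟨M', hM', hw', hcase'⟩ := norm L' D' h2' h4' hcD' hb'
    obtain rfl := hM.unique hM' (hw.trans (h.trans hw'.symm))
    rcases hcase with ⟨e, e1⟩ | ⟨e, e1⟩ <;> rcases hcase' with ⟨e', e1'⟩ | ⟨e', e1'⟩
    · exact ⟨by rw [← e1, ← e1'], e.trans e'.symm⟩
    · exact (h4 L' D' (e1.symm.trans e1') hb').elim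
    · exact (h4' L D (e1'.symm.trans e1) hb).elim
    · obtain ⟨rfl, h6⟩ := List.append_inj' (e1.symm.trans e1') rfl
      exact ⟨rfl, List.singleton_inj.1 h6⟩

/-- Inverting zeta in `dirichletGF_wordsIn_eq_mul`, the words ending in a constant letter of either
kind have the series `C - C μ`, and those ending in a nonconstant letter have `C M`. Adding the
empty word, `C = 1 + 2 (C - C μ) + C M`. -/
theorem dirichletGF_wordsIn_mul (hX : ∀ D b, IsComp D → Const b D → X D) :
    dirichletGF (WordsIn X) * (2 * (ArithmeticFunction.moebius : ArithmeticFunction ℚ) - 1 -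
      dirichletGF (fun D => IsLetter D ∧ X D ∧ IsMixed D)) = 1 := by
  set C := dirichletGF (WordsIn X) with hC
  have hb : ∀ b, C * (ArithmeticFunction.moebius : ArithmeticFunction ℚ) =
      1 + dirichletGF (WordsEnding X fun D => ¬ Const b D) := fun b => by
    rw [hC, dirichletGF_wordsIn_eq_mul hX b, mul_assoc, ArithmeticFunction.coe_zeta_mul_coe_moebius,
      mul_one]
  have hs : ∀ b, C = C * (ArithmeticFunction.moebius : ArithmeticFunction ℚ) +
      dirichletGF (WordsEnding X (Const b)) := fun b => by
    rw [hb, add_assoc, ← dirichletGF_wordsEnding_add fun D _ h h' => h h', hC, dirichletGF_wordsIn]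
    congr 2
    funext α
    congr 1
    funext D
    exact (propext (iff_true_intro (em' _))).symm
  have ht : C = 1 + (dirichletGF (WordsEnding X (Const True)) +
      (dirichletGF (WordsEnding X (Const False)) + dirichletGF (WordsEnding X IsMixed))) := by
    rw [← dirichletGF_wordsEnding_add, ← dirichletGF_wordsEnding_add, hC, dirichletGF_wordsIn]
    · congr 2
      funext α
      congr 1
      funext D
      refine (propext (iff_true_intro ?_)).symm
      by_contra h
      push Not at h
      refine h.2.2 fun b hb => ?_
      by_cases hb' : b
      · rw [eq_true hb'] at hb
        exact h.1 hb
      · rw [eq_false hb'] at hb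
        exact h.2.1 hb
    · rintro D hD h (h' | h')
      · exact (h.iff h' hD.one_lt_sum).1 trivial
      · exact h' _ h
    · exact fun D _ h h' => h' _ h
  rw [dirichletGF_wordsEnding_isMixed, ← hC] at ht
  linear_combination ht - hs True - hs False

end Counting

end RibbonCount

namespace RibbonCount

/-! ### Comparison of all, symmetric and lexicographic minimal letters -/

theorem isLexMin_of_reverse_eq {l : List ℕ} (h : l.reverse = l) : IsLexMin l := by
  rw [IsLexMin, h]

theorem wordsIn_true_iff {l : List ℕ} (hl : IsComp l) : True ↔ WordsIn (fun _ => True) l := by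
  obtain ⟨L, hL, h⟩ := exists_reduced hl
  exact iff_of_true trivial ⟨L, h, hL, fun _ _ => trivial⟩

/-- Reversal acts letter by letter without changing the order of the letters, so uniqueness of
reduced words makes each letter of a symmetric composition symmetric. -/
theorem isSymmetric_iff {l : List ℕ} (hl : IsComp l) : IsSymmetric l ↔ WordsIn IsSymmetric l := by
  obtain ⟨L, hL, rfl⟩ := exists_reduced hl
  have hP : ReducedPairs (L.map fun δ => (δ, δ)) := by
    refine ⟨fun q hq => ?_, ?_⟩
    · obtain ⟨δ, hδ, rfl⟩ := List.mem_map.1 hq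
      exact .self (hL.1 δ hδ).isComp
    · rw [List.map_map]
      simpa [Function.comp_def] using hL
  have hrev : word (L.map List.reverse) = (word L).reverse := by
    have := sndWord_reverse hP.1
    simpa [sndWord, Function.comp_def] using this
  have hQ : ReducedPairs (L.map fun δ => (δ, δ.reverse)) := by
    refine ⟨fun q hq => ?_, ?_⟩
    · obtain ⟨δ, hδ, rfl⟩ := List.mem_map.1 hq
      exact (RevPair.self (hL.1 δ hδ).isComp).reverse_snd
    · rw [List.map_map]
      simpa [Function.comp_def] using hL
  have hred : Reduced (L.map List.reverse) := by
    simpa [Function.comp_def] using hQ.snd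
  constructor
  · intro h
    have h1 : L = L.map List.reverse := hL.unique hred (h.trans hrev.symm)
    exact ⟨L, rfl, hL, fun δ hδ => (List.map_eq_map_iff.1 ((List.map_id L).trans h1)) δ hδ⟩
  · rintro ⟨L', h1, h2, h3⟩
    rw [h2.unique hL h1] at h3
    rw [IsSymmetric, ← hrev]
    congr 1
    exact (List.map_id L).symm.trans (List.map_congr_left h3)

/-- Of a letter and its reversal at least one is minimal, and both are only if they coincide.
Counting one of the two copies through reversal turns this into a union and an intersection. -/
theorem dirichletGF_isLexMin : 2 * dirichletGF (fun D => IsLetter D ∧ IsLexMin D ∧ IsMixed D) =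
    dirichletGF (fun D => IsLetter D ∧ True ∧ IsMixed D) +
      dirichletGF (fun D => IsLetter D ∧ IsSymmetric D ∧ IsMixed D) := by
  have hmix : ∀ {D}, IsComp D → IsMixed D → IsMixed D.reverse := fun {D} hc h b hb =>
    h b (by simpa using hb.reverse hc.reverse)
  rw [two_mul]
  nth_rw 2 [← dirichletGF_reverse]
  rw [← dirichletGF_or]
  congr 1 <;> refine dirichletGF_congr fun D hD => ⟨?_, ?_⟩
  · rintro (⟨h1, -, h2⟩ | ⟨h1, -, h2⟩)
    · exact ⟨h1, trivial, h2⟩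
    · exact ⟨by simpa using h1.reverse, trivial, by simpa using hmix hD.reverse h2⟩
  · rintro ⟨h1, -, h2⟩
    rcases le_total D D.reverse with h | h
    · exact Or.inl ⟨h1, h, h2⟩
    · exact Or.inr ⟨h1.reverse, by rwa [IsLexMin, List.reverse_reverse], hmix hD h2⟩
  · rintro ⟨⟨h1, h2, h3⟩, -, h4, -⟩
    rw [IsLexMin, List.reverse_reverse] at h4
    exact ⟨h1, le_antisymm h2 h4, h3⟩
  · rintro ⟨h1, h2, h3⟩
    have h4 : D.reverse = D := h2.symm
    rw [h4]
    exact ⟨⟨h1, isLexMin_of_reverse_eq h4, h3⟩, h1, isLexMin_of_reverse_eq h4, h3⟩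

/-- The generating functions of all, of the symmetric and of the normalised compositions have
inverses `u`, `v` and `r` with `2 r = u + v`. -/
theorem exists_inverses : ∃ u v r : ArithmeticFunction ℚ,
    dirichletGF (fun _ => True) * u = 1 ∧ dirichletGF IsSymmetric * v = 1 ∧
      dirichletGF IsNormalised * r = 1 ∧ 2 * r = u + v := by
  have hC := dirichletGF_wordsIn_mul (X := fun _ => True) fun _ _ _ _ => trivial
  have hS := dirichletGF_wordsIn_mul (X := IsSymmetric) fun D b hD h => (h.reverse_eq hD).symm
  have hR := dirichletGF_wordsIn_mul (X := IsLexMin) fun D b hD h =>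
    isLexMin_of_reverse_eq (h.reverse_eq hD)
  rw [← dirichletGF_congr fun l hl => wordsIn_true_iff hl] at hC
  rw [← dirichletGF_congr fun l hl => isSymmetric_iff hl] at hS
  rw [← dirichletGF_congr (P := IsNormalised) (Q := WordsIn IsLexMin) fun l _ => isNormalised_iff] at hR
  exact ⟨_, _, _, hC, hS, hR, by linear_combination -dirichletGF_isLexMin⟩

/-- If `u`, `v`, `r` are the inverses of `C`, `S`, `R`, then `(C + S) u v = u + v = 2 r`, so `u v R
/ 2` is an inverse. -/
theorem isUnit_add : IsUnit (dirichletGF (fun _ => True) + dirichletGF IsSymmetric) := by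
  obtain ⟨u, v, r, hC, hS, hR, h⟩ := exists_inverses
  refine .of_mul_eq_one (u * v * dirichletGF IsNormalised * algebraMap ℚ _ (1 / 2)) ?_
  have h3 : (2 : ArithmeticFunction ℚ) * algebraMap ℚ _ (1 / 2) = 1 := by
    rw [← map_ofNat (algebraMap ℚ (ArithmeticFunction ℚ)) 2, ← _root_.map_mul]
    norm_num
  set C := dirichletGF (fun _ => True)
  set S := dirichletGF IsSymmetric
  set R := dirichletGF IsNormalised
  set t := algebraMap ℚ (ArithmeticFunction ℚ) (1 / 2)
  have h4 : (C + S) * (u * v) = 2 * r := by linear_combination v * hC + u * hS - h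
  linear_combination R * t * h4 + 2 * t * hR + h3

theorem dirichletGF_isNormalised : dirichletGF IsNormalised =
    ((2 : ℚ) • dirichletGF (fun _ => True)) * dirichletGF IsSymmetric *
      Ring.inverse (dirichletGF (fun _ => True) + dirichletGF IsSymmetric) := by
  obtain ⟨u, v, r, hC, hS, hR, h⟩ := exists_inverses
  have hi := Ring.mul_inverse_cancel _ isUnit_add
  set C := dirichletGF (fun _ => True)
  set S := dirichletGF IsSymmetric
  set R := dirichletGF IsNormalised
  have h1 : (2 : ℚ) • C = 2 * C := by rw [two_smul, two_mul]
  have h2 : R * (C + S) = 2 * C * S := by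
    linear_combination -R * C * S * h + 2 * C * S * hR - R * C * hS - R * S * hC
  rw [h1, ← h2, mul_assoc, hi, mul_one]

/-! ### The numbers of all and of symmetric compositions -/

theorem dirichletGF_true : dirichletGF (fun _ => True) = powPred := by
  ext n
  show (if n = 0 then (0 : ℚ) else (numComps (fun _ => True) n : ℚ)) =
    if n = 0 then 0 else 2 ^ (n - 1)
  congr 1
  rw [numComps, Nat.card_congr (Equiv.subtypeUnivEquiv fun _ => trivial), Nat.card_eq_fintype_card,
    composition_card]
  simp

/-- A symmetric composition is given by an arbitrary set of cuts between `1` and `n / 2`; the others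
are the mirror images, and for even `n` the midpoint is its own. -/
theorem card_isSymmetric (n : ℕ) (hn : n ≠ 0) : (comps IsSymmetric n).card = 2 ^ (n / 2) := by
  classical
  have h1 : 2 ^ (n / 2) = (Finset.Icc 1 (n / 2)).powerset.card := by
    rw [Finset.card_powerset, Nat.card_Icc, Nat.add_sub_cancel]
  have hsym : ∀ {l}, l ∈ comps IsSymmetric n → ∀ s ≤ n, (s ∈ cuts l ↔ n - s ∈ cuts l) := by
    intro l hl s hs
    obtain ⟨h2, h3, h4⟩ := mem_comps.1 hl
    have := mem_cuts_reverse (l := l) (h4.symm ▸ hs)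
    rwa [← h2, h4] at this
  rw [h1]
  refine Finset.card_bij (fun l _ => {s ∈ Finset.Icc 1 (n / 2) | s ∈ cuts l}) ?_ ?_ ?_
  · exact fun l _ => Finset.mem_powerset.2 (Finset.filter_subset _ _)
  · intro l hl l' hl' h
    obtain ⟨-, h3, h4⟩ := mem_comps.1 hl
    obtain ⟨-, h3', h4'⟩ := mem_comps.1 hl'
    have key : ∀ s, 0 < s → s ≤ n / 2 → (s ∈ cuts l ↔ s ∈ cuts l') := fun s h0 hs => by
      have := Finset.ext_iff.1 h s
      simp only [Finset.mem_filter, Finset.mem_Icc] at this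
      simpa [hs, show 1 ≤ s from h0] using this
    refine eq_of_cuts h3.2 h3'.2 (h4.trans h4'.symm) fun s h0 hs => ?_
    rw [h4] at hs
    rcases le_or_gt s (n / 2) with h | h
    · exact key s h0 h
    · rw [hsym hl s hs.le, hsym hl' s hs.le]
      exact key _ (by omega) (by omega)
  · intro U hU
    rw [Finset.mem_powerset] at hU
    obtain ⟨l, h2, h3, h4⟩ := exists_cuts n {s | s ∈ U ∨ n - s ∈ U}
    have hmem : ∀ s, 0 < s → s < n → (s ∈ cuts l ↔ s ∈ U ∨ n - s ∈ U) := h4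
    have hl : IsComp l := .of_sum_pos h2 (by omega)
    refine ⟨l, mem_comps.2 ⟨?_, hl, h3⟩, ?_⟩
    · refine eq_of_cuts h2 hl.reverse.2 (List.sum_reverse l).symm fun s h0 hs => ?_
      rw [mem_cuts_reverse hs.le]
      rw [h3] at hs ⊢
      rw [hmem s h0 hs, hmem _ (by omega) (by omega), Nat.sub_sub_self hs.le, or_comm]
    · ext s
      simp only [Finset.mem_filter, Finset.mem_Icc]
      constructor
      · rintro ⟨⟨h5, h6⟩, h7⟩
        rcases Nat.lt_or_ge s n with h | h
        · rcases (hmem s h5 h).1 h7 with h' | h'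
          · exact h'
          · have := Finset.mem_Icc.1 (hU h')
            rwa [show s = n - s by omega]
        · omega
      · intro h
        have := Finset.mem_Icc.1 (hU h)
        exact ⟨this, (hmem s (by omega) (by omega)).2 (Or.inl h)⟩

theorem dirichletGF_isSymmetric : dirichletGF IsSymmetric = powHalf := by
  ext n
  rw [dirichletGF_apply]
  show _ = if n = 0 then (0 : ℚ) else 2 ^ (n / 2)
  split_ifs with hn
  · simp [hn, comps_zero]
  · rw [card_isSymmetric n hn]
    norm_num

end RibbonCount

namespace RibbonCount

open PowerSeries

/-! ### Words with prescribed ascents and descents -/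

section Words

variable {N : ℕ} {A : Type*} [CommRing A]

/-- The word ascends weakly at the positions in `S` and descends strictly at the others. -/
def Fits {α : Type*} [LinearOrder α] {n : ℕ} (S : Set ℕ) (w : Fin n → α) : Prop :=
  ∀ i j : Fin n, (j : ℕ) = i + 1 → ((j : ℕ) ∈ S → w i ≤ w j) ∧ ((j : ℕ) ∉ S → w j < w i)

theorem Fits.congr {α : Type*} [LinearOrder α] {n : ℕ} {S T : Set ℕ} {w : Fin n → α}
    (h : ∀ s, 0 < s → s < n → (s ∈ S ↔ s ∈ T)) (hw : Fits S w) : Fits T w := fun i j hij => by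
  rw [← h j (by omega) j.2]
  exact hw i j hij

open Classical in
/-- The sum of the weights of the words of length `n` which fit `S`. -/
noncomputable def ribbonSum (a : Fin N → A) (n : ℕ) (S : Set ℕ) : A :=
  ∑ w : Fin n → Fin N with Fits S w, ∏ i, a (w i)

theorem ribbonSum_congr {n : ℕ} {S T : Set ℕ} (a : Fin N → A)
    (h : ∀ s, 0 < s → s < n → (s ∈ S ↔ s ∈ T)) : ribbonSum a n S = ribbonSum a n T := by
  classical
  rw [ribbonSum, ribbonSum]
  refine Finset.sum_congr (Finset.filter_congr fun w _ => ⟨Fits.congr h, Fits.congr ?_⟩) fun _ _ => rfl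
  exact fun s h0 hs => (h s h0 hs).symm

theorem fits_empty {α : Type*} [LinearOrder α] {n : ℕ} {w : Fin n → α} :
    Fits ∅ w ↔ StrictAnti w := by
  constructor
  · intro h
    have key : ∀ k, ∀ i j : Fin n, (j : ℕ) = i + k + 1 → w j < w i := by
      intro k
      induction k with
      | zero => exact fun i j hij => (h i j hij).2 (Set.notMem_empty _)
      | succ k ih =>
        intro i j hij
        have hj := j.2
        have h1 := ih i ⟨i + k + 1, by omega⟩ rfl
        exact ((h ⟨i + k + 1, by omega⟩ j hij).2 (Set.notMem_empty _)).trans h1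
    intro i j hij
    rw [Fin.lt_def] at hij
    exact key (j - i - 1) i j (by omega)
  · exact fun h i j hij => ⟨fun h' => h'.elim, fun _ => h (Fin.lt_def.2 (by omega))⟩

/-- A strictly decreasing word is determined by its set of letters, so without cuts the sum is an
elementary symmetric polynomial. -/
theorem ribbonSum_empty (a : Fin N → A) (n : ℕ) :
    ribbonSum a n ∅ = ∑ t ∈ Finset.powersetCard n Finset.univ, ∏ i ∈ t, a i := by
  classical
  rw [ribbonSum]
  refine Finset.sum_bij (fun w _ => Finset.univ.image w) ?_ ?_ ?_ ?_
  · intro w hw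
    rw [Finset.mem_filter, fits_empty] at hw
    rw [Finset.mem_powersetCard, Finset.card_image_of_injective _ hw.2.injective, Finset.card_fin]
    exact ⟨Finset.subset_univ _, rfl⟩
  · intro w hw w' hw' h
    rw [Finset.mem_filter, fits_empty] at hw hw'
    refine (hw.2.range_inj hw'.2).1 ?_
    have := congrArg (fun s : Finset (Fin N) => (s : Set (Fin N))) h
    simpa using this
  · intro t ht
    rw [Finset.mem_powersetCard] at ht
    refine ⟨fun i => t.orderEmbOfFin ht.2 i.rev, ?_, ?_⟩
    · rw [Finset.mem_filter, fits_empty]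
      exact ⟨Finset.mem_univ _, fun i j hij => (t.orderEmbOfFin ht.2).strictMono (Fin.rev_lt_rev.2 hij)⟩
    · apply Finset.coe_injective
      rw [Finset.coe_image, Finset.coe_univ, Set.image_univ]
      exact (Fin.revPerm.surjective.range_comp _).trans (t.range_orderEmbOfFin ht.2)
  · intro w hw
    rw [Finset.mem_filter, fits_empty] at hw
    rw [Finset.prod_image fun i _ j _ h => hw.2.injective h]

/-- Cutting words at the last position where they may ascend. -/
theorem ribbonSum_add (a : Fin N → A) {r b : ℕ} (hr : 0 < r) (hb : 0 < b) {S : Set ℕ} (hS : r ∈ S)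
    (hmax : ∀ t ∈ S, t ≤ r) : ribbonSum a (r + b) S + ribbonSum a (r + b) (S \ {r}) =
      ribbonSum a r S * ribbonSum a b ∅ := by
  classical
  simp only [ribbonSum, Finset.sum_filter]
  rw [Finset.sum_mul_sum, ← Fintype.sum_prod_type', ← Finset.sum_add_distrib]
  symm
  refine Fintype.sum_equiv (Fin.appendEquiv r b) _ _ ?_
  rintro ⟨u, v⟩
  have hw : Fin.appendEquiv r b (u, v) = Fin.append u v := rfl
  rw [hw, Fin.prod_univ_add]
  simp only [Fin.append_left, Fin.append_right]
  set i₀ : Fin r := ⟨r - 1, by omega⟩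
  set j₀ : Fin b := ⟨0, hb⟩
  -- The condition on a word of length `r + b` splits into conditions on both pieces and one at the
  -- junction. The sets `S` and `S \ {r}` impose complementary conditions at the junction, so
  -- together they leave the pieces free.
  have split : ∀ T : Set ℕ, (∀ t, t < r → (t ∈ T ↔ t ∈ S)) → (∀ t ∈ T, t ≤ r) →
      (Fits T (Fin.append u v) ↔ (Fits S u ∧ Fits ∅ v) ∧
        ((r ∈ T → u i₀ ≤ v j₀) ∧ (r ∉ T → v j₀ < u i₀))) := by
    intro T hT hTmax
    constructor
    · refine fun h => ⟨⟨fun i j hij => ?_, fun i j hij => ⟨fun h => h.elim, fun _ => ?_⟩⟩, ?_⟩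
      · have := h (Fin.castAdd b i) (Fin.castAdd b j) hij
        simp only [Fin.append_left, Fin.val_castAdd] at this
        rwa [hT _ j.2] at this
      · have := (h (Fin.natAdd r i) (Fin.natAdd r j) (by simp only [Fin.val_natAdd]; omega)).2
          fun h' => by have := hTmax _ h'; simp only [Fin.val_natAdd] at this; omega
        simpa only [Fin.append_right] using this
      · have := h (Fin.castAdd b i₀) (Fin.natAdd r j₀)
          (by simp only [Fin.val_natAdd, Fin.val_castAdd, i₀, j₀]; omega)
        simpa only [Fin.append_left, Fin.append_right, Fin.val_natAdd, j₀, add_zero] using this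
    · rintro ⟨⟨h1, h2⟩, h3⟩ i j hij
      induction i using Fin.addCases with
      | left i =>
        induction j using Fin.addCases with
        | left j =>
          simp only [Fin.append_left, Fin.val_castAdd] at hij ⊢
          rw [hT _ j.2]
          exact h1 i j hij
        | right j =>
          simp only [Fin.val_natAdd, Fin.val_castAdd] at hij
          have e1 : i = i₀ := Fin.ext (by simp only [i₀]; omega)
          have e2 : j = j₀ := Fin.ext (by simp only [j₀]; omega)
          subst e1 e2
          simpa only [Fin.append_left, Fin.append_right, Fin.val_natAdd, j₀, add_zero] using h3
      | right i =>
        induction j using Fin.addCases with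
        | left j =>
          simp only [Fin.val_natAdd, Fin.val_castAdd] at hij
          omega
        | right j =>
          simp only [Fin.append_right, Fin.val_natAdd] at hij ⊢
          have hj : r + (j : ℕ) ∉ T := fun h => by have := hTmax _ h; omega
          exact ⟨fun h => (hj h).elim, fun _ => (h2 i j (by omega)).2 (Set.notMem_empty _)⟩
  have e1 := split S (fun _ _ => Iff.rfl) hmax
  have e2 := split (S \ {r}) (fun t ht => by simp [ht.ne]) fun t ht => hmax t ht.1
  simp only [hS, true_implies, not_true_eq_false, false_implies, and_true] at e1
  simp only [Set.mem_sdiff, Set.mem_singleton_iff, not_true_eq_false, and_false, not_false_eq_true,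
    true_implies, false_implies, true_and] at e2
  rw [← not_lt] at e1
  rw [e1, e2]
  by_cases hu : Fits S u <;> by_cases hv : Fits ∅ v <;> by_cases h : v j₀ < u i₀ <;>
    simp only [hu, hv, h, and_true, and_false, if_true, if_false,
      not_true_eq_false, not_false_eq_true, mul_zero, zero_mul, add_zero, zero_add]

/-- The sign of the number of elements of `S` between `1` and `r`. -/
noncomputable def cutSign (S : Set ℕ) : ℕ → ℤ
  | 0 => 1
  | r + 1 => open Classical in if r + 1 ∈ S then - cutSign S r else cutSign S r

theorem cutSign_eq (S : Set ℕ) (r : ℕ) : cutSign S r = 1 ∨ cutSign S r = -1 := by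
  induction r with
  | zero => exact Or.inl rfl
  | succ r ih =>
    rw [cutSign]
    split_ifs <;> omega

/-- The relation `ribbonSum_add` is iterated over the cuts up to `r`. Each use replaces the sum with
the last cut by a product minus the sum without it, hence the alternating sign. -/
theorem cutSign_mul_ribbonSum (a : Fin N → A) (S : Set ℕ) {s : ℕ} : ∀ r < s,
    (cutSign S r : A) * ribbonSum a s (S ∩ Set.Icc 1 r) = ribbonSum a s ∅ +
      ∑ t ∈ Finset.Ico 1 (r + 1), (chi S t : A) * (cutSign S t : A) * ribbonSum a t S *
        ribbonSum a (s - t) ∅ := by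
  intro r
  induction r with
  | zero => intro _; simp [cutSign]
  | succ r ih =>
    intro hr
    rw [Finset.sum_Ico_succ_top (by omega), ← add_assoc, ← ih (by omega)]
    by_cases hS : r + 1 ∈ S
    · have h1 := ribbonSum_add a (r := r + 1) (b := s - (r + 1)) (by omega) (by omega)
        (S := S ∩ Set.Icc 1 (r + 1)) ⟨hS, by simp⟩ fun t ht => ht.2.2
      have h2 : (S ∩ Set.Icc 1 (r + 1)) \ {r + 1} = S ∩ Set.Icc 1 r := by
        ext t
        simp only [Set.mem_sdiff, Set.mem_inter_iff, Set.mem_Icc, Set.mem_singleton_iff]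
        constructor
        · rintro ⟨⟨h, h'⟩, h''⟩
          exact ⟨h, by omega⟩
        · rintro ⟨h, h'⟩
          exact ⟨⟨h, by omega⟩, by omega⟩
      rw [h2, show r + 1 + (s - (r + 1)) = s by omega,
        ribbonSum_congr a (n := r + 1) (T := S) fun t h0 ht => by
          simp only [Set.mem_inter_iff, Set.mem_Icc]; exact and_iff_left (by omega)] at h1
      have h3 : cutSign S (r + 1) = -cutSign S r := by rw [cutSign, if_pos hS]
      rw [chi_of_mem hS, h3]
      push_cast
      linear_combination (-(cutSign S r : A)) * h1
    · have h2 : S ∩ Set.Icc 1 (r + 1) = S ∩ Set.Icc 1 r := by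
        ext t
        simp only [Set.mem_inter_iff, Set.mem_Icc]
        refine and_congr_right fun h => ⟨fun h' => ⟨h'.1, ?_⟩, fun h' => by omega⟩
        have : t ≠ r + 1 := fun h'' => hS (h'' ▸ h)
        omega
      have h3 : cutSign S (r + 1) = cutSign S r := by rw [cutSign, if_neg hS]
      rw [chi_of_notMem hS, h2, h3]
      simp

/-- The sum over words is, up to sign, the total with the elementary symmetric weights. -/
theorem total_neg_ribbonSum (a : Fin N → A) (S : Set ℕ) {s : ℕ} (hs : 0 < s) :
    total s S (fun i => - ribbonSum a i ∅) = -(cutSign S (s - 1) : A) * ribbonSum a s S := by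
  induction s using Nat.strong_induction_on with
  | _ s ih =>
    have h1 := cutSign_mul_ribbonSum a S (s := s) (s - 1) (by omega)
    rw [show s - 1 + 1 = s by omega, ribbonSum_congr a (n := s) (T := S) fun t h0 ht => by
      simp only [Set.mem_inter_iff, Set.mem_Icc]; exact and_iff_left (by omega)] at h1
    rw [neg_mul, h1, total_eq_sum S _ hs, neg_add, ← Finset.sum_neg_distrib]
    congr 1
    refine Finset.sum_congr rfl fun t ht => ?_
    rw [Finset.mem_Ico] at ht
    rw [ih t ht.2 ht.1]
    obtain ⟨t, rfl⟩ := Nat.exists_eq_add_of_le' ht.1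
    by_cases hS : t + 1 ∈ S
    · rw [Nat.add_sub_cancel, cutSign, if_pos hS]
      push_cast
      ring
    · rw [chi_of_notMem hS]
      simp

end Words

end RibbonCount

namespace RibbonCount

/-! ### Equality of word generating functions as similarity of sets of cuts -/

/-- The generating function of the words of length `n` that fit `S`. -/
noncomputable def ribbonSeries (n : ℕ) (S : Set ℕ) : MvPowerSeries ℕ ℤ := fun d =>
  (Nat.card {w : Fin n → ℕ // Fits S w ∧ ∑ i, Finsupp.single (w i) 1 = d} : ℤ)

theorem map_ribbonSum {A B : Type*} [CommRing A] [CommRing B] (φ : A →+* B) {N : ℕ} (a : Fin N → A)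
    (n : ℕ) (S : Set ℕ) : φ (ribbonSum a n S) = ribbonSum (fun j => φ (a j)) n S := by
  simp only [ribbonSum, map_sum, map_prod]

/-- The generating polynomial of the words of length `n` in `N` letters that fit `S`. -/
noncomputable def ribbonPoly (N n : ℕ) (S : Set ℕ) : MvPolynomial ℕ ℤ :=
  ribbonSum (fun j : Fin N => MvPolynomial.X (j : ℕ)) n S

theorem coeff_ribbonPoly (N n : ℕ) (S : Set ℕ) (d : ℕ →₀ ℕ) :
    MvPolynomial.coeff d (ribbonPoly N n S) = (Nat.card {w : Fin n → Fin N //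
      Fits S w ∧ ∑ i, Finsupp.single (w i : ℕ) 1 = d} : ℤ) := by
  classical
  have h : ∀ w : Fin n → Fin N, ∏ i, (MvPolynomial.X (w i : ℕ) : MvPolynomial ℕ ℤ) =
      MvPolynomial.monomial (∑ i, Finsupp.single (w i : ℕ) 1) 1 := fun w => by
    rw [MvPolynomial.monomial_sum_one]
    rfl
  rw [ribbonPoly, ribbonSum, MvPolynomial.coeff_sum]
  simp only [h, MvPolynomial.coeff_monomial]
  rw [← Finset.sum_filter, Finset.filter_filter, Finset.sum_const, nsmul_eq_mul, mul_one,
    Nat.card_eq_fintype_card, Fintype.card_subtype]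

theorem mem_support_of_sum {n : ℕ} (w : Fin n → ℕ) (i : Fin n) :
    w i ∈ (∑ i, Finsupp.single (w i) 1 : ℕ →₀ ℕ).support := by
  rw [Finsupp.mem_support_iff, Finsupp.finsetSum_apply]
  refine (lt_of_lt_of_le ?_ (Finset.single_le_sum (fun _ _ => Nat.zero_le _)
    (Finset.mem_univ i))).ne'
  simp

theorem coeff_ribbonPoly_of_subset {N n : ℕ} {S : Set ℕ} {d : ℕ →₀ ℕ}
    (hd : d.support ⊆ Finset.range N) :
    MvPolynomial.coeff d (ribbonPoly N n S) = ribbonSeries n S d := by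
  rw [coeff_ribbonPoly, ribbonSeries, Nat.cast_inj]
  refine Nat.card_congr (Equiv.ofBijective (fun w => ⟨fun i => (w.1 i : ℕ), w.2⟩) ⟨?_, ?_⟩)
  · rintro ⟨w, hw⟩ ⟨w', hw'⟩ h
    exact Subtype.ext (funext fun i => Fin.ext (congrFun (congrArg Subtype.val h) i))
  · rintro ⟨w, hw, hw'⟩
    have h : ∀ i, w i < N := fun i => Finset.mem_range.1 (hd (hw' ▸ mem_support_of_sum w i))
    exact ⟨⟨fun i => ⟨w i, h i⟩, hw, hw'⟩, rfl⟩

theorem coeff_ribbonPoly_of_not_subset {N n : ℕ} {S : Set ℕ} {d : ℕ →₀ ℕ}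
    (hd : ¬ d.support ⊆ Finset.range N) : MvPolynomial.coeff d (ribbonPoly N n S) = 0 := by
  rw [coeff_ribbonPoly, Nat.cast_eq_zero, Nat.card_eq_zero]
  refine Or.inl ⟨fun w => hd fun k hk => ?_⟩
  rw [← w.2.2, Finsupp.mem_support_iff, Finsupp.finsetSum_apply] at hk
  obtain ⟨i, -, hi⟩ := Finset.exists_ne_zero_of_sum_ne_zero hk
  rw [Finsupp.single_apply_ne_zero] at hi
  rw [hi.1, Finset.mem_range]
  exact (w.1 i).2

theorem total_neg_ribbonSum_sign {N : ℕ} {A : Type*} [CommRing A] (a : Fin N → A) (S : Set ℕ)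
    {n : ℕ} (hn : 0 < n) : ∃ c : ℤ, (c = 1 ∨ c = -1) ∧
      total n S (fun i => - ribbonSum a i ∅) = c * ribbonSum a n S ∧
      ribbonSum a n S = c * total n S (fun i => - ribbonSum a i ∅) := by
  have h := total_neg_ribbonSum a S hn
  rcases cutSign_eq S (n - 1) with h' | h' <;> rw [h'] at h
  · exact ⟨-1, Or.inr rfl, by simpa using h, by rw [h]; simp⟩
  · exact ⟨1, Or.inl rfl, by simpa using h, by rw [h]; simp⟩

/-- Similar sets of cuts have the same generating function. -/
theorem Sim.ribbonSeries_eq {n : ℕ} {S T : Set ℕ} (h : Sim n S T) (hn : 0 < n) :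
    ribbonSeries n S = ribbonSeries n T := by
  funext d
  obtain ⟨N, hN⟩ : ∃ N, d.support ⊆ Finset.range N :=
    ⟨d.support.sup id + 1, fun k hk => Finset.mem_range.2 (Nat.lt_succ_of_le
      (Finset.le_sup (f := id) hk))⟩
  obtain ⟨c, hc, h1, h2⟩ := total_neg_ribbonSum_sign
    (fun j : Fin N => (MvPolynomial.X (j : ℕ) : MvPolynomial ℕ ℤ)) S hn
  obtain ⟨c', hc', h1', h2'⟩ := total_neg_ribbonSum_sign
    (fun j : Fin N => (MvPolynomial.X (j : ℕ) : MvPolynomial ℕ ℤ)) T hn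
  have key : ribbonPoly N n S = MvPolynomial.C (c * c') * ribbonPoly N n T := by
    rw [ribbonPoly, h2, h.total_eq, h1', ← mul_assoc, ribbonPoly]
    simp
  have h3 := congrArg (MvPolynomial.coeff d) key
  rw [MvPolynomial.coeff_C_mul, coeff_ribbonPoly_of_subset hN, coeff_ribbonPoly_of_subset hN] at h3
  -- The two coefficients agree up to a sign. They are counts, so with a negative sign both vanish.
  have p1 : 0 ≤ ribbonSeries n S d := Int.natCast_nonneg _
  have p2 : 0 ≤ ribbonSeries n T d := Int.natCast_nonneg _
  have hcc : c * c' = 1 ∨ c * c' = -1 := by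
    rcases hc with rfl | rfl <;> rcases hc' with rfl | rfl <;> simp
  rcases hcc with h4 | h4 <;> rw [h4] at h3 <;> omega

/-- Totals count chains, and the chain with a single step always exists. This excludes a relative
sign between the totals of two sets. -/
theorem total_one_pos (n : ℕ) (S : Set ℕ) (hn : 0 < n) : 0 < total n S (fun _ => (1 : ℤ)) := by
  induction n using Nat.strong_induction_on with
  | _ n ih =>
    rw [total_eq_sum S _ hn]
    have : 0 ≤ ∑ t ∈ Finset.Ico 1 n, ((chi S t : ℤ) : ℤ) * total t S (fun _ => (1 : ℤ)) * 1 := by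
      refine Finset.sum_nonneg fun t ht => ?_
      rw [Finset.mem_Ico] at ht
      rw [mul_one]
      refine mul_nonneg ?_ (ih t ht.2 ht.1).le
      rcases chi_eq_zero_or_one S t with h | h <;> simp [h]
    simp only [Int.cast_id] at *
    omega

/-- By the algebraic independence of the elementary symmetric polynomials, sets of cuts with the
same generating function are similar. -/
theorem Sim.of_ribbonSeries_eq {n : ℕ} {S T : Set ℕ} (hn : 0 < n)
    (h : ribbonSeries n S = ribbonSeries n T) : Sim n S T := by
  classical
  have h1 : ribbonPoly n n S = ribbonPoly n n T := by
    ext d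
    by_cases hd : d.support ⊆ Finset.range n
    · rw [coeff_ribbonPoly_of_subset hd, coeff_ribbonPoly_of_subset hd, h]
    · rw [coeff_ribbonPoly_of_not_subset hd, coeff_ribbonPoly_of_not_subset hd]
  set a : Fin n → MvPolynomial (Fin n) ℤ := MvPolynomial.X with ha
  have h2 : ribbonSum a n S = ribbonSum a n T := by
    have hmap : ∀ U, (MvPolynomial.rename (R := ℤ) (Fin.val (n := n))).toRingHom (ribbonSum a n U) =
        ribbonPoly n n U := fun U => by
      rw [map_ribbonSum, ribbonPoly]
      congr 1
      funext j
      exact MvPolynomial.rename_X _ _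
    refine MvPolynomial.rename_injective _ Fin.val_injective ?_
    exact (hmap S).trans (h1.trans (hmap T).symm)
  -- The variable of index `i - 1` stands for the `i`-th elementary symmetric polynomial. The
  -- injective map `φ` sends the weights `y` to `-eᵢ`, and `ψ` sends them to the independent weights
  -- in the definition of `Sim`. Steps longer than `n` do not occur.
  set y : ℕ → MvPolynomial (Fin n) ℤ := fun i =>
    if h : 0 < i ∧ i ≤ n then - MvPolynomial.X ⟨i - 1, by omega⟩ else 0 with hy
  set φ : MvPolynomial (Fin n) ℤ →ₐ[ℤ] MvPolynomial (Fin n) ℤ :=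
    (MvPolynomial.symmetricSubalgebra (Fin n) ℤ).val.comp
      (MvPolynomial.esymmAlgHom (Fin n) ℤ n) with hφ
  have hφi : Function.Injective φ :=
    Subtype.val_injective.comp (MvPolynomial.esymmAlgHom_fin_injective ℤ le_rfl)
  have hφX : ∀ i, 0 < i → i ≤ n → φ (y i) = - ribbonSum a i ∅ := fun i h0 hi => by
    simp only [hy]
    rw [dif_pos ⟨h0, hi⟩, map_neg, ribbonSum_empty]
    congr 1
    have : φ (MvPolynomial.X ⟨i - 1, by omega⟩) = MvPolynomial.esymm (Fin n) ℤ (i - 1 + 1) := by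
      rw [hφ, AlgHom.comp_apply, MvPolynomial.esymmAlgHom, MvPolynomial.aeval_X]
      rfl
    rw [this, MvPolynomial.esymm, show i - 1 + 1 = i by omega]
  have hφt : ∀ U, φ (total n U y) = total n U fun i => - ribbonSum a i ∅ := fun U =>
    (map_total φ.toRingHom n U y).trans (total_congr_weight hφX hn)
  set ψ : MvPolynomial (Fin n) ℤ →ₐ[ℤ] MvPolynomial ℕ ℤ :=
    MvPolynomial.aeval fun j => - MvPolynomial.X ((j : ℕ) + 1) with hψ
  have hψt : ∀ U, ψ (total n U y) = total n U MvPolynomial.X := fun U => by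
    refine (map_total ψ.toRingHom n U y).trans (total_congr_weight (fun i h0 hi => ?_) hn)
    simp only [hy]
    rw [dif_pos ⟨h0, hi⟩]
    have : ψ (- MvPolynomial.X ⟨i - 1, by omega⟩) = MvPolynomial.X i := by
      rw [map_neg, hψ, MvPolynomial.aeval_X, neg_neg]
      congr 1
      simp only
      omega
    exact this
  obtain ⟨c, hc, e1, -⟩ := total_neg_ribbonSum_sign a S hn
  obtain ⟨c', hc', -, e2⟩ := total_neg_ribbonSum_sign a T hn
  have h3 : total n S y = MvPolynomial.C (c * c') * total n T y := by
    refine hφi ?_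
    rw [_root_.map_mul, hφt, e1, h2, e2, ← hφt, ← mul_assoc, ← MvPolynomial.algebraMap_eq,
      AlgHom.commutes]
    simp
  have h4 := congrArg ψ h3
  rw [_root_.map_mul, hψt, hψt, ← MvPolynomial.algebraMap_eq, AlgHom.commutes] at h4
  have hcc : c * c' = 1 ∨ c * c' = -1 := by
    rcases hc with rfl | rfl <;> rcases hc' with rfl | rfl <;> simp
  rcases hcc with h5 | h5 <;> rw [h5] at h4
  · rw [map_one, one_mul] at h4
    exact h4
  · have h6 := congrArg (MvPolynomial.aeval fun _ => (1 : ℤ)).toRingHom h4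
    rw [_root_.map_mul, map_total, map_total] at h6
    have p1 := total_one_pos n S hn
    have p2 := total_one_pos n T hn
    simp at h6
    omega

end RibbonCount

namespace RibbonCount

/-! ### Ribbon Schur functions -/

section Ribbon

variable {lam mu : YoungDiagram} {i j : ℕ}

/-- The condition on row lengths says that `mu` is `lam` without its first row and column. In this
form the inner shape is determined by the outer one, and rows and columns play symmetric roles. -/
theorem isRibbon_iff : IsRibbon lam mu ↔
    (0, 0) ∈ lam ∧ ∀ i j, (i, j) ∈ mu ↔ (i + 1, j + 1) ∈ lam := by
  constructor
  · rintro ⟨-, h2, h3⟩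
    refine ⟨YoungDiagram.mem_iff_lt_colLen.2 (by omega), fun i j => ?_⟩
    by_cases hi : i + 1 < lam.colLen 0
    · rw [YoungDiagram.mem_iff_lt_rowLen, YoungDiagram.mem_iff_lt_rowLen, h3 i hi]
      omega
    · refine iff_of_false (fun h => ?_) fun h => ?_
      · have := YoungDiagram.mem_iff_lt_colLen.1 (mu.up_left_mem le_rfl (Nat.zero_le j) h)
        omega
      · exact hi (YoungDiagram.mem_iff_lt_colLen.1
          (lam.up_left_mem le_rfl (Nat.zero_le (j + 1)) h))
  · rintro ⟨h0, h⟩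
    refine ⟨fun p hp => ?_, ?_, fun i hi => ?_⟩
    · exact lam.up_left_mem (Nat.le_succ _) (Nat.le_succ _) ((h p.1 p.2).1 hp)
    · by_contra h'
      have h1 := YoungDiagram.mem_iff_lt_colLen.1 h0
      have h2 : (lam.colLen 0 - 1, 0) ∈ mu := YoungDiagram.mem_iff_lt_colLen.2 (by omega)
      rw [h] at h2
      have := YoungDiagram.mem_iff_lt_colLen.1 (lam.up_left_mem le_rfl (Nat.zero_le _) h2)
      omega
    · have h1 := YoungDiagram.mem_iff_lt_rowLen.1 (YoungDiagram.mem_iff_lt_colLen.2 hi)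
      have h2 : ∀ j, j < mu.rowLen i ↔ j + 1 < lam.rowLen (i + 1) := fun j => by
        rw [← YoungDiagram.mem_iff_lt_rowLen, ← YoungDiagram.mem_iff_lt_rowLen]
        exact h i j
      have h3 := h2 (mu.rowLen i)
      have h4 := h2 (lam.rowLen (i + 1) - 1)
      omega

theorem IsRibbon.mem_skewCells (h : IsRibbon lam mu) {i j : ℕ} :
    (i, j) ∈ skewCells lam mu ↔ (i, j) ∈ lam ∧ (i + 1, j + 1) ∉ lam := by
  rw [skewCells, Finset.mem_sdiff, YoungDiagram.mem_cells, YoungDiagram.mem_cells,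
    (isRibbon_iff.1 h).2]

/-- The position of a cell in a ribbon with `r` rows, counted from its lower left end. -/
def cellPos (r : ℕ) (p : ℕ × ℕ) : ℕ := p.2 + (r - 1 - p.1)

/-- The positions of the cells whose left neighbours belong to the ribbon. -/
def ribbonCuts (lam mu : YoungDiagram) : Set ℕ :=
  {s | ∃ i j, (i, j) ∈ skewCells lam mu ∧ (i, j + 1) ∈ skewCells lam mu ∧
    cellPos (lam.colLen 0) (i, j + 1) = s}

theorem lt_colLen_of_mem (h : (i, j) ∈ lam) : i < lam.colLen 0 :=
  YoungDiagram.mem_iff_lt_colLen.1 (lam.up_left_mem le_rfl (Nat.zero_le j) h)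

namespace IsRibbon

variable {p q : ℕ × ℕ}

theorem lt_colLen (h : IsRibbon lam mu) (hp : p ∈ skewCells lam mu) : p.1 < lam.colLen 0 :=
  lt_colLen_of_mem (h.mem_skewCells.1 hp).1

/-- Two cells with the same position in different rows would lie strictly to the lower right of one
another, which a ribbon excludes. -/
theorem cellPos_injOn (h : IsRibbon lam mu) :
    Set.InjOn (cellPos (lam.colLen 0)) (skewCells lam mu : Set (ℕ × ℕ)) := by
  have key : ∀ i j i' j', (i, j) ∈ skewCells lam mu → (i', j') ∈ skewCells lam mu →
      cellPos (lam.colLen 0) (i, j) = cellPos (lam.colLen 0) (i', j') → ¬ i < i' := by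
    intro i j i' j' hp hq he hlt
    have h1 := h.lt_colLen hp
    have h2 := h.lt_colLen hq
    simp only [cellPos] at he h1 h2
    exact (h.mem_skewCells.1 hp).2
      (lam.up_left_mem hlt (show j + 1 ≤ j' by omega) (h.mem_skewCells.1 hq).1)
  rintro ⟨i, j⟩ hp ⟨i', j'⟩ hq he
  have h1 := key i j i' j' hp hq he
  have h2 := key i' j' i j hq hp he.symm
  have h3 : i = i' := by omega
  subst h3
  simp only [cellPos] at he
  rw [show j = j' by omega]

/-- From every cell but the lower left one, a ribbon continues downwards or to the left. This makes
the positions an initial segment of the natural numbers. -/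
theorem pred_mem (h : IsRibbon lam mu) (hp : (i, j) ∈ skewCells lam mu)
    (h0 : 0 < cellPos (lam.colLen 0) (i, j)) :
    (0 < j ∧ (i, j - 1) ∈ skewCells lam mu) ∨ (i + 1, j) ∈ skewCells lam mu := by
  have hi := h.lt_colLen hp
  simp only [cellPos] at h0 hi
  obtain ⟨h1, h2⟩ := h.mem_skewCells.1 hp
  have h3 : (i + 1 + 1, j + 1) ∉ lam := fun h' => h2 (lam.up_left_mem (Nat.le_succ _) le_rfl h')
  rcases Nat.eq_zero_or_pos j with rfl | hj
  · exact Or.inr (h.mem_skewCells.2 ⟨YoungDiagram.mem_iff_lt_colLen.2 (by omega), h3⟩)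
  · by_cases h4 : (i + 1, j) ∈ lam
    · exact Or.inr (h.mem_skewCells.2 ⟨h4, h3⟩)
    · refine Or.inl ⟨hj, h.mem_skewCells.2 ⟨lam.up_left_mem le_rfl (Nat.sub_le j 1) h1, ?_⟩⟩
      rwa [Nat.sub_add_cancel hj]

theorem image_cellPos (h : IsRibbon lam mu) : (skewCells lam mu).image (cellPos (lam.colLen 0)) =
    Finset.range (skewCells lam mu).card := by
  set K := (skewCells lam mu).image (cellPos (lam.colLen 0)) with hK
  have hcard : K.card = (skewCells lam mu).card := Finset.card_image_of_injOn h.cellPos_injOn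
  have step : ∀ k, k + 1 ∈ K → k ∈ K := by
    intro k hk
    obtain ⟨⟨i, j⟩, hp, he⟩ := Finset.mem_image.1 hk
    have hi := h.lt_colLen hp
    rcases h.pred_mem hp (by omega) with ⟨hj, h'⟩ | h'
    · refine Finset.mem_image.2 ⟨_, h', ?_⟩
      simp only [cellPos] at he ⊢
      omega
    · refine Finset.mem_image.2 ⟨_, h', ?_⟩
      have := h.lt_colLen h'
      simp only [cellPos] at he this ⊢
      omega
  have lower : ∀ k l, l ≤ k → k ∈ K → l ∈ K := by
    intro k l hl
    induction k, hl using Nat.le_induction with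
    | base => exact id
    | succ k _ ih => exact fun hk => ih (step k hk)
  obtain ⟨m, hm⟩ := K.exists_notMem
  classical
  have hex : ∃ m, m ∉ K := ⟨m, hm⟩
  have hKm : K = Finset.range (Nat.find hex) := by
    ext k
    rw [Finset.mem_range]
    refine ⟨fun hk => ?_, fun hk => not_not.1 (Nat.find_min hex hk)⟩
    by_contra h'
    exact Nat.find_spec hex (lower k _ (not_lt.1 h') hk)
  rw [← hcard, hKm, Finset.card_range]

theorem adjacent (h : IsRibbon lam mu) (hp : p ∈ skewCells lam mu) (hq : q ∈ skewCells lam mu)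
    (hpq : cellPos (lam.colLen 0) q = cellPos (lam.colLen 0) p + 1) :
    (p.1 = q.1 ∧ p.2 < q.2 ∧ cellPos (lam.colLen 0) q ∈ ribbonCuts lam mu) ∨
      (p.2 = q.2 ∧ q.1 < p.1 ∧ cellPos (lam.colLen 0) q ∉ ribbonCuts lam mu) := by
  obtain ⟨i, j⟩ := q
  have hi := h.lt_colLen hq
  rcases h.pred_mem hq (by omega) with ⟨hj, h'⟩ | h'
  · have he : p = (i, j - 1) := h.cellPos_injOn hp h' (by simp only [cellPos] at hpq ⊢; omega)
    subst he
    refine Or.inl ⟨rfl, Nat.sub_lt hj one_pos, i, j - 1, h', ?_⟩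
    rw [Nat.sub_add_cancel hj]
    exact ⟨hq, rfl⟩
  · have hi' := h.lt_colLen h'
    have he : p = (i + 1, j) := h.cellPos_injOn hp h' (by simp only [cellPos] at hpq hi' ⊢; omega)
    subst he
    refine Or.inr ⟨rfl, Nat.lt_succ_self i, ?_⟩
    rintro ⟨i', j', h1, h2, h3⟩
    have e1 := h.cellPos_injOn h2 hq h3
    rw [Prod.mk.injEq] at e1
    have e2 := h.cellPos_injOn h1 hp (by
      simp only [cellPos] at h3 hpq ⊢; omega)
    rw [Prod.mk.injEq] at e2
    omega

theorem row_convex (h : IsRibbon lam mu) {j' k : ℕ} (hp : (i, j) ∈ skewCells lam mu)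
    (hq : (i, j') ∈ skewCells lam mu) (h1 : j ≤ k) (h2 : k ≤ j') : (i, k) ∈ skewCells lam mu :=
  h.mem_skewCells.2 ⟨lam.up_left_mem le_rfl h2 (h.mem_skewCells.1 hq).1, fun h' =>
    (h.mem_skewCells.1 hp).2 (lam.up_left_mem le_rfl (Nat.succ_le_succ h1) h')⟩

theorem col_convex (h : IsRibbon lam mu) {i' k : ℕ} (hp : (i, j) ∈ skewCells lam mu)
    (hq : (i', j) ∈ skewCells lam mu) (h1 : i ≤ k) (h2 : k ≤ i') : (k, j) ∈ skewCells lam mu :=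
  h.mem_skewCells.2 ⟨lam.up_left_mem h2 le_rfl (h.mem_skewCells.1 hq).1, fun h' =>
    (h.mem_skewCells.1 hp).2 (lam.up_left_mem (Nat.succ_le_succ h1) le_rfl h')⟩

/-- The cells of a ribbon are numbered by their positions. -/
theorem exists_equiv (h : IsRibbon lam mu) : ∃ e : skewCells lam mu ≃ Fin (skewCells lam mu).card,
    ∀ p, (e p : ℕ) = cellPos (lam.colLen 0) p.1 := by
  have h1 : ∀ p : skewCells lam mu,
      cellPos (lam.colLen 0) p.1 < (skewCells lam mu).card := fun p => by
    rw [← Finset.mem_range, ← h.image_cellPos]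
    exact Finset.mem_image_of_mem _ p.2
  refine ⟨Equiv.ofBijective (fun p => ⟨_, h1 p⟩) ⟨fun p q hpq => ?_, fun k => ?_⟩, fun p => rfl⟩
  · exact Subtype.ext (h.cellPos_injOn p.2 q.2 (Fin.ext_iff.1 hpq))
  · have := Finset.mem_range.2 k.2
    rw [← h.image_cellPos] at this
    obtain ⟨p, hp, he⟩ := Finset.mem_image.1 this
    exact ⟨⟨p, hp⟩, Fin.ext he⟩

/-- Going up in position moves right at a cut, where entries increase weakly, and up elsewhere,
where they decrease strictly. Rows and columns of a ribbon have no gaps, so these local conditions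
imply the global ones. -/
theorem isSemistandard_iff (h : IsRibbon lam mu)
    {e : skewCells lam mu ≃ Fin (skewCells lam mu).card}
    (he : ∀ p, (e p : ℕ) = cellPos (lam.colLen 0) p.1) (T : skewCells lam mu → ℕ) :
    IsSemistandard (skewCells lam mu) T ↔ Fits (ribbonCuts lam mu) (T ∘ e.symm) := by
  constructor
  · rintro ⟨hrow, hcol⟩ i j hij
    obtain ⟨p, rfl⟩ := e.surjective i
    obtain ⟨q, rfl⟩ := e.surjective j
    simp only [Function.comp_apply, Equiv.symm_apply_apply]
    rw [he, he] at hij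
    rw [he]
    rcases h.adjacent p.2 q.2 hij with ⟨h1, h2, h3⟩ | ⟨h1, h2, h3⟩
    · exact ⟨fun _ => hrow p q h1 h2, fun h' => (h' h3).elim⟩
    · exact ⟨fun h' => (h3 h').elim, fun _ => hcol q p h1.symm h2⟩
  · intro hF
    have step : ∀ p q : skewCells lam mu,
        cellPos (lam.colLen 0) q.1 = cellPos (lam.colLen 0) p.1 + 1 →
        (p.1.1 = q.1.1 → T p ≤ T q) ∧ (p.1.2 = q.1.2 → T q < T p) := by
      intro p q hpq
      have h0 := hF (e p) (e q) (by rw [he, he, hpq])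
      simp only [Function.comp_apply, Equiv.symm_apply_apply] at h0
      rw [he] at h0
      rcases h.adjacent p.2 q.2 hpq with ⟨h1, h2, h3⟩ | ⟨h1, h2, h3⟩
      · exact ⟨fun _ => h0.1 h3, fun h' => by omega⟩
      · exact ⟨fun h' => by omega, fun _ => h0.2 h3⟩
    have row : ∀ d i j (hp : (i, j) ∈ skewCells lam mu) (hq : (i, j + d) ∈ skewCells lam mu),
        T ⟨_, hp⟩ ≤ T ⟨_, hq⟩ := by
      intro d
      induction d with
      | zero => exact fun i j hp hq => le_rfl
      | succ d ih =>
        intro i j hp hq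
        have hm := h.row_convex hp hq (Nat.le_add_right j d) (by omega)
        exact (ih i j hp hm).trans ((step ⟨_, hm⟩ ⟨_, hq⟩ (by simp only [cellPos]; omega)).1 rfl)
    have col : ∀ d i j (hp : (i, j) ∈ skewCells lam mu) (hq : (i + d, j) ∈ skewCells lam mu),
        T ⟨_, hp⟩ + d ≤ T ⟨_, hq⟩ := by
      intro d
      induction d with
      | zero => exact fun i j hp hq => le_rfl
      | succ d ih =>
        intro i j hp hq
        have hm := h.col_convex hp hq (Nat.le_add_right i d) (by omega)
        have h1 := h.lt_colLen hq
        have h2 := (step ⟨_, hq⟩ ⟨_, hm⟩ (by simp only [cellPos] at h1 ⊢; omega)).2 rfl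
        have h3 := ih i j hp hm
        omega
    refine ⟨?_, ?_⟩
    · rintro ⟨⟨i, j⟩, hp⟩ ⟨⟨i', j'⟩, hq⟩ h1 h2
      dsimp only at h1 h2
      subst h1
      obtain ⟨d, rfl⟩ := Nat.exists_eq_add_of_le h2.le
      exact row d i j hp hq
    · rintro ⟨⟨i, j⟩, hp⟩ ⟨⟨i', j'⟩, hq⟩ h1 h2
      dsimp only at h1 h2
      subst h1
      obtain ⟨d, rfl⟩ := Nat.exists_eq_add_of_le h2.le
      have := col d i j hp hq
      omega

theorem skewSchur_eq (h : IsRibbon lam mu) :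
    skewSchur lam mu = ribbonSeries (skewCells lam mu).card (ribbonCuts lam mu) := by
  obtain ⟨e, he⟩ := h.exists_equiv
  funext d
  rw [skewSchur, ribbonSeries, Nat.cast_inj]
  refine Nat.card_congr (Equiv.subtypeEquiv (e.arrowCongr (Equiv.refl ℕ)) fun T => ?_)
  have h1 : content (skewCells lam mu) T =
      ∑ i, Finsupp.single ((e.arrowCongr (Equiv.refl ℕ)) T i) 1 := by
    rw [content]
    exact Fintype.sum_equiv e _ _ fun p => by simp [Equiv.arrowCongr]
  rw [h.isSemistandard_iff he, ← h1]
  rfl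

end IsRibbon

/-! ### Every set of cuts comes from a ribbon -/

/-- The number of elements of `S` between `1` and `s`: the column of the cell at position `s`. -/
noncomputable def cutCol (S : Set ℕ) : ℕ → ℕ
  | 0 => 0
  | s + 1 => open Classical in if s + 1 ∈ S then cutCol S s + 1 else cutCol S s

/-- The number of non-elements of `S` between `1` and `s`. -/
noncomputable def cutRow (S : Set ℕ) : ℕ → ℕ
  | 0 => 0
  | s + 1 => open Classical in if s + 1 ∈ S then cutRow S s else cutRow S s + 1

theorem cutCol_add_cutRow (S : Set ℕ) (s : ℕ) : cutCol S s + cutRow S s = s := by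
  induction s with
  | zero => rfl
  | succ s ih =>
    rw [cutCol, cutRow]
    split_ifs <;> omega

theorem cutCol_mono (S : Set ℕ) : Monotone (cutCol S) := by
  refine monotone_nat_of_le_succ fun s => ?_
  rw [cutCol]
  split_ifs <;> omega

theorem cutRow_mono (S : Set ℕ) : Monotone (cutRow S) := by
  refine monotone_nat_of_le_succ fun s => ?_
  rw [cutRow]
  split_ifs <;> omega

/-- The cell at position `s` of a ribbon with `n + 1` cells. -/
noncomputable def cutCell (S : Set ℕ) (n s : ℕ) : ℕ × ℕ := (cutRow S n - cutRow S s, cutCol S s)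

/-- The outer shape of the ribbon with `n + 1` cells and a set of cuts. -/
noncomputable def outerShape (S : Set ℕ) (n : ℕ) : YoungDiagram where
  cells := (Finset.range (n + 1)).biUnion fun s => Finset.Iic (cutCell S n s)
  isLowerSet := by
    intro p q hqp hp
    simp only [Finset.coe_biUnion, Set.mem_iUnion, Finset.coe_Iic, Set.mem_Iic] at hp ⊢
    obtain ⟨s, hs, h⟩ := hp
    exact ⟨s, hs, hqp.trans h⟩

theorem mem_outerShape {S : Set ℕ} {n : ℕ} : (i, j) ∈ outerShape S n ↔
    ∃ s ≤ n, i ≤ cutRow S n - cutRow S s ∧ j ≤ cutCol S s := by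
  rw [← YoungDiagram.mem_cells, outerShape, Finset.mem_biUnion]
  simp only [Finset.mem_range, Nat.lt_succ_iff, Finset.mem_Iic, cutCell, Prod.mk_le_mk]

/-- A Young diagram without its cells that have no lower right neighbour. -/
def innerShape (lam : YoungDiagram) : YoungDiagram where
  cells := {p ∈ lam.cells | (p.1 + 1, p.2 + 1) ∈ lam}
  isLowerSet := by
    rintro ⟨i, j⟩ ⟨i', j'⟩ h hp
    simp only [Finset.coe_filter, Set.mem_ofPred_eq, YoungDiagram.mem_cells] at hp ⊢
    exact ⟨lam.up_left_mem h.1 h.2 hp.1,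
      lam.up_left_mem (Nat.succ_le_succ h.1) (Nat.succ_le_succ h.2) hp.2⟩

theorem isRibbon_innerShape (h : (0, 0) ∈ lam) : IsRibbon lam (innerShape lam) := by
  refine isRibbon_iff.2 ⟨h, fun i j => ?_⟩
  rw [← YoungDiagram.mem_cells, innerShape, Finset.mem_filter, YoungDiagram.mem_cells]
  exact and_iff_right_of_imp fun h => lam.up_left_mem (Nat.le_succ _) (Nat.le_succ _) h

/-- The path starts in the lower left corner and moves right at each cut and up at each other
position. The outer shape is the lower set generated by its cells, and the inner shape consists of
the cells with a lower right neighbour in the outer shape. -/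
theorem exists_ribbon (S : Set ℕ) (n : ℕ) : ∃ lam mu, IsRibbon lam mu ∧
    (skewCells lam mu).card = n + 1 ∧ ∀ s, 0 < s → s < n + 1 → (s ∈ ribbonCuts lam mu ↔ s ∈ S) := by
  set lam := outerShape S n with hlam
  have h0 : (0, 0) ∈ lam := mem_outerShape.2 ⟨0, Nat.zero_le _, Nat.zero_le _, Nat.zero_le _⟩
  have h := isRibbon_innerShape h0
  have hR : lam.colLen 0 = cutRow S n + 1 := by
    have h1 : ∀ i, i < lam.colLen 0 ↔ i ≤ cutRow S n := fun i => by
      rw [← YoungDiagram.mem_iff_lt_colLen, mem_outerShape]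
      constructor
      · rintro ⟨s, -, h2, -⟩
        omega
      · exact fun h2 => ⟨0, Nat.zero_le _, by rw [cutRow]; omega, Nat.zero_le _⟩
    have h2 := h1 (cutRow S n)
    have h3 := h1 (cutRow S n + 1)
    omega
  have hpos : ∀ s ≤ n, cellPos (lam.colLen 0) (cutCell S n s) = s := fun s hs => by
    have h1 := cutRow_mono S hs
    have h2 := cutCol_add_cutRow S s
    rw [hR, cellPos, cutCell]
    dsimp only
    omega
  have hmem : ∀ s ≤ n, cutCell S n s ∈ skewCells lam (innerShape lam) := fun s hs => by
    rw [cutCell, h.mem_skewCells, mem_outerShape, mem_outerShape]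
    refine ⟨⟨s, hs, le_rfl, le_rfl⟩, ?_⟩
    rintro ⟨t, ht, h1, h2⟩
    rcases le_total s t with hst | hst
    · have := cutRow_mono S hst
      omega
    · have := cutCol_mono S hst
      omega
  -- The positions are an initial segment, so it suffices that `n` occurs and `n + 1` does not: a
  -- cell lies to the upper left of some cell of the path, so its column is at most `cutCol S n`,
  -- and it is at most `cutRow S n` rows above the bottom.
  have hcard : (skewCells lam (innerShape lam)).card = n + 1 := by
    have himg := h.image_cellPos
    refine le_antisymm ?_ ?_
    · by_contra hlt
      have : n + 1 ∈ (skewCells lam (innerShape lam)).image (cellPos (lam.colLen 0)) := by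
        rw [himg, Finset.mem_range]
        omega
      obtain ⟨⟨i, j⟩, hp, he⟩ := Finset.mem_image.1 this
      obtain ⟨t, ht, h1, h2⟩ := mem_outerShape.1 (h.mem_skewCells.1 hp).1
      have h3 := cutCol_mono S ht
      have h4 := cutCol_add_cutRow S n
      rw [cellPos, hR] at he
      dsimp only at he
      omega
    · have : n ∈ (skewCells lam (innerShape lam)).image (cellPos (lam.colLen 0)) :=
        Finset.mem_image.2 ⟨_, hmem n le_rfl, hpos n le_rfl⟩
      rw [himg, Finset.mem_range] at this
      omega
  refine ⟨lam, innerShape lam, h, hcard, fun s hs0 hs => ?_⟩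
  obtain ⟨t, rfl⟩ := Nat.exists_eq_add_of_le' hs0
  have ht : t + 1 ≤ n := by omega
  have hadj := h.adjacent (hmem t (by omega)) (hmem (t + 1) ht)
    (by rw [hpos _ ht, hpos t (by omega)])
  rw [hpos _ ht] at hadj
  simp only [cutCell, cutCol, cutRow] at hadj
  by_cases hS : t + 1 ∈ S
  · simp only [hS, if_true, lt_irrefl, false_and, and_false, or_false, true_and] at hadj
    exact iff_of_true hadj.2 hS
  · simp only [hS, if_false, lt_irrefl, false_and, and_false, false_or, true_and] at hadj
    exact iff_of_false hadj.2 hS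

end Ribbon

/-- Every ribbon Schur function of size `n` comes from a normalised composition of `n`. -/
theorem ribbonSchurFunctions_eq {n : ℕ} (hn : 1 ≤ n) : ribbonSchurFunctions n =
    (fun α => ribbonSeries n (cuts α)) '' (comps IsNormalised n : Set (List ℕ)) := by
  ext f
  constructor
  · rintro ⟨lam, mu, h, hcard, rfl⟩
    obtain ⟨α, h1, h2, h3⟩ := exists_cuts n (ribbonCuts lam mu)
    have hα : IsComp α := .of_sum_pos h1 (by omega)
    obtain ⟨γ, hγ, hαγ⟩ := exists_isNormalised hα
    refine ⟨γ, mem_comps.2 ⟨hγ, hγ.isComp, hαγ.1.symm.trans h2⟩, ?_⟩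
    have h4 := hαγ.2.ribbonSeries_eq (by omega)
    rw [h2] at h4
    rw [h.skewSchur_eq, hcard]
    refine h4.symm.trans (Sim.ribbonSeries_eq ?_ (by omega))
    exact total_congr h3 _
  · rintro ⟨α, hα, rfl⟩
    obtain ⟨k, rfl⟩ := Nat.exists_eq_add_of_le' hn
    obtain ⟨lam, mu, h, hcard, hc⟩ := exists_ribbon (cuts α) k
    refine ⟨lam, mu, h, hcard, ?_⟩
    rw [h.skewSchur_eq, hcard]
    refine Sim.ribbonSeries_eq ?_ (by omega)
    exact total_congr (fun s h0 hs => (hc s h0 hs).symm) _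

theorem injOn_ribbonSeries {n : ℕ} (hn : 1 ≤ n) :
    Set.InjOn (fun α => ribbonSeries n (cuts α)) (comps IsNormalised n : Set (List ℕ)) := by
  intro α hα γ hγ h
  obtain ⟨h1, -, h3⟩ := mem_comps.1 (Finset.mem_coe.1 hα)
  obtain ⟨h1', -, h3'⟩ := mem_comps.1 (Finset.mem_coe.1 hγ)
  refine SimComp.eq_of_isNormalised ⟨h3.trans h3'.symm, ?_⟩ h1 h1'
  rw [h3]
  exact Sim.of_ribbonSeries_eq (by omega) h

/-- The number of ribbon Schur functions of size `n` is the number of normalised compositions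
of `n`. -/
theorem ncard_ribbonSchurFunctions {n : ℕ} (hn : 1 ≤ n) : (ribbonSchurFunctions n).Finite ∧
    (ribbonSchurFunctions n).ncard = numComps IsNormalised n := by
  rw [ribbonSchurFunctions_eq hn]
  refine ⟨(Finset.finite_toSet _).image _, ?_⟩
  rw [(injOn_ribbonSeries hn).ncard_image, Set.ncard_coe_finset, numComps_eq (by omega)]

end RibbonCount

theorem mainTheorem1 :
    -- the count of normalised compositions, the inverse being taken in the Dirichlet ring
    (IsUnit (RibbonCount.powPred + RibbonCount.powHalf) ∧
      ∀ n : ℕ, 1 ≤ n →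
        (RibbonCount.numComps RibbonCount.IsNormalised n : ℚ) =
          (((2 : ℚ) • RibbonCount.powPred) * RibbonCount.powHalf *
            Ring.inverse (RibbonCount.powPred + RibbonCount.powHalf)) n) ∧
    -- the identity `R = 2 C S / (C + S)` of Dirichlet generating functions
    (IsUnit (RibbonCount.dirichletGF (fun _ => True) +
        RibbonCount.dirichletGF RibbonCount.IsSymmetric) ∧
      RibbonCount.dirichletGF RibbonCount.IsNormalised =
        ((2 : ℚ) • RibbonCount.dirichletGF (fun _ => True)) *
          RibbonCount.dirichletGF RibbonCount.IsSymmetric *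
          Ring.inverse (RibbonCount.dirichletGF (fun _ => True) +
            RibbonCount.dirichletGF RibbonCount.IsSymmetric)) ∧
    -- the values of `C` and `S`, which make the two formulas the same
    (RibbonCount.dirichletGF (fun _ => True) = RibbonCount.powPred ∧
      RibbonCount.dirichletGF RibbonCount.IsSymmetric = RibbonCount.powHalf) ∧
    -- the count of distinct ribbon Schur functions
    (∀ n : ℕ, 1 ≤ n →
      (RibbonCount.ribbonSchurFunctions n).Finite ∧
        (RibbonCount.ribbonSchurFunctions n).ncard =
          RibbonCount.numComps RibbonCount.IsNormalised n) := by
  refine ⟨⟨?_, fun n hn => ?_⟩, ⟨RibbonCount.isUnit_add, RibbonCount.dirichletGF_isNormalised⟩,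
    ⟨RibbonCount.dirichletGF_true, RibbonCount.dirichletGF_isSymmetric⟩,
    fun n hn => RibbonCount.ncard_ribbonSchurFunctions hn⟩
  · rw [← RibbonCount.dirichletGF_true, ← RibbonCount.dirichletGF_isSymmetric]
    exact RibbonCount.isUnit_add
  · rw [RibbonCount.numComps_eq (by omega), ← RibbonCount.dirichletGF_apply,
      RibbonCount.dirichletGF_isNormalised, RibbonCount.dirichletGF_true,
      RibbonCount.dirichletGF_isSymmetric]
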